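/- Let $M$ be a matroid of rank $r$ on a finite totally ordered set $E$, with set of bases $\mathcal B$. **Ordered blueprints.** An ordered blueprint $B$ is a commutative ordered semiring $(B^+,\le)$ together with a multiplicative subset $B^\bullet$ that contains $0,1$ and generates $B^+$ as a semiring; $a\in B$ means $a\in B^\bullet$, and $B^\times$ is the group of invertible elements of $B^\bullet$. For a set $S$ of relations, $B/\!\!/S$ is the quotient of $B$ by the smallest preorder that contains $\le$ and $S$ and is closed under addition and multiplication, with $x,y$ identified if $x\le y\le x$. A submonoid of $B^\bullet$ containing $0$ defines a subblueprint, with the semiring it generates and the induced order. Let $\mathbb F_1=(\{0,1\},\mathbb N,=)$ and $\mathbb F_1^\pm=\{0,1,\epsilon\}/\!\!/(0\le 1+\epsilon)$, where $\epsilon^2=1$. The pasteurization $B^\pm$ is the quotient of $B\otimes_{\mathbb F_1}\mathbb F_1^\pm$ by all identifications $a\equiv a'$ for which $0\le a+b$ and $0\le a'+b$ for some $b\in B\otimes_{\mathbb F_1}\mathbb F_1^\pm$. **The weak universal pasture and the foundation.** The weak universal pasture of $M$ is $$k_M^w=\Big(\mathbb F_1^\pm[x_I^{\pm1}\mid I\in\mathcal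 B]\,/\!\!/\,\mathcal P\Big)_0^{\pm},$$ where $(-)_0$ is the subblueprint of homogeneous elements of degree $0$ (each $x_I$ having degree $1$), and $\mathcal P$ consists of the relations $$0\le x_{J\cup\{i_1,i_2\}}x_{J\cup\{i_3,i_4\}}+\epsilon\,x_{J\cup\{i_1,i_3\}}x_{J\cup\{i_2,i_4\}}+x_{J\cup\{i_1,i_4\}}x_{J\cup\{i_2,i_3\}}$$ for all $(r-2)$-subsets $J$ of $E$ and all $i_1<i_2<i_3<i_4$ in $E\setminus J$, with $x_I=0$ for $I\notin\mathcal B$. The foundation $k_M^f$ of $M$ is the subblueprint of $k_M^w$ generated by its fundamental elements, i.e. the elements $a\in k_M^w$ with $0\le a+b+\epsilon^i$ for some $b\in k_M^w$ and $i\in\{0,1\}$, where $\epsilon$ is the weak inverse of $1$ (so $0\le 1+\epsilon$). **The Tutte groups.** Let $G_M$ be the abelian group, written multiplicatively, generated by $\epsilon$ and symbols $X_{(i_1,\dots,i_r)}$ for all $(i_1,\dots,i_r)\in E^r$ with $\{i_1,\dots,i_r\}\in\mathcal B$, subject to the relations $\epsilon^2=1$; $$\epsilon^{\operatorname{sign}\sigma}X_{(i_{\sigma(1)},\dots,i_{\sigma(r)})}=X_{(i_1,\dots,i_r)}$$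 for all permutations $\sigma$ of $\{1,\dots,r\}$ (with $\operatorname{sign}\sigma=0$ for even and $1$ for odd $\sigma$); and $$X_{(i_1,\dots,i_{r-2},k_1,l_1)}X_{(i_1,\dots,i_{r-2},k_2,l_2)}=X_{(i_1,\dots,i_{r-2},k_1,l_2)}X_{(i_1,\dots,i_{r-2},k_2,l_1)}$$ whenever these four symbols are defined and $\{i_1,\dots,i_{r-2},k_1,k_2\}\notin\mathcal B$. The Tutte group $\mathbb T_M$ is the subgroup of $G_M$ generated by $\epsilon$ and all quotients $X_{(i_1,\dots,i_r)}X_{(j_1,\dots,j_r)}^{-1}$. For a basis $I=\{i_1<\dots<i_r\}$ put $X_I=X_{(i_1,\dots,i_r)}$. The homomorphism $\deg_E:\mathbb T_M\to\mathbb Z^E$ sends $\epsilon^i\prod X_I^{e_I}$ to $\sum e_I\delta_I$, where $\delta_I$ is the characteristic function of $I$; its kernel $\mathbb T_M^{(0)}$ is the inner Tutte group. **Statement.** There is a unique group isomorphism $\Phi:(k_M^w)^\times\to\mathbb T_M$ with $$\Phi\Big(\epsilon^i\prod_{I\in\mathcal B}x_I^{e_I}\Big)=\epsilon^i\prod_{I\in\mathcal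 B}X_I^{e_I}$$ for all $i\in\mathbb N$ and $e_I\in\mathbb Z$ with $\sum_{I}e_I=0$, and $\Phi$ restricts to an isomorphism $(k_M^f)^\times\to\mathbb T_M^{(0)}$. -/

import Mathlib

/-!
# Ordered blueprints, the weak universal pasture and the foundation of a matroid, the Tutte group
-/

noncomputable section

universe u

/-! ## Ordered blueprints -/

/-- An ordered blueprint `B = (B^•, B^+, ≤)`: an ordered semiring `B^+` (the field `Amb`) together
with a multiplicative subset `B^•` (the field `points`) containing `0` and `1` that generates `B^+`
as a semiring. -/
structure OrderedBlueprint where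
  Amb : Type u
  [semiring : CommSemiring Amb]
  [order : PartialOrder Amb]
  add_le : ∀ {x y z t : Amb}, x ≤ y → z ≤ t → x + z ≤ y + t
  mul_le : ∀ {x y z t : Amb}, x ≤ y → z ≤ t → x * z ≤ y * t
  points : Submonoid Amb
  zero_mem : (0 : Amb) ∈ points
  closure_points : Subsemiring.closure (points : Set Amb) = ⊤

namespace OrderedBlueprint

attribute [instance] OrderedBlueprint.semiring OrderedBlueprint.order

/-- The unit group `B^×`: the multiplicatively invertible elements of the underlying monoid. -/
abbrev UnitGroup (B : OrderedBlueprint.{u}) : Type u := (B.points)ˣ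

/-- A semiring with a generating multiplicative subset, with equality as partial order. -/
def trivialOrder (R : Type u) [CommSemiring R] (A : Submonoid R) (h0 : (0 : R) ∈ A)
    (hA : Subsemiring.closure (A : Set R) = ⊤) : OrderedBlueprint.{u} where
  Amb := R
  order :=
    { le := fun x y => x = y
      le_refl := fun _ => rfl
      le_trans := fun _ _ _ h h' => Eq.trans h h'
      le_antisymm := fun _ _ h _ => h }
  add_le := fun {x y z t} (h : x = y) (h' : z = t) => show x + z = y + t by rw [h, h']
  mul_le := fun {x y z t} (h : x = y) (h' : z = t) => show x * z = y * t by rw [h, h']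
  points := A
  zero_mem := h0
  closure_points := hA

/-! ### Quotients by relations -/

section Quotient

variable (B : OrderedBlueprint.{u}) (S : Set (B.Amb × B.Amb))

/-- The smallest preorder on `B^+` that contains the partial order of `B` and the relations `x ≤ y`
for `(x, y) ∈ S`, and that is closed under addition and multiplication. -/
inductive GenLE : B.Amb → B.Amb → Prop
  | of_le {x y : B.Amb} : x ≤ y → GenLE x y
  | of_mem {x y : B.Amb} : (x, y) ∈ S → GenLE x y
  | trans {x y z : B.Amb} : GenLE x y → GenLE y z → GenLE x z
  | add {x y z t : B.Amb} : GenLE x y → GenLE z t → GenLE (x + z) (y + t)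
  | mul {x y z t : B.Amb} : GenLE x y → GenLE z t → GenLE (x * z) (y * t)

/-- The congruence `x ≡ y`, i.e. `x ≤ y` and `y ≤ x` for the generated preorder. -/
def genCon : RingCon B.Amb where
  r x y := B.GenLE S x y ∧ B.GenLE S y x
  iseqv :=
    { refl := fun _ => ⟨.of_le le_rfl, .of_le le_rfl⟩
      symm := fun h => ⟨h.2, h.1⟩
      trans := fun h h' => ⟨.trans h.1 h'.1, .trans h'.2 h.2⟩ }
  add' := fun h h' => ⟨.add h.1 h'.1, .add h.2 h'.2⟩
  mul' := fun h h' => ⟨.mul h.1 h'.1, .mul h.2 h'.2⟩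

/-- The partial order on the quotient semiring that is induced by the generated preorder. -/
abbrev genOrder : PartialOrder (B.genCon S).Quotient where
  le a b := Quotient.liftOn₂' a b (fun x y => B.GenLE S x y) (by
    intro x y x' y' hx hy
    exact propext ⟨fun h => .trans (.trans hx.2 h) hy.1, fun h => .trans (.trans hx.1 h) hy.2⟩)
  le_refl a := by
    induction a using Quotient.inductionOn'
    exact GenLE.of_le le_rfl
  le_trans a b c := by
    induction a using Quotient.inductionOn'
    induction b using Quotient.inductionOn'
    induction c using Quotient.inductionOn'
    exact fun h h' => GenLE.trans h h'
  le_antisymm a b := by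
    induction a using Quotient.inductionOn'
    induction b using Quotient.inductionOn'
    exact fun h h' => Quotient.sound' ⟨h, h'⟩

/-- The quotient `B // S` of an ordered blueprint by a set `S` of relations `x ≤ y`. -/
def quot : OrderedBlueprint.{u} where
  Amb := (B.genCon S).Quotient
  semiring := inferInstance
  order := B.genOrder S
  add_le {x y z t} := by
    induction x using Quotient.inductionOn'
    induction y using Quotient.inductionOn'
    induction z using Quotient.inductionOn'
    induction t using Quotient.inductionOn'
    exact fun h h' => GenLE.add h h'
  mul_le {x y z t} := by
    induction x using Quotient.inductionOn'
    induction y using Quotient.inductionOn'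
    induction z using Quotient.inductionOn'
    induction t using Quotient.inductionOn'
    exact fun h h' => GenLE.mul h h'
  points := B.points.map (B.genCon S).mk'
  zero_mem := ⟨0, B.zero_mem, map_zero _⟩
  closure_points := by
    rw [Submonoid.coe_map]
    have := RingHom.map_closureS (B.genCon S).mk' (B.points : Set B.Amb)
    rw [B.closure_points] at this
    refine Eq.trans this.symm ?_
    rw [← RingHom.rangeS_eq_map]
    exact RingHom.rangeS_top_of_surjective _ (RingCon.mk'_surjective _)

/-- The quotient map `B^+ → (B // S)^+`. -/
def toQuot : B.Amb →+* (B.quot S).Amb := (B.genCon S).mk'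

/-- The quotient map `B^• → (B // S)^•`. -/
def toQuotPoints : B.points →* (B.quot S).points :=
  ((B.toQuot S : B.Amb →* (B.quot S).Amb).comp B.points.subtype).codRestrict _
    fun a => ⟨a.1, a.2, rfl⟩

end Quotient

/-! ### Subblueprints -/

section Sub

variable (B : OrderedBlueprint.{u}) (C : Submonoid B.Amb) (h0 : (0 : B.Amb) ∈ C)

/-- The subblueprint with underlying monoid `C ⊆ B^•`: its ambient semiring is the subsemiring
generated by `C` and its partial order is the restriction of the partial order of `B`. -/
def sub : OrderedBlueprint.{u} where
  Amb := Subsemiring.closure (C : Set B.Amb)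
  add_le := fun {x y z t} h h' =>
    show (x : B.Amb) + (z : B.Amb) ≤ (y : B.Amb) + (t : B.Amb) from B.add_le h h'
  mul_le := fun {x y z t} h h' =>
    show (x : B.Amb) * (z : B.Amb) ≤ (y : B.Amb) * (t : B.Amb) from B.mul_le h h'
  points := C.comap (Subsemiring.closure (C : Set B.Amb)).subtype
  zero_mem := h0
  closure_points := by
    rw [eq_top_iff]
    rintro ⟨x, hx⟩ -
    induction hx using Subsemiring.closure_induction with
    | mem x hx => exact Subsemiring.subset_closure hx
    | zero => exact Subsemiring.zero_mem _
    | one => exact Subsemiring.one_mem _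
    | add x y hx hy h h' => exact Subsemiring.add_mem _ h h'
    | mul x y hx hy h h' => exact Subsemiring.mul_mem _ h h'

/-- An element of the submonoid `C`, seen as an element of the subblueprint. -/
def toSubPoints : C →* (B.sub C h0).points where
  toFun a := ⟨⟨a.1, Subsemiring.subset_closure a.2⟩, a.2⟩
  map_one' := rfl
  map_mul' _ _ := rfl

/-- The inclusion of the underlying monoid of a subblueprint. -/
def subInclusion (hC : C ≤ B.points) : (B.sub C h0).points →* B.points where
  toFun a := ⟨a.1.1, hC a.2⟩
  map_one' := rfl
  map_mul' _ _ := rfl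

end Sub

/-! ### Pasteurization -/

section Pasteurization

variable (B : OrderedBlueprint.{u})

/-- The underlying monoid of `B ⊗ 𝔽₁^±`: all `a ⊗ 1` and `a ⊗ ε` with `a ∈ B^•`, where
`(B ⊗ 𝔽₁^±)^+ = B^+ ⊗ ℕ[{1, ε}]` is the monoid semiring `B^+[{1, ε}]`. The group `{1, ε}` is
`ℤˣ`, with `ε = -1`. -/
def tensorPoints : Submonoid (MonoidAlgebra B.Amb ℤˣ) where
  carrier := {x | ∃ a ∈ B.points, ∃ s : ℤˣ, x = MonoidAlgebra.single s a}
  one_mem' := ⟨1, B.points.one_mem, 1, rfl⟩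
  mul_mem' := by
    rintro _ _ ⟨a, ha, s, rfl⟩ ⟨b, hb, t, rfl⟩
    exact ⟨a * b, B.points.mul_mem ha hb, s * t, MonoidAlgebra.single_mul_single ..⟩

/-- The tensor product `B ⊗ 𝔽₁^±` over `𝔽₁`, where `𝔽₁^± = {0, 1, ε} // (0 ≤ 1 + ε)`. Its order is
generated by the relations `x ⊗ 1 ≤ y ⊗ 1` for `x ≤ y` in `B`, and by `0 ≤ 1 ⊗ 1 + 1 ⊗ ε`. -/
def tensorF1pm : OrderedBlueprint.{u} :=
  (trivialOrder (MonoidAlgebra B.Amb ℤˣ) B.tensorPoints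
    ⟨0, B.zero_mem, 1, by simp⟩ (by
      rw [eq_top_iff]
      rintro x -
      have key : ∀ (s : ℤˣ) (a : B.Amb), MonoidAlgebra.single s a ∈
          Subsemiring.closure (B.tensorPoints : Set (MonoidAlgebra B.Amb ℤˣ)) := by
        intro s a
        have ha : a ∈ Subsemiring.closure (B.points : Set B.Amb) := by
          rw [B.closure_points]; trivial
        induction ha using Subsemiring.closure_induction with
        | mem a ha => exact Subsemiring.subset_closure ⟨a, ha, s, rfl⟩
        | zero => simp
        | one => exact Subsemiring.subset_closure ⟨1, B.points.one_mem, s, rfl⟩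
        | add a b _ _ h h' => rw [MonoidAlgebra.single_add]; exact add_mem h h'
        | mul a b ha' hb' h h' =>
          have h1 : ∀ c ∈ Subsemiring.closure (B.points : Set B.Amb),
              MonoidAlgebra.single (1 : ℤˣ) c ∈
              Subsemiring.closure (B.tensorPoints : Set (MonoidAlgebra B.Amb ℤˣ)) := by
            intro c hc
            induction hc using Subsemiring.closure_induction with
            | mem a ha => exact Subsemiring.subset_closure ⟨a, ha, 1, rfl⟩
            | zero => simp
            | one => exact one_mem _
            | add a b _ _ h h' => rw [MonoidAlgebra.single_add]; exact add_mem h h'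
            | mul a b _ _ h h' =>
              have := mul_mem h h'
              rwa [MonoidAlgebra.single_mul_single, one_mul] at this
          have := mul_mem h (h1 b hb')
          rwa [MonoidAlgebra.single_mul_single, mul_one] at this
      induction x using MonoidAlgebra.induction_linear with
      | zero => exact Subsemiring.zero_mem _
      | add f g hf hg => exact add_mem hf hg
      | single s a => exact key s a)).quot
    ({p | ∃ x y : B.Amb, x ≤ y ∧
        p = (MonoidAlgebra.single (1 : ℤˣ) x, MonoidAlgebra.single (1 : ℤˣ) y)} ∪
      {((0 : MonoidAlgebra B.Amb ℤˣ),
        MonoidAlgebra.single (1 : ℤˣ) 1 + MonoidAlgebra.single (-1 : ℤˣ) 1)})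

/-- The map `B^• → (B ⊗ 𝔽₁^±)^•`, `a ↦ a ⊗ 1`. -/
def toTensorF1pm : B.points →* B.tensorF1pm.points :=
  (toQuotPoints _ _).comp
    { toFun := fun a => ⟨MonoidAlgebra.single (1 : ℤˣ) a.1, a.1, a.2, 1, rfl⟩
      map_one' := rfl
      map_mul' := fun a b => Subtype.ext (by
        change MonoidAlgebra.single (1 : ℤˣ) (a.1 * b.1) =
          MonoidAlgebra.single (1 : ℤˣ) a.1 * MonoidAlgebra.single (1 : ℤˣ) b.1
        rw [MonoidAlgebra.single_mul_single, one_mul]) }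

/-- The relations `a ≡ a'` for all `a, a' ∈ B` that have a common weak inverse `b ∈ B`. They are
symmetric in `a` and `a'`, so listing `a ≤ a'` for all such pairs gives both inequalities. -/
def commonWeakInverse : Set (B.Amb × B.Amb) :=
  {p | p.1 ∈ B.points ∧ p.2 ∈ B.points ∧ ∃ b ∈ B.points, 0 ≤ p.1 + b ∧ 0 ≤ p.2 + b}

/-- The pasteurization `B^± = B ⊗ 𝔽₁^± // ⟨a ≡ a' | 0 ≤ a + b and 0 ≤ a' + b for some b⟩`. -/
def pasteurization : OrderedBlueprint.{u} :=
  B.tensorF1pm.quot B.tensorF1pm.commonWeakInverse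

/-- The canonical map `B^• → (B^±)^•`. -/
def toPasteurization : B.points →* B.pasteurization.points :=
  (toQuotPoints _ _).comp B.toTensorF1pm

end Pasteurization

/-! ### Foundations -/

section Foundation

variable (B : OrderedBlueprint.{u})

/-- `a ∈ B` is a fundamental element if `0 ≤ a + b + ε ^ i` for some `b ∈ B` and `i ∈ {0, 1}`, where
`ε ∈ B` is the weak inverse of `1` (which is unique if `B` is pasteurized). -/
def IsFundamental (a : B.Amb) : Prop :=
  a ∈ B.points ∧ ∃ ε ∈ B.points, 0 ≤ 1 + ε ∧
    ∃ b ∈ B.points, ∃ i : ℕ, i ≤ 1 ∧ 0 ≤ a + b + ε ^ i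

/-- The submonoid of `B^•` generated by the fundamental elements. (In a pasteurized ordered
blueprint, `0` is a fundamental element; it is listed so that the definition makes sense for all
ordered blueprints.) -/
def foundationPoints : Submonoid B.Amb :=
  Submonoid.closure ({0} ∪ {a | B.IsFundamental a})

theorem zero_mem_foundationPoints : (0 : B.Amb) ∈ B.foundationPoints :=
  Submonoid.subset_closure (Or.inl rfl)

theorem foundationPoints_le : B.foundationPoints ≤ B.points := by
  refine Submonoid.closure_le.mpr ?_
  rintro a (rfl | ha)
  · exact B.zero_mem
  · exact ha.1

/-- The foundation of `B`: the subblueprint generated by the fundamental elements. -/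
def foundation : OrderedBlueprint.{u} :=
  B.sub B.foundationPoints B.zero_mem_foundationPoints

/-- The inclusion of unit groups `(B^found)^× → B^×`. -/
def foundationUnitsInclusion : B.foundation.UnitGroup →* B.UnitGroup :=
  Units.map (B.subInclusion _ _ B.foundationPoints_le)

end Foundation

/-! ### The ordered blueprint of a group -/

section Group

variable (G : Type u) [CommGroup G]

/-- The monoid with zero `G ∪ {0}` inside the group semiring `ℕ[G]`. -/
def groupPoints : Submonoid (MonoidAlgebra ℕ G) where
  carrier := {x | x = 0 ∨ ∃ g : G, x = MonoidAlgebra.single g 1}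
  one_mem' := Or.inr ⟨1, rfl⟩
  mul_mem' := by
    rintro _ _ (rfl | ⟨g, rfl⟩) (rfl | ⟨h, rfl⟩)
    · left; simp
    · left; simp
    · left; simp
    · right; exact ⟨g * h, by rw [MonoidAlgebra.single_mul_single, one_mul]⟩

/-- The ordered blueprint `(G ∪ {0}, ℕ[G], =)`. -/
def ofGroup : OrderedBlueprint.{u} :=
  trivialOrder (MonoidAlgebra ℕ G) (groupPoints G) (Or.inl rfl) (by
    rw [eq_top_iff]
    rintro x -
    induction x using MonoidAlgebra.induction_linear with
    | zero => exact Subsemiring.zero_mem _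
    | add f g hf hg => exact add_mem hf hg
    | single g n =>
      have h1 : MonoidAlgebra.single g (1 : ℕ) ∈
          Subsemiring.closure (groupPoints G : Set (MonoidAlgebra ℕ G)) :=
        Subsemiring.subset_closure (Or.inr ⟨g, rfl⟩)
      have := nsmul_mem h1 n
      rwa [MonoidAlgebra.smul_single, smul_eq_mul, mul_one] at this)

/-- The inclusion `G → G ∪ {0}`. -/
def toOfGroup : G →* (ofGroup G).points where
  toFun g := ⟨MonoidAlgebra.single g (1 : ℕ), Or.inr ⟨g, rfl⟩⟩
  map_one' := rfl
  map_mul' g h := Subtype.ext (by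
    change MonoidAlgebra.single (g * h) (1 : ℕ) =
      MonoidAlgebra.single g (1 : ℕ) * MonoidAlgebra.single h (1 : ℕ)
    rw [MonoidAlgebra.single_mul_single, one_mul])

end Group

end OrderedBlueprint

/-! ## Matroids -/

namespace Matroid

/-- The set of bases of `M`. -/
abbrev Bases {E : Type u} (M : Matroid E) : Type u := {I : Finset E // M.IsBase (I : Set E)}

/-- The rank of `M` as a natural number. -/
def rk {E : Type u} (M : Matroid E) : ℕ := M.eRank.toNat

theorem card_eq_rk {E : Type u} (M : Matroid E) (I : M.Bases) : I.1.card = M.rk := by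
  rw [rk, ← I.2.encard_eq_eRank, Set.encard_coe_eq_coe_finsetCard]
  rfl

variable {E : Type u} [LinearOrder E] (M : Matroid E)

/-! ### The weak universal pasture -/

/-- The group of Laurent monomials `ε ^ i * ∏ x_I ^ e_I` with `I` running through the bases of `M`
and `ε ^ 2 = 1`. The first factor is `{1, ε}`, with `ε = -1`; the second factor is the free abelian
group generated by the `x_I`. -/
abbrev MonomialGroup : Type u := ℤˣ × Multiplicative (M.Bases →₀ ℤ)

/-- The element `ε` of `ℕ[MonomialGroup]`. -/
def plEps : MonoidAlgebra ℕ M.MonomialGroup := MonoidAlgebra.single (-1, 1) 1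

open Classical in
/-- The variable `x_I` as an element of `ℕ[MonomialGroup]`; it is `0` if `I` is not a basis. -/
def plVar (I : Finset E) : MonoidAlgebra ℕ M.MonomialGroup :=
  if h : M.IsBase (I : Set E) then
    MonoidAlgebra.single (1, Multiplicative.ofAdd (Finsupp.single ⟨I, h⟩ 1)) 1
  else 0

/-- The `3`-term Plücker relations
`0 ≤ x_{I,1,2} x_{I,3,4} + ε x_{I,1,3} x_{I,2,4} + x_{I,1,4} x_{I,2,3}`. -/
def threeTermPluecker :
    Set (MonoidAlgebra ℕ M.MonomialGroup × MonoidAlgebra ℕ M.MonomialGroup) :=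
  {p | ∃ (I : Finset E) (i₁ i₂ i₃ i₄ : E), I.card + 2 = M.rk ∧
    i₁ < i₂ ∧ i₂ < i₃ ∧ i₃ < i₄ ∧ i₁ ∉ I ∧ i₂ ∉ I ∧ i₃ ∉ I ∧ i₄ ∉ I ∧
    p = (0, M.plVar (I ∪ {i₁, i₂}) * M.plVar (I ∪ {i₃, i₄}) +
      M.plEps * (M.plVar (I ∪ {i₁, i₃}) * M.plVar (I ∪ {i₂, i₄})) +
      M.plVar (I ∪ {i₁, i₄}) * M.plVar (I ∪ {i₂, i₃}))}

/-- The graded ordered blueprint `𝔽₁^±[x_I^{±1} | I basis of M] // (3-term Plücker relations)`. -/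
def plueckerBlueprint : OrderedBlueprint.{u} :=
  (OrderedBlueprint.ofGroup M.MonomialGroup).quot
    ({((0 : MonoidAlgebra ℕ M.MonomialGroup), 1 + M.plEps)} ∪ M.threeTermPluecker)

/-- The canonical map from Laurent monomials. -/
def monomialToPluecker : M.MonomialGroup →* M.plueckerBlueprint.points :=
  (OrderedBlueprint.toQuotPoints _ _).comp (OrderedBlueprint.toOfGroup _)

/-- The subgroup of Laurent monomials `ε ^ i * ∏ x_I ^ e_I` of degree `∑ e_I = 0`. -/
def degreeZero : Subgroup M.MonomialGroup where
  carrier := {m | (Multiplicative.toAdd m.2).sum (fun _ n => n) = 0}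
  one_mem' := Finsupp.sum_zero_index
  mul_mem' {a b} ha hb := by
    change (Multiplicative.toAdd a.2 + Multiplicative.toAdd b.2).sum (fun _ n => n) = 0
    rw [Finsupp.sum_add_index' (fun _ => rfl) (fun _ _ _ => rfl)]
    exact (congrArg₂ (· + ·) ha hb).trans (add_zero 0)
  inv_mem' {a} ha := by
    change (-Multiplicative.toAdd a.2).sum (fun _ n => n) = 0
    rw [Finsupp.sum_neg_index (fun _ => rfl), Finsupp.sum_neg]
    exact neg_eq_zero.mpr ha

/-- The homogeneous elements of degree `0` (including `0`) of the graded ordered blueprint. -/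
def degreeZeroPoints : Submonoid M.plueckerBlueprint.Amb where
  carrier := {x | x = 0 ∨ ∃ m ∈ M.degreeZero, x = (M.monomialToPluecker m).1}
  one_mem' := Or.inr ⟨1, one_mem _, by rw [map_one]; rfl⟩
  mul_mem' := by
    rintro _ _ (rfl | ⟨m, hm, rfl⟩) (rfl | ⟨n, hn, rfl⟩)
    · left; simp
    · left; simp
    · left; simp
    · right; exact ⟨m * n, mul_mem hm hn, by rw [map_mul]; rfl⟩

/-- The residue field of the weak matroid space at the weak support of `M`:
`(𝔽₁^±[x_I^{±1} | I basis of M] // (3-term Plücker relations))_0`. -/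
def weakResidueField : OrderedBlueprint.{u} :=
  M.plueckerBlueprint.sub M.degreeZeroPoints (Or.inl rfl)

/-- The weak universal pasture `k_M^w`: the pasteurization of the residue field. -/
def weakUniversalPasture : OrderedBlueprint.{u} := M.weakResidueField.pasteurization

/-- The foundation `k_M^f` of `M`. -/
def foundation : OrderedBlueprint.{u} := M.weakUniversalPasture.foundation

/-- The class of a Laurent monomial of degree `0` in the unit group of `k_M^w`. -/
def monomialClass : M.degreeZero →* M.weakUniversalPasture.UnitGroup :=
  MonoidHom.toHomUnits
    ((M.weakResidueField.toPasteurization.comp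
      (M.plueckerBlueprint.toSubPoints M.degreeZeroPoints (Or.inl rfl))).comp
      { toFun := fun m => ⟨(M.monomialToPluecker m.1).1, Or.inr ⟨m.1, m.2, rfl⟩⟩
        map_one' := Subtype.ext (by
          change (M.monomialToPluecker 1).1 = _
          rw [map_one]; rfl)
        map_mul' := fun m n => Subtype.ext (by
          change (M.monomialToPluecker (m.1 * n.1)).1 = _
          rw [map_mul]; rfl) })

/-- The unit `ε ^ i * ∏ x_I ^ e_I` of `k_M^w`, where `∑ e_I = 0`. -/
def unitMonomial (i : ℕ) (e : M.Bases →₀ ℤ) (he : e.sum (fun _ n => n) = 0) :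
    M.weakUniversalPasture.UnitGroup :=
  M.monomialClass ⟨((-1) ^ i, Multiplicative.ofAdd e), he⟩

/-! ### The Tutte group -/

/-- The symbols `ε` and `X_{(i_1, …, i_r)}` with `{i_1, …, i_r}` a basis of `M`. -/
inductive TutteSymbol : Type u
  | eps : TutteSymbol
  | X (i : Fin M.rk → E) (hi : M.IsBase (Set.range i)) : TutteSymbol

/-- The free abelian group generated by the symbols, written multiplicatively. -/
abbrev TutteFree : Type u := Multiplicative (FreeAbelianGroup M.TutteSymbol)

/-- The generator `ε`. -/
def freeEps : M.TutteFree := Multiplicative.ofAdd (FreeAbelianGroup.of .eps)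

/-- The generator `X_{(i_1, …, i_r)}`. -/
def freeX (i : Fin M.rk → E) (hi : M.IsBase (Set.range i)) : M.TutteFree :=
  Multiplicative.ofAdd (FreeAbelianGroup.of (.X i hi))

/-- The exponent `sign σ` in `ε ^ sign σ`: `0` if `σ` is even, and `1` if `σ` is odd. -/
def signExponent {n : ℕ} (σ : Equiv.Perm (Fin n)) : ℕ := if Equiv.Perm.sign σ = 1 then 0 else 1

/-- The tuple `(i_1, …, i_{r-2}, k, l)`. -/
def tupleSnoc {s : ℕ} (h : s + 2 = M.rk) (J : Fin s → E) (k l : E) : Fin M.rk → E :=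
  Fin.append J ![k, l] ∘ Fin.cast h.symm

/-- The defining relations of `G_M`. -/
inductive TutteRel : M.TutteFree → Prop
  | eps_sq : TutteRel (M.freeEps ^ 2)
  | perm (σ : Equiv.Perm (Fin M.rk)) (i : Fin M.rk → E) (hi : M.IsBase (Set.range i))
      (hσ : M.IsBase (Set.range (i ∘ σ))) :
      TutteRel (M.freeEps ^ signExponent σ * M.freeX (i ∘ σ) hσ * (M.freeX i hi)⁻¹)
  | exchange {s : ℕ} (h : s + 2 = M.rk) (J : Fin s → E) (k₁ k₂ l₁ l₂ : E)
      (h₁₁ : M.IsBase (Set.range (M.tupleSnoc h J k₁ l₁)))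
      (h₂₂ : M.IsBase (Set.range (M.tupleSnoc h J k₂ l₂)))
      (h₁₂ : M.IsBase (Set.range (M.tupleSnoc h J k₁ l₂)))
      (h₂₁ : M.IsBase (Set.range (M.tupleSnoc h J k₂ l₁)))
      (hk : ¬ M.IsBase (Set.range J ∪ {k₁, k₂})) :
      TutteRel (M.freeX _ h₁₁ * M.freeX _ h₂₂ * (M.freeX _ h₁₂)⁻¹ * (M.freeX _ h₂₁)⁻¹)

/-- The group `G_M`. -/
abbrev TutteG : Type u := M.TutteFree ⧸ Subgroup.closure {g | M.TutteRel g}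

/-- The element `ε` of `G_M`. -/
def tutteEps : M.TutteG := QuotientGroup.mk M.freeEps

/-- The element `X_{(i_1, …, i_r)}` of `G_M`. -/
def tutteX (i : Fin M.rk → E) (hi : M.IsBase (Set.range i)) : M.TutteG :=
  QuotientGroup.mk (M.freeX i hi)

/-- The element `X_I = X_{(i_1, …, i_r)}` of `G_M`, for a basis `I = {i_1, …, i_r}` with
`i_1 < … < i_r`. -/
def tutteXBasis (I : M.Bases) : M.TutteG :=
  M.tutteX (I.1.orderEmbOfFin (M.card_eq_rk I)) (by
    rw [Finset.range_orderEmbOfFin]; exact I.2)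

/-- The Tutte group `𝕋_M`: the subgroup of `G_M` generated by `ε` and the quotients
`X_{(i_1, …, i_r)} X_{(j_1, …, j_r)}⁻¹`. -/
def tutteGroup : Subgroup M.TutteG :=
  Subgroup.closure ({M.tutteEps} ∪
    {g | ∃ i hi j hj, g = M.tutteX i hi * (M.tutteX j hj)⁻¹})

/-! ### The inner Tutte group -/

/-- The homomorphism from the free abelian group to `ℤ^E` with `ε ↦ 0` and
`X_{(i_1, …, i_r)} ↦ δ_{i_1} + … + δ_{i_r}`. Since `i_1, …, i_r` are pairwise distinct, this sum is
the characteristic function of `{i_1, …, i_r}`; see `degG_tutteXBasis`. -/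
def degFree : M.TutteFree →* Multiplicative (E → ℤ) :=
  AddMonoidHom.toMultiplicative (FreeAbelianGroup.lift fun x => match x with
    | .eps => 0
    | .X i _ => ∑ j, Pi.single (i j) 1)

theorem degFree_eps : M.degFree M.freeEps = 1 := by
  simp [degFree, freeEps]

theorem degFree_X (i : Fin M.rk → E) (hi : M.IsBase (Set.range i)) :
    M.degFree (M.freeX i hi) = Multiplicative.ofAdd (∑ j, Pi.single (i j) 1) := by
  simp [degFree, freeX]

theorem sum_tupleSnoc {s : ℕ} (h : s + 2 = M.rk) (J : Fin s → E) (k l : E) :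
    (∑ j, Pi.single (M.tupleSnoc h J k l j) 1 : E → ℤ) =
      ∑ j, Pi.single (J j) 1 + (Pi.single k 1 + Pi.single l 1) := by
  have h1 := Equiv.sum_comp (finCongr h.symm)
    (fun j => (Pi.single (Fin.append J ![k, l] j) 1 : E → ℤ))
  refine Eq.trans h1 ?_
  rw [Fin.sum_univ_add]
  simp

theorem degFree_rel {g : M.TutteFree} (hg : M.TutteRel g) : M.degFree g = 1 := by
  cases hg with
  | eps_sq => rw [map_pow, degFree_eps, one_pow]
  | perm σ i hi hσ =>
    rw [map_mul, map_mul, map_pow, degFree_eps, one_pow, one_mul, map_inv, degFree_X, degFree_X,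
      mul_inv_eq_one]
    exact congrArg Multiplicative.ofAdd
      (Equiv.sum_comp σ (fun j => (Pi.single (i j) 1 : E → ℤ)))
  | exchange h J k₁ k₂ l₁ l₂ h₁₁ h₂₂ h₁₂ h₂₁ hk =>
    simp only [map_mul, map_inv, degFree_X, sum_tupleSnoc, ← ofAdd_add, ← ofAdd_neg]
    rw [ofAdd_eq_one]
    abel

/-- The homomorphism `G_M → ℤ^E` with `ε ↦ 0` and `X_{(i_1, …, i_r)} ↦ δ_{i_1} + … + δ_{i_r}`. -/
def degG : M.TutteG →* Multiplicative (E → ℤ) :=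
  QuotientGroup.lift _ M.degFree
    ((Subgroup.closure_le _).mpr fun _ hg => M.degFree_rel hg)

/-- The homomorphism `deg_E : 𝕋_M → ℤ^E`. -/
def degE : M.tutteGroup →* Multiplicative (E → ℤ) := M.degG.comp M.tutteGroup.subtype

theorem degG_tutteEps : M.degG M.tutteEps = 1 := M.degFree_eps

/-- `deg_E` is computed from `X_I ↦ δ_I`, the characteristic function of the basis `I`. -/
theorem degG_tutteXBasis (I : M.Bases) :
    M.degG (M.tutteXBasis I) = Multiplicative.ofAdd (Set.indicator (I.1 : Set E) 1) := by
  refine (M.degFree_X _ _).trans (congrArg Multiplicative.ofAdd ?_)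
  have h1 : ∑ a ∈ I.1, (Pi.single a 1 : E → ℤ) =
      ∑ j, Pi.single (I.1.orderEmbOfFin (M.card_eq_rk I) j) 1 := by
    conv_lhs => rw [← Finset.image_orderEmbOfFin_univ I.1 (M.card_eq_rk I)]
    rw [Finset.sum_image (fun a _ b _ hab => (I.1.orderEmbOfFin _).injective hab)]
  rw [← h1]
  ext x
  by_cases hx : x ∈ I.1 <;> simp [Finset.sum_apply, Pi.single_apply, Set.indicator, hx]

/-- The inner Tutte group `𝕋_M^{(0)}`: the kernel of `deg_E`. -/
def innerTutteGroup : Subgroup M.tutteGroup := M.degE.ker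

end Matroid

end

/-! Both unit groups are described by Laurent monomials `ε ^ i * ∏ x_I ^ e_I` of degree `0`, and the
isomorphism holds because the two sides impose the same relations on them. A `3`-term Plücker
relation constrains units directly only when exactly two of its three products survive; uniqueness
of weak inverses in the pasteurization then turns it into a monomial equation. Up to the signs from
sorting tuples, these equations are the exchange relations of `G_M` (`IsPluecker.isExchange`,
`IsExchange.isPluecker`). Exactly one surviving product never occurs, by basis exchange
(`IsFinBase.exchange_pair`).

This gives a homomorphism `tutteToPasture` from `G_M` to the units of `k_M^w`. It has to be shown
that the order imposes no further identities and that `0` is not a unit. For this `k_M^w` is mapped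
to an explicit blueprint over `ℕ[G_M]` (`pastureHom`), whose null set `nullIdeal` consists of the
formal sums that satisfy two conditions. First, they are `0`, or `g + ε g`, or have at least three
terms; so weak inverses in the target are unique and pasteurizing identifies nothing. Second, no
degree in `ℤ^E` occurs exactly once. Since `pastureHom` sends the class of a monomial to its image
in `G_M`, a monomial that is trivial in `k_M^w` is trivial in `G_M`.

For the foundation, the second condition forces the nonzero fundamental elements to have degree `0`:
in a null sum `a + b + ε ^ i`, a degree different from that of `ε ^ i` could not be repeated
consistently. Conversely, whenever two products in a Plücker relation are nonzero, their ratio up to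
`ε` is fundamental, whatever the third product is. Hence modulo the units of the foundation `I ↦
x_I` is multiplicative on every square of bases. The combinatorial core is
`IsSquareMul.exists_eq_prod`: on a finite ground set such a function has the form `I ↦ c * ∏ a ∈ I,
u a`. Modulo the foundation the class of a monomial therefore depends only on its total degree and
on `deg_E`, so the kernel of `deg_E` lies in the foundation. -/

namespace Matroid

/-! ### Exchange of pairs and pivoting in the fundamental graph of a base -/

section Exchange

variable {E : Type*} {M : Matroid E}

/-- A finite set is a base. -/
def IsFinBase (M : Matroid E) (I : Finset E) : Prop := M.IsBase (I : Set E)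

theorem IsFinBase.card_eq {B D : Finset E} (hB : M.IsFinBase B) (hD : M.IsFinBase D) :
    B.card = D.card := by
  have := IsBase.ncard_eq_ncard_of_isBase hB hD
  simpa [Set.ncard_coe_finset] using this

variable [DecidableEq E]

theorem IsFinBase.exchange {B D : Finset E} (hB : M.IsFinBase B) (hD : M.IsFinBase D) {s : E}
    (hs : s ∈ B) (hs' : s ∉ D) : ∃ e ∈ D, e ∉ B ∧ M.IsFinBase (insert e (B.erase s)) := by
  obtain ⟨e, he, h⟩ := IsBase.exchange hB hD (e := s) ⟨by simpa using hs, by simpa using hs'⟩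
  refine ⟨e, by simpa using he.1, by simpa using he.2, ?_⟩
  simpa [IsFinBase] using h

/-- Exchanging one element of a pair against the other base shows that its partner completes `J`
together with one of the two elements of the other pair. So the bipartite graph between `{a, b}` and
`{c, d}` has no isolated vertex, and with two vertices on each side this forces a perfect matching.
-/
theorem IsFinBase.exchange_pair {J : Finset E} {a b c d : E}
    (hab : M.IsFinBase (insert a (insert b J))) (hcd : M.IsFinBase (insert c (insert d J)))
    (h₁ : a ≠ b) (h₂ : a ≠ c) (h₃ : a ≠ d) (h₄ : b ≠ c) (h₅ : b ≠ d) (h₆ : c ≠ d)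
    (ha : a ∉ J) (hb : b ∉ J) (hc : c ∉ J) (hd : d ∉ J) :
    (M.IsFinBase (insert a (insert c J)) ∧ M.IsFinBase (insert b (insert d J))) ∨
      (M.IsFinBase (insert a (insert d J)) ∧ M.IsFinBase (insert b (insert c J))) := by
  have key : ∀ {p q u v : E}, M.IsFinBase (insert p (insert q J)) →
      M.IsFinBase (insert u (insert v J)) → p ≠ q → p ≠ u → p ≠ v → p ∉ J →
      M.IsFinBase (insert q (insert u J)) ∨ M.IsFinBase (insert q (insert v J)) := by
    intro p q u v hpq huv h1 h2 h3 hp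
    obtain ⟨e, he, he', h⟩ := hpq.exchange huv (s := p) (by simp) (by simp [h2, h3, hp])
    have h4 : insert e ((insert p (insert q J)).erase p) = insert q (insert e J) := by
      rw [Finset.erase_insert (by simp [h1, hp]), Finset.insert_comm]
    rw [h4] at h
    have : e = u ∨ e = v := by grind
    rcases this with rfl | rfl
    · exact .inl h
    · exact .inr h
  have k1 := key hab hcd h₁ h₂ h₃ ha
  have k2 := key (Finset.insert_comm a b J ▸ hab) hcd h₁.symm h₄ h₅ hb
  have k3 := key hcd hab h₆ h₂.symm h₄.symm hc
  have k4 := key (Finset.insert_comm c d J ▸ hcd) hab h₆.symm h₃.symm h₅.symm hd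
  simp only [Finset.insert_comm d a, Finset.insert_comm d b, Finset.insert_comm c a,
    Finset.insert_comm c b] at k3 k4
  tauto

/-- The entry in row `s` and column `e` of the fundamental matrix of `B` is nonzero. -/
def FundAdj (M : Matroid E) (B : Finset E) (s e : E) : Prop :=
  M.IsFinBase (insert e (B.erase s))

/-- Replace two elements `s`, `t` of a finite set by `e`, `f`. -/
theorem insert_insert_erase_erase {B : Finset E} {s t e : E} (hs : s ∈ B) (hst : s ≠ t) :
    insert s (insert e ((B.erase s).erase t)) = insert e (B.erase t) := by
  grind

theorem insert_insert_erase_erase' {B : Finset E} {s t e : E} (ht : t ∈ B) (hst : s ≠ t) :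
    insert t (insert e ((B.erase s).erase t)) = insert e (B.erase s) := by
  grind

/-- Combinatorial form of the fact that a `2 × 2` minor with exactly one nonzero product does not
vanish. The pair exchange for `B - t + f` and `B - s + e` over `B - s - t` leaves only one
possibility, since the other matching is excluded by `h`. -/
theorem FundAdj.pivot {B : Finset E} {s t e f : E} (hs : s ∈ B) (ht : t ∈ B)
    (hst : s ≠ t) (he : e ∉ B) (hf : f ∉ B) (hef : e ≠ f) (hse : M.FundAdj B s e)
    (htf : M.FundAdj B t f) (h : ¬ (M.FundAdj B s f ∧ M.FundAdj B t e)) :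
    M.FundAdj (insert e (B.erase s)) t f := by
  have h1 := insert_insert_erase_erase (e := f) hs hst
  have h2 := insert_insert_erase_erase' (e := e) ht hst
  have h3 := insert_insert_erase_erase (e := e) hs hst
  have h4 := insert_insert_erase_erase' (e := f) ht hst
  have := IsFinBase.exchange_pair (M := M) (J := (B.erase s).erase t) (a := s) (b := f) (c := t)
    (d := e) (by rw [h1]; exact htf) (by rw [h2]; exact hse) (by grind) hst (by grind) (by grind)
    hef.symm (by grind) (by simp) (by grind) (by simp) (by grind)
  rcases this with ⟨_, h5⟩ | ⟨h5, h6⟩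
  · unfold FundAdj
    convert h5 using 1
    grind
  · rw [h3] at h5
    rw [Finset.insert_comm, h4] at h6
    exact absurd ⟨h6, h5⟩ h

end Exchange

/-! ### Functions on bases that are multiplicative on squares -/

section Potential

variable {E : Type*} [DecidableEq E] {M : Matroid E} {A : Type*} [CommGroup A]

/-- The multiplicative relations of a function on bases for all squares of bases
`J ∪ {a, c}`, `J ∪ {b, d}`, `J ∪ {a, d}`, `J ∪ {b, c}`. -/
def IsSquareMul (M : Matroid E) (χ : Finset E → A) : Prop :=
  ∀ (J : Finset E) (a b c d : E), a ≠ b → a ≠ c → a ≠ d → b ≠ c → b ≠ d → c ≠ d →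
    a ∉ J → b ∉ J → c ∉ J → d ∉ J →
    M.IsFinBase (insert a (insert c J)) → M.IsFinBase (insert b (insert d J)) →
    M.IsFinBase (insert a (insert d J)) → M.IsFinBase (insert b (insert c J)) →
    χ (insert a (insert c J)) * χ (insert b (insert d J)) =
      χ (insert a (insert d J)) * χ (insert b (insert c J))

variable {χ : Finset E → A}

theorem IsSquareMul.fundAdj (hχ : M.IsSquareMul χ) {B : Finset E} {s t e f : E} (hs : s ∈ B)
    (ht : t ∈ B) (hst : s ≠ t) (he : e ∉ B) (hf : f ∉ B) (hef : e ≠ f)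
    (hse : M.FundAdj B s e) (hsf : M.FundAdj B s f) (hte : M.FundAdj B t e)
    (htf : M.FundAdj B t f) :
    χ (insert e (B.erase s)) * χ (insert f (B.erase t)) =
      χ (insert f (B.erase s)) * χ (insert e (B.erase t)) := by
  have h1 := insert_insert_erase_erase (e := f) hs hst
  have h2 := insert_insert_erase_erase' (e := e) ht hst
  have h3 := insert_insert_erase_erase (e := e) hs hst
  have h4 := insert_insert_erase_erase' (e := f) ht hst
  have := hχ ((B.erase s).erase t) t s e f hst.symm (by grind) (by grind) (by grind) (by grind) hef
    (by grind) (by grind) (by grind) (by grind) (by rwa [h2]) (by rwa [h1]) (by rwa [h4])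
    (by rwa [h3])
  rwa [h1, h2, h3, h4] at this

/-- The sequence `s 0, e 0, s 1, …, s n` is a path in the fundamental graph of `B` inside `Y`, and
both of its ends are adjacent to `x`. Induction on `n`, over all bases `B` at once: for `n = 1` the
claim is one square, a chord shortens the path, and a path without the relevant chords is shortened
by pivoting. -/
theorem IsSquareMul.eq_of_path (hχ : M.IsSquareMul χ) {Y : Finset E} {x : E} (hx : x ∉ Y)
    (h1 : ∀ B ⊆ Y, M.IsFinBase B → χ B = 1) (n : ℕ) :
    ∀ (B : Finset E) (s e : ℕ → E), B ⊆ Y → M.IsFinBase B → (∀ i ≤ n, s i ∈ B) →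
      (∀ i < n, e i ∈ Y ∧ e i ∉ B ∧ M.FundAdj B (s i) (e i) ∧ M.FundAdj B (s (i + 1)) (e i)) →
      M.FundAdj B (s 0) x → M.FundAdj B (s n) x →
      χ (insert x (B.erase (s 0))) = χ (insert x (B.erase (s n))) := by
  induction n using Nat.strong_induction_on with
  | _ n ih =>
  intro B s e hBY hB hs he hx0 hxn
  have hxB : x ∉ B := fun h => hx (hBY h)
  by_cases hsn : s 0 = s n
  · rw [hsn]
  match n, ih with
  | 0, _ => exact absurd rfl hsn
  | 1, _ =>
    obtain ⟨h2, h3, h4, h5⟩ := he 0 one_pos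
    have h6 := hχ.fundAdj (hs 0 zero_le_one) (hs 1 le_rfl) hsn h3 hxB
      (fun h => hx (h ▸ h2)) h4 hx0 h5 hxn
    rw [h1 _ (by grind) h4, h1 _ (by grind) h5, one_mul, mul_one] at h6
    exact h6.symm
  | n + 2, ih =>
    obtain ⟨a1, a2, a3, a4⟩ := he 0 (by omega)
    obtain ⟨b1, b2, b3, b4⟩ := he 1 (by omega)
    -- shortcuts
    by_cases c1 : M.FundAdj B (s 1) x
    · have d1 := ih 1 (by omega) B s e hBY hB (fun i hi => hs i (by omega))
        (fun i hi => he i (by omega)) hx0 c1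
      have d2 := ih (n + 1) (by omega) B (fun i => s (i + 1)) (fun i => e (i + 1)) hBY hB
        (fun i hi => hs _ (by omega)) (fun i hi => he _ (by omega)) c1 hxn
      exact d1.trans d2
    by_cases c2 : ∃ j, 2 ≤ j ∧ j ≤ n + 2 ∧ M.FundAdj B (s j) (e 0)
    · obtain ⟨j, hj, hjn, hj'⟩ := c2
      have := ih (n + 2 - j + 1) (by omega) B (fun i => if i = 0 then s 0 else s (i - 1 + j))
        (fun i => if i = 0 then e 0 else e (i - 1 + j)) hBY hB
        (fun i hi => by
          by_cases h : i = 0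
          · simpa [h] using hs 0 (by omega)
          · simpa [h] using hs _ (by omega))
        (fun i hi => by
          by_cases h : i = 0
          · subst h
            simpa using ⟨a1, a2, a3, hj'⟩
          · have := he (i - 1 + j) (by omega)
            rw [show i - 1 + j + 1 = i + j by omega] at this
            simpa [h] using this)
        (by simpa using hx0) (by simpa [show n + 2 - j + j = n + 2 by omega] using hxn)
      simpa [show n + 2 - j + j = n + 2 by omega] using this
    -- A chord from `s 0` to `e 1` skips `e 0` and `s 1`.
    by_cases c3 : M.FundAdj B (s 0) (e 1)
    · have := ih (n + 1) (by omega) B (fun i => if i = 0 then s 0 else s (i + 1))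
        (fun i => e (i + 1)) hBY hB
        (fun i hi => by
          by_cases h : i = 0
          · simpa [h] using hs 0 (by omega)
          · simpa [h] using hs _ (by omega))
        (fun i hi => by
          by_cases h : i = 0
          · subst h
            simpa using ⟨b1, b2, c3, b4⟩
          · simpa [h] using he (i + 1) (by omega))
        (by simpa using hx0) (by simpa using hxn)
      simpa using this
    push Not at c2
    have s01 : s 0 ≠ s 1 := fun h => c1 (h ▸ hx0)
    have s1n : s 1 ≠ s (n + 2) := fun h => c1 (h ▸ hxn)
    have s1j : ∀ j, 2 ≤ j → j ≤ n + 2 → s 1 ≠ s j := fun j h h' h'' => c2 j h h' (h'' ▸ a4)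
    have e0j : ∀ j, 1 ≤ j → j < n + 2 → e 0 ≠ e j := by
      intro j h h' h''
      obtain rfl | h := h.eq_or_lt
      · exact c3 (h'' ▸ a3)
      · exact c2 j h h'.le (h'' ▸ (he j h').2.2.1)
    have xe0 : e 0 ≠ x := fun h => hx (h ▸ a1)
    have s0 := hs 0 (by omega)
    have s1 := hs 1 (by omega)
    have sn := hs (n + 2) le_rfl
    -- the neighbours of the new base
    have p0 : M.FundAdj (insert (e 0) (B.erase (s 1))) (s 0) x :=
      FundAdj.pivot s1 s0 s01.symm a2 hxB xe0 a4 hx0 (fun h => c1 h.1)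
    have pn : M.FundAdj (insert (e 0) (B.erase (s 1))) (s (n + 2)) x :=
      FundAdj.pivot s1 sn s1n a2 hxB xe0 a4 hxn (fun h => c1 h.1)
    -- The pivot that exchanges `s 1` for `e 0` creates the edge from `s 0` to `e 1`, which `c3`
    -- excludes in the old graph. This edge makes the new path shorter by one.
    have p1 : M.FundAdj (insert (e 0) (B.erase (s 1))) (s 0) (e 1) := by
      have := FundAdj.pivot s0 s1 s01 a2 b2 (e0j 1 le_rfl (by omega)) a3 b3 (fun h => c3 h.1)
      unfold FundAdj at this ⊢
      convert this using 1
      grind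
    have pj : ∀ j k, 1 ≤ j → j < n + 2 → 2 ≤ k → k ≤ n + 2 → M.FundAdj B (s k) (e j) →
        M.FundAdj (insert (e 0) (B.erase (s 1))) (s k) (e j) := fun j k h h' h2 h3 h4 =>
      FundAdj.pivot s1 (hs k h3) (s1j k h2 h3) a2 (he j h').2.1 (e0j j h h') a4 h4
        (fun h => c2 k h2 h3 h.2)
    have := ih (n + 1) (by omega) (insert (e 0) (B.erase (s 1)))
        (fun i => if i = 0 then s 0 else s (i + 1)) (fun i => e (i + 1)) (by grind) a4
        (fun i hi => by
          by_cases h : i = 0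
          · simp [h, s01, s0]
          · simp [h, (s1j (i + 1) (by omega) (by omega)).symm, hs (i + 1) (by omega)])
        (fun i hi => by
          refine ⟨(he (i + 1) (by omega)).1, ?_, ?_, ?_⟩
          · simp [(e0j (i + 1) (by omega) (by omega)).symm, (he (i + 1) (by omega)).2.1]
          · by_cases h : i = 0
            · subst h
              simpa using p1
            · simpa [h] using pj (i + 1) (i + 1) (by omega) (by omega) (by omega) (by omega)
                (he (i + 1) (by omega)).2.2.1
          · simpa using pj (i + 1) (i + 2) (by omega) (by omega) (by omega) (by omega)
                (he (i + 1) (by omega)).2.2.2)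
        (by simpa using p0) (by simpa using pn)
    simp only [if_true, Nat.add_eq_zero_iff, one_ne_zero, and_false, if_false] at this
    have h7 := this
    -- A single square links the old and the new neighbours that contain `x`. Since the two values
    -- at the new base agree by induction, they cancel and the two values at `B` agree.
    have q0 : insert (s (n + 2)) (insert (s 1)
        (insert x (((B.erase (s 0)).erase (s 1)).erase (s (n + 2))))) =
        insert x (B.erase (s 0)) := by grind
    have qn : insert (s 0) (insert (s 1)
        (insert x (((B.erase (s 0)).erase (s 1)).erase (s (n + 2))))) =
        insert x (B.erase (s (n + 2))) := by grind
    have r0 : insert (s (n + 2)) (insert (e 0)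
        (insert x (((B.erase (s 0)).erase (s 1)).erase (s (n + 2))))) =
        insert x ((insert (e 0) (B.erase (s 1))).erase (s 0)) := by grind
    have rn : insert (s 0) (insert (e 0)
        (insert x (((B.erase (s 0)).erase (s 1)).erase (s (n + 2))))) =
        insert x ((insert (e 0) (B.erase (s 1))).erase (s (n + 2))) := by grind
    have := hχ (insert x (((B.erase (s 0)).erase (s 1)).erase (s (n + 2)))) (s 0) (s (n + 2))
      (s 1) (e 0) hsn s01 (by grind) s1n.symm (by grind) (by grind) (by grind) (by grind)
      (by grind) (by grind) (by rwa [qn]) (by rwa [r0]) (by rwa [rn]) (by rwa [q0])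
    rw [q0, qn, r0, rn] at this
    rw [h7, mul_comm] at this
    exact (mul_left_cancel this).symm

end Potential
end Matroid

/-! ### Potentials and the product formula -/

namespace Matroid

theorem exists_path_of_reflTransGen {E : Type*} {r : E → E → Prop} {p : E → E → E → Prop}
    (hr : ∀ a b, r a b → ∃ e, p a b e) {a b : E} (h : Relation.ReflTransGen r a b) :
    ∃ (n : ℕ) (s e : ℕ → E), s 0 = a ∧ s n = b ∧ ∀ i < n, p (s i) (s (i + 1)) (e i) := by
  induction h using Relation.ReflTransGen.head_induction_on with
  | refl => exact ⟨0, fun _ => b, fun _ => b, rfl, rfl, by simp⟩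
  | @head a' _ hac _ ih =>
    obtain ⟨n, s, e, rfl, rfl, h⟩ := ih
    obtain ⟨f, hf⟩ := hr _ _ hac
    refine ⟨n + 1, fun i => if i = 0 then a' else s (i - 1),
      fun i => if i = 0 then f else e (i - 1),
      by simp, by simp, fun i hi => ?_⟩
    match i with
    | 0 => simpa using hf
    | i + 1 => simpa using h i (by omega)

section Potential

variable {E : Type*} [DecidableEq E] {M : Matroid E} {A : Type*} [CommGroup A] {χ : Finset E → A}

/-- `u` describes the values of `χ` on the neighbours of the base `B` inside `Y`. -/
def IsPotentialAt (M : Matroid E) (χ : Finset E → A) (Y : Finset E) (u : E → A) (B : Finset E) :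
    Prop :=
  ∀ s ∈ B, ∀ e ∈ Y, e ∉ B → M.FundAdj B s e → χ (insert e (B.erase s)) * u s = χ B * u e

/-- Locally, `u` says that `χ` changes by `u e / u s` when `s` is exchanged for `e`. This propagates
to an adjacent base: exchanges that involve `s` or `e` again are compositions of exchanges at `B`,
and every other one is reached through a square containing `B`. -/
theorem IsPotentialAt.exchange (hχ : M.IsSquareMul χ) {Y B : Finset E} {u : E → A}
    (hB : M.IsFinBase B) (hu : M.IsPotentialAt χ Y u B) {s e : E} (hs : s ∈ B)
    (he : e ∈ Y) (he' : e ∉ B) (hse : M.FundAdj B s e) :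
    M.IsPotentialAt χ Y u (insert e (B.erase s)) := by
  have h0 := hu s hs e he he' hse
  intro t ht f hf hf' htf
  have hef : e ≠ f := by grind
  unfold FundAdj at htf
  by_cases hte : t = e
  · subst hte
    rw [Finset.erase_insert (by simp [he'])] at htf ⊢
    by_cases hfs : f = s
    · subst hfs
      rw [Finset.insert_erase hs, h0]
    · have h1 := hu s hs f hf (by grind) htf
      apply mul_right_cancel (b := u s)
      calc _ = (χ (insert f (B.erase s)) * u s) * u t := by ac_rfl
        _ = (χ (insert t (B.erase s)) * u s) * u f := by rw [h1, h0]; ac_rfl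
        _ = _ := by ac_rfl
  have htB : t ∈ B := by grind
  have hts : t ≠ s := by grind
  by_cases hfs : f = s
  · subst hfs
    have h2 : insert f ((insert e (B.erase f)).erase t) = insert e (B.erase t) := by grind
    rw [h2] at htf ⊢
    rw [hu t htB e he he' htf, h0]
  have hfB : f ∉ B := by grind
  have h2 : insert f ((insert e (B.erase s)).erase t) =
      insert e (insert f ((B.erase s).erase t)) := by grind
  have h3 : insert s (insert t ((B.erase s).erase t)) = B := by grind
  rw [h2] at htf ⊢
  have e1 := insert_insert_erase_erase (e := f) hs hts.symm
  have e2 := insert_insert_erase_erase' (e := e) htB hts.symm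
  have e3 := insert_insert_erase_erase (e := e) hs hts.symm
  have e4 := insert_insert_erase_erase' (e := f) htB hts.symm
  have hf0 : f ∉ (B.erase s).erase t := by grind
  have he0 : e ∉ (B.erase s).erase t := by grind
  have hs0 : s ∉ (B.erase s).erase t := by grind
  have ht0 : t ∉ (B.erase s).erase t := by grind
  have nse : s ≠ e := by grind
  have nte : t ≠ e := by grind
  have nsf : s ≠ f := by grind
  have ntf : t ≠ f := by grind
  apply mul_right_cancel (b := u s)
  rw [mul_right_comm _ (u f), h0]
  -- `B` and the base obtained by both exchanges are opposite corners of a square. One of the two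
  -- possible pairs of remaining corners consists of bases, and both of these are neighbours of `B`,
  -- where `u` is known.
  rcases IsFinBase.exchange_pair (M := M) (J := (B.erase s).erase t) (by rwa [h3]) htf
    hts.symm nse nsf nte ntf hef hs0 ht0 he0 hf0 with ⟨k1, k2⟩ | ⟨k1, k2⟩
  · have h4 := hχ ((B.erase s).erase t) s f t e nsf hts.symm nse (Ne.symm ntf)
      hef.symm nte hs0 hf0 ht0 he0
      (by rwa [h3]) (by rwa [Finset.insert_comm]) k1 (by rwa [Finset.insert_comm])
    rw [Finset.insert_comm f e, Finset.insert_comm f t, h3, e3, e4] at h4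
    rw [e3] at k1
    rw [e4] at k2
    have h5 := hu t htB e he he' k1
    have h6 := hu s hs f hf hfB k2
    apply mul_left_cancel (a := χ B)
    calc _ = (χ (insert e (B.erase t)) * u t) * (χ (insert f (B.erase s)) * u s) := by
            rw [← mul_assoc, ← mul_assoc, h4]; ac_rfl
      _ = _ := by rw [h5, h6]; ac_rfl
  · have h4 := hχ ((B.erase s).erase t) s e t f nse hts.symm nsf (Ne.symm nte)
      hef ntf hs0 he0 ht0 hf0
      (by rwa [h3]) htf k1 (by rwa [Finset.insert_comm])
    rw [Finset.insert_comm e t, h3, e1, e2] at h4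
    rw [e1] at k1
    rw [e2] at k2
    have h5 := hu t htB f hf hfB k1
    have h6 := hu s hs e he he' k2
    apply mul_left_cancel (a := χ B)
    calc _ = (χ (insert f (B.erase t)) * u t) * (χ (insert e (B.erase s)) * u s) := by
            rw [← mul_assoc, ← mul_assoc, h4]; ac_rfl
      _ = _ := by rw [h5, h6]; ac_rfl

/-- Walk from `B` to `D` by basis exchanges, each of which decreases `B \ D`; the potential is
carried along by `IsPotentialAt.exchange` and the local ratios telescope. -/
theorem IsPotentialAt.eq_prod (hχ : M.IsSquareMul χ) {Y : Finset E} {u : E → A} {D : Finset E}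
    (hD : M.IsFinBase D) (hDY : D ⊆ Y) (n : ℕ) : ∀ B : Finset E, (B \ D).card = n →
      M.IsFinBase B → M.IsPotentialAt χ Y u B →
      χ D * ∏ a ∈ B, u a = χ B * ∏ a ∈ D, u a := by
  induction n with
  | zero =>
    intro B h hB _
    rw [Finset.card_eq_zero, Finset.sdiff_eq_empty_iff_subset] at h
    rw [Finset.eq_of_subset_of_card_le h (hD.card_eq hB).le]
  | succ n ih =>
    intro B h hB hu
    obtain ⟨s, hs⟩ : (B \ D).Nonempty := Finset.card_pos.mp (by omega)
    rw [Finset.mem_sdiff] at hs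
    obtain ⟨e, heD, heB, hse⟩ := hB.exchange hD hs.1 hs.2
    have h1 : insert e (B.erase s) \ D = (B \ D).erase s := by grind
    have h2 := ih (insert e (B.erase s))
      (by rw [h1, Finset.card_erase_of_mem (by simp [hs])]; omega) hse
      (hu.exchange hχ hB hs.1 (hDY heD) heB hse)
    rw [Finset.prod_insert (by simp [heB])] at h2
    have h3 := hu s hs.1 e (hDY heD) heB hse
    rw [← Finset.mul_prod_erase B u hs.1]
    apply mul_left_cancel (a := u e)
    calc _ = (χ D * (u e * ∏ a ∈ B.erase s, u a)) * u s := by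
            ac_rfl
      _ = (χ (insert e (B.erase s)) * u s) * ∏ a ∈ D, u a := by
            rw [h2]; ac_rfl
      _ = _ := by rw [h3]; ac_rfl

/-- Since `χ` is trivial inside `Y`, a potential has to be constant on the components of the
fundamental graph of `B` in `Y`. The edges to `x` then prescribe a value on each component that is
adjacent to `x`, and by `IsSquareMul.eq_of_path` they all prescribe the same one. -/
theorem IsSquareMul.exists_isPotentialAt_insert (hχ : M.IsSquareMul χ) {Y B : Finset E} {x : E}
    (hx : x ∉ Y) (h1 : ∀ B ⊆ Y, M.IsFinBase B → χ B = 1) (hBY : B ⊆ Y) (hB : M.IsFinBase B) :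
    ∃ u : E → A, M.IsPotentialAt χ (insert x Y) u B := by
  classical
  let r : E → E → Prop := fun s t =>
    ∃ e, s ∈ B ∧ t ∈ B ∧ e ∈ Y ∧ e ∉ B ∧ M.FundAdj B s e ∧ M.FundAdj B t e
  have : Std.Symm r := ⟨fun s t ⟨e, h1, h2, h3, h4, h5, h6⟩ => ⟨e, h2, h1, h3, h4, h6, h5⟩⟩
  have hsymm : ∀ {s t}, Relation.ReflTransGen r s t → Relation.ReflTransGen r t s := fun h =>
    Relation.ReflTransGen.stdSymm.symm _ _ h
  have key : ∀ {s t}, s ∈ B → Relation.ReflTransGen r s t → M.FundAdj B s x → M.FundAdj B t x →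
      χ (insert x (B.erase s)) = χ (insert x (B.erase t)) := by
    intro s t hs hst h h'
    obtain ⟨n, p, e, rfl, rfl, hp⟩ := exists_path_of_reflTransGen (fun _ _ h => h) hst
    refine hχ.eq_of_path hx h1 n B p e hBY hB (fun i hi => ?_)
      (fun i hi => (hp i hi).2.2) h h'
    match i with
    | 0 => exact hs
    | i + 1 => exact (hp i (by omega)).2.1
  -- the elements of `B` adjacent to `x` that can be reached from a vertex
  let q : E → E → Prop := fun v a => a ∈ B ∧ M.FundAdj B a x ∧
    ∃ s ∈ B, (v = s ∨ (v ∈ Y ∧ v ∉ B ∧ M.FundAdj B s v)) ∧ Relation.ReflTransGen r s a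
  -- The potential is normalized to `1` at `x` and on components without an edge to `x`.
  let u : E → A := fun v => if h : v ≠ x ∧ ∃ a, q v a then
    (χ (insert x (B.erase h.2.choose)))⁻¹ else 1
  have hu' : ∀ v, ¬ (v ≠ x ∧ ∃ a, q v a) → u v = 1 := fun v h => dif_neg h
  have hu : ∀ v a, v ≠ x → q v a → u v = (χ (insert x (B.erase a)))⁻¹ := by
    intro v a hv ha
    have hex : v ≠ x ∧ ∃ a, q v a := ⟨hv, a, ha⟩
    have hc : q v hex.2.choose := hex.2.choose_spec
    have hv' : u v = (χ (insert x (B.erase hex.2.choose)))⁻¹ := dif_pos hex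
    rw [hv', inv_inj]
    generalize hex.2.choose = c at hc
    obtain ⟨hcB, hcx, s, hs, hs', hsc⟩ := hc
    obtain ⟨haB, hax, t, ht, ht', hta⟩ := ha
    have hst : Relation.ReflTransGen r s t := by
      rcases hs' with rfl | ⟨h2, h3, h4⟩
      · rcases ht' with rfl | ⟨h5, h6, h7⟩
        · exact .refl
        · exact absurd hs h6
      · rcases ht' with rfl | ⟨h5, h6, h7⟩
        · exact absurd ht h3
        · exact .single ⟨v, hs, ht, h2, h3, h4, h7⟩
    exact key hcB ((hsymm hsc).trans (hst.trans hta)) hcx hax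
  refine ⟨u, fun s hs e he heB hse => ?_⟩
  have hsx : s ≠ x := fun h => hx (h ▸ hBY hs)
  rw [h1 B hBY hB, one_mul]
  by_cases hex : e = x
  · subst hex
    rw [hu s s hsx ⟨hs, hse, s, hs, .inl rfl, .refl⟩, mul_inv_cancel]
    exact (hu' e (fun h => h.1 rfl)).symm
  · have heY : e ∈ Y := by grind
    rw [h1 _ (by grind) hse, one_mul]
    have hiff : ∀ a, q s a ↔ q e a := by
      refine fun a => ⟨fun ⟨h2, h3, t, h4, h5, h6⟩ => ⟨h2, h3, t, h4, .inr ⟨heY, heB, ?_⟩, h6⟩,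
        fun ⟨h2, h3, t, h4, h5, h6⟩ => ⟨h2, h3, s, hs, .inl rfl, ?_⟩⟩
      · rcases h5 with rfl | h5
        · exact hse
        · exact absurd hs h5.2.1
      · rcases h5 with rfl | h5
        · exact absurd h4 heB
        · exact .head ⟨e, hs, h4, heY, heB, hse, h5.2.2⟩ h6
    by_cases h : ∃ a, q s a
    · obtain ⟨a, ha⟩ := h
      rw [hu s a hsx ha, hu e a hex ((hiff a).1 ha)]
    · have hne : ¬ ∃ a, q e a := by simpa only [hiff] using h
      rw [hu' s (fun h2 => h h2.2), hu' e (fun h2 => hne h2.2)]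

/-- A function on the bases of a matroid that is multiplicative on all squares of bases is, up to a
constant, the product of the values of a function on the ground set. -/
theorem IsSquareMul.exists_eq_prod [Fintype E] (hχ : M.IsSquareMul χ) :
    ∃ (c : A) (u : E → A), ∀ D, M.IsFinBase D → χ D = c * ∏ a ∈ D, u a := by
  obtain ⟨B, hB⟩ : ∃ B, M.IsFinBase B := by
    classical
    obtain ⟨B, hB⟩ := M.exists_isBase
    exact ⟨B.toFinset, by simpa [IsFinBase] using hB⟩
  -- The ground set grows one element at a time, starting from a fixed base `B`, so that `B` is
  -- available as base point at every stage.
  have main : ∀ F : Finset E, Disjoint B F →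
      ∃ (c : A) (u : E → A), ∀ D ⊆ B ∪ F, M.IsFinBase D → χ D = c * ∏ a ∈ D, u a := by
    intro F
    induction F using Finset.induction_on with
    | empty =>
      refine fun _ => ⟨χ B, 1, fun D hD hD' => ?_⟩
      rw [Finset.union_empty] at hD
      simp [Finset.eq_of_subset_of_card_le hD (hB.card_eq hD').le]
    | insert x F hxF ih =>
      intro hBF
      obtain ⟨c, u, hu⟩ := ih (Finset.disjoint_of_subset_right (Finset.subset_insert _ _) hBF)
      -- Dividing by the product already found makes the function trivial on the bases inside `B ∪
      -- F`, and keeps it multiplicative on squares.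
      let ψ : Finset E → A := fun D => (c * ∏ a ∈ D, u a)⁻¹ * χ D
      have hψ : M.IsSquareMul ψ := by
        intro J a b e d h1 h2 h3 h4 h5 h6 h7 h8 h9 h10 h11 h12 h13 h14
        have := hχ J a b e d h1 h2 h3 h4 h5 h6 h7 h8 h9 h10 h11 h12 h13 h14
        simp only [ψ]
        rw [mul_mul_mul_comm, this, mul_mul_mul_comm ((c * _)⁻¹) (χ _)]
        congr 1
        rw [← mul_inv, ← mul_inv]
        congr 1
        have key : ∀ {p q}, p ≠ q → p ∉ J → q ∉ J →
            ∏ i ∈ insert p (insert q J), u i = u p * (u q * ∏ i ∈ J, u i) := by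
          intro p q hpq hp hq
          rw [Finset.prod_insert (by simp [hpq, hp]), Finset.prod_insert hq]
        rw [key h2 h7 h9, key h5 h8 h10, key h3 h7 h10, key h4 h8 h9]
        ac_rfl
      have hxY : x ∉ B ∪ F := by
        have : x ∉ B := fun h => Finset.disjoint_left.mp hBF h (by simp)
        simp [this, hxF]
      obtain ⟨v, hv⟩ := hψ.exists_isPotentialAt_insert hxY
        (fun D hD hD' => by simp [ψ, hu D hD hD']) Finset.subset_union_left hB
      refine ⟨c * (ψ B * (∏ a ∈ B, v a)⁻¹), fun a => u a * v a, fun D hD hD' => ?_⟩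
      have h1 := IsPotentialAt.eq_prod hψ (Y := insert x (B ∪ F)) (u := v) hD'
        (by rwa [← Finset.union_insert]) _ B rfl hB hv
      have h2 : χ D = c * (∏ a ∈ D, u a) * ψ D := by simp only [ψ]; rw [mul_inv_cancel_left]
      rw [← eq_mul_inv_iff_mul_eq] at h1
      rw [h2, h1, Finset.prod_mul_distrib]
      ac_rfl
  obtain ⟨c, u, hu⟩ := main Bᶜ disjoint_compl_right
  exact ⟨c, u, fun D hD => hu D (by simp) hD⟩

end Potential
end Matroid

/-! ### Signs of tuples in an ordered set -/

namespace Matroid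

theorem append_pair {E : Type*} {n : ℕ} (J : Fin n → E) (k l : E) :
    Fin.append J ![k, l] = Fin.snoc (α := fun _ => E) (Fin.snoc (α := fun _ => E) J k) l := by
  have h : ![k, l] = Fin.snoc (α := fun _ => E) ![k] l := by
    ext p
    fin_cases p <;> rfl
  rw [h, Fin.append_snoc, Fin.append_right_eq_snoc]
  rfl

section Sign

variable {E : Type*} [LinearOrder E]

/-- The sign of the difference `b - a` of two distinct elements. -/
def ordSign (a b : E) : ℤˣ := if a < b then 1 else -1

theorem ordSign_of_lt {a b : E} (h : a < b) : ordSign a b = 1 := if_pos h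

theorem ordSign_of_gt {a b : E} (h : b < a) : ordSign a b = -1 := if_neg h.not_gt

theorem ordSign_swap {a b : E} (h : a ≠ b) : ordSign a b = -ordSign b a := by
  rcases h.lt_or_gt with h | h <;> simp [ordSign_of_lt, ordSign_of_gt, h]

/-- The sign of the permutation that sorts an injective tuple. -/
def tupleSign {n : ℕ} (i : Fin n → E) : ℤˣ := ∏ q, ∏ p ∈ Finset.Iio q, ordSign (i p) (i q)

theorem tupleSign_comp {n : ℕ} {i : Fin n → E} (hi : Function.Injective i)
    (σ : Equiv.Perm (Fin n)) : tupleSign (i ∘ σ) = Equiv.Perm.sign σ * tupleSign i := by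
  -- Signs are taken in `ℤ` with value `0` on the diagonal, so that `f` is antisymmetric for all
  -- pairs of indices.
  let f : Fin n → Fin n → ℤ := fun p q => if p = q then 0 else ordSign (i p) (i q)
  have h := Equiv.Perm.prod_Iio_comp_eq_sign_mul_prod σ (f := f) (fun p q => by
    by_cases hpq : p = q
    · simp [f, hpq]
    · have h : i p ≠ i q := fun h => hpq (hi h)
      simp [f, hpq, Ne.symm hpq, ordSign_swap h])
  have h1 : ∀ τ : Equiv.Perm (Fin n), ∏ q, ∏ p ∈ Finset.Iio q, f (τ p) (τ q) =
      (tupleSign (i ∘ τ) : ℤˣ) := by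
    intro τ
    rw [tupleSign, Units.coe_prod]
    refine Finset.prod_congr rfl fun q _ => ?_
    rw [Units.coe_prod]
    refine Finset.prod_congr rfl fun p hp => ?_
    rw [Finset.mem_Iio] at hp
    simp [f, hp.ne]
  rw [h1, show ∏ q, ∏ p ∈ Finset.Iio q, f p q = _ from h1 1] at h
  apply Units.ext
  simpa using h

theorem tupleSign_snoc {n : ℕ} (i : Fin n → E) (k : E) :
    tupleSign (Fin.snoc i k : Fin (n + 1) → E) = tupleSign i * ∏ p, ordSign (i p) k := by
  rw [tupleSign, Fin.prod_univ_castSucc]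
  congr 1
  · refine Finset.prod_congr rfl fun q _ => ?_
    rw [← Fin.map_castSuccEmb_Iio, Finset.prod_map]
    simp
  · rw [Fin.Iio_last_eq_map]
    simp

theorem tupleSign_cast {m n : ℕ} (h : m = n) (i : Fin m → E) :
    tupleSign (i ∘ Fin.cast h.symm) = tupleSign i := by
  subst h
  rfl

theorem tupleSign_strictMono {n : ℕ} {i : Fin n → E} (hi : StrictMono i) : tupleSign i = 1 :=
  Finset.prod_eq_one fun _ _ => Finset.prod_eq_one fun _ hp =>
    ordSign_of_lt (hi (Finset.mem_Iio.mp hp))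

theorem tupleSign_tupleSnoc (M : Matroid E) {s : ℕ} (h : s + 2 = M.rk) (J : Fin s → E) (k l : E) :
    tupleSign (M.tupleSnoc h J k l) =
      tupleSign J * (∏ p, ordSign (J p) k) * ((∏ p, ordSign (J p) l) * ordSign k l) := by
  rw [tupleSnoc, show tupleSign (Fin.append J ![k, l] ∘ Fin.cast h.symm) = _ from
    tupleSign_cast h _, append_pair, tupleSign_snoc, tupleSign_snoc, Fin.prod_univ_castSucc]
  simp

theorem image_tupleSnoc (M : Matroid E) {s : ℕ} (h : s + 2 = M.rk) (J : Fin s → E) (k l : E) :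
    Finset.univ.image (M.tupleSnoc h J k l) = insert k (insert l (Finset.univ.image J)) := by
  ext x
  have h1 : (∃ p, M.tupleSnoc h J k l p = x) ↔ ∃ p, Fin.append J ![k, l] p = x :=
    ((finCongr h.symm).surjective.exists (p := fun p => Fin.append J ![k, l] p = x)).symm
  rw [Finset.mem_image]
  simp only [Finset.mem_univ, true_and]
  rw [h1, append_pair]
  constructor
  · rintro ⟨p, rfl⟩
    induction p using Fin.lastCases with
    | last => simp
    | cast p =>
      induction p using Fin.lastCases with
      | last => simp
      | cast p => simp
  · rw [Finset.mem_insert, Finset.mem_insert, Finset.mem_image]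
    rintro (rfl | rfl | ⟨p, -, rfl⟩)
    · exact ⟨(Fin.last s).castSucc, by simp⟩
    · exact ⟨Fin.last (s + 1), by simp⟩
    · exact ⟨p.castSucc.castSucc, by simp⟩

end Sign

/-! ### Two-term Plücker relations and signed exchange relations -/

section Units

variable {A : Type*} [CommGroup A]

/-- The homomorphism `{1, -1} → A` that sends `-1` to an element of order at most `2`. -/
def unitsHom (e : A) (he : e ^ 2 = 1) : ℤˣ →* A where
  toFun u := if u = 1 then 1 else e
  map_one' := if_pos rfl
  map_mul' u v := by
    rw [pow_two] at he
    rcases Int.units_eq_one_or u with rfl | rfl <;> rcases Int.units_eq_one_or v with rfl | rfl <;>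
      simp [he]

variable {e : A} {he : e ^ 2 = 1}

theorem unitsHom_neg_one : unitsHom e he (-1) = e := by
  have h : ¬ (-1 : ℤˣ) = 1 := by decide
  simp [unitsHom, h]

theorem unitsHom_mul_self (u : ℤˣ) (a : A) : unitsHom e he u * (unitsHom e he u * a) = a := by
  rw [← mul_assoc, ← map_mul, Int.units_mul_self, map_one, one_mul]

variable {E : Type*} [LinearOrder E] (M : Matroid E) (y : Finset E → A)

/-- The two-term degenerations of the three-term Plücker relations. -/
structure IsPluecker (e : A) : Prop where
  eq₁₂ : ∀ (J : Finset E) (a b c d : E), J.card + 2 = M.rk → a < b → b < c → c < d →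
    a ∉ J → b ∉ J → c ∉ J → d ∉ J →
    ¬ (M.IsFinBase (insert a (insert b J)) ∧ M.IsFinBase (insert c (insert d J))) →
    M.IsFinBase (insert a (insert c J)) → M.IsFinBase (insert b (insert d J)) →
    M.IsFinBase (insert a (insert d J)) → M.IsFinBase (insert b (insert c J)) →
    y (insert a (insert c J)) * y (insert b (insert d J)) =
      y (insert a (insert d J)) * y (insert b (insert c J))
  eq₁₃ : ∀ (J : Finset E) (a b c d : E), J.card + 2 = M.rk → a < b → b < c → c < d →
    a ∉ J → b ∉ J → c ∉ J → d ∉ J →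
    ¬ (M.IsFinBase (insert a (insert c J)) ∧ M.IsFinBase (insert b (insert d J))) →
    M.IsFinBase (insert a (insert b J)) → M.IsFinBase (insert c (insert d J)) →
    M.IsFinBase (insert a (insert d J)) → M.IsFinBase (insert b (insert c J)) →
    y (insert a (insert b J)) * y (insert c (insert d J)) =
      e * (y (insert a (insert d J)) * y (insert b (insert c J)))
  eq₁₄ : ∀ (J : Finset E) (a b c d : E), J.card + 2 = M.rk → a < b → b < c → c < d →
    a ∉ J → b ∉ J → c ∉ J → d ∉ J →
    ¬ (M.IsFinBase (insert a (insert d J)) ∧ M.IsFinBase (insert b (insert c J))) →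
    M.IsFinBase (insert a (insert b J)) → M.IsFinBase (insert c (insert d J)) →
    M.IsFinBase (insert a (insert c J)) → M.IsFinBase (insert b (insert d J)) →
    y (insert a (insert b J)) * y (insert c (insert d J)) =
      y (insert a (insert c J)) * y (insert b (insert d J))

/-- The exchange relations up to sign for the squares of bases with vanishing third term. -/
def IsExchange (e : A) (he : e ^ 2 = 1) : Prop :=
  ∀ (J : Finset E) (k₁ k₂ l₁ l₂ : E), J.card + 2 = M.rk →
    k₁ ≠ k₂ → k₁ ≠ l₁ → k₁ ≠ l₂ → k₂ ≠ l₁ → k₂ ≠ l₂ → l₁ ≠ l₂ →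
    k₁ ∉ J → k₂ ∉ J → l₁ ∉ J → l₂ ∉ J →
    ¬ (M.IsFinBase (insert k₁ (insert k₂ J)) ∧ M.IsFinBase (insert l₁ (insert l₂ J))) →
    M.IsFinBase (insert k₁ (insert l₁ J)) → M.IsFinBase (insert k₂ (insert l₂ J)) →
    M.IsFinBase (insert k₁ (insert l₂ J)) → M.IsFinBase (insert k₂ (insert l₁ J)) →
    y (insert k₁ (insert l₁ J)) * y (insert k₂ (insert l₂ J)) =
      unitsHom e he (ordSign k₁ l₁ * ordSign k₂ l₂ * ordSign k₁ l₂ * ordSign k₂ l₁) *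
        (y (insert k₁ (insert l₂ J)) * y (insert k₂ (insert l₁ J)))

variable {M y}

/-- The vanishing product is that of `k₁ k₂` and `l₁ l₂`. It can sit in the order as `ab|cd`,
`ac|bd` or `ad|bc`, and only the interleaved position `ac|bd` has sign `ε`. -/
theorem IsExchange.isPluecker (h : IsExchange M y e he) : IsPluecker M y e where
  eq₁₂ J a b c d hJ h₁ h₂ h₃ ha hb hc hd h0 h4 h5 h6 h7 := by
    have := h J a b c d hJ h₁.ne (h₁.trans h₂).ne (h₁.trans (h₂.trans h₃)).ne h₂.ne
      (h₂.trans h₃).ne h₃.ne ha hb hc hd h0 h4 h5 h6 h7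
    simpa [ordSign_of_lt, h₁.trans h₂, h₁.trans (h₂.trans h₃), h₂, h₂.trans h₃] using this
  eq₁₃ J a b c d hJ h₁ h₂ h₃ ha hb hc hd h0 h4 h5 h6 h7 := by
    have := h J a c b d hJ (h₁.trans h₂).ne h₁.ne (h₁.trans (h₂.trans h₃)).ne h₂.ne' h₃.ne
      (h₂.trans h₃).ne ha hc hb hd h0 h4 h5 h6 (by rwa [Finset.insert_comm])
    simpa [ordSign_of_lt, ordSign_of_gt, h₁, h₁.trans (h₂.trans h₃), h₂, h₃, unitsHom_neg_one,
      Finset.insert_comm c b] using this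
  eq₁₄ J a b c d hJ h₁ h₂ h₃ ha hb hc hd h0 h4 h5 h6 h7 := by
    have := h J a d b c hJ (h₁.trans (h₂.trans h₃)).ne h₁.ne (h₁.trans h₂).ne (h₂.trans h₃).ne'
      h₃.ne' h₂.ne ha hd hb hc h0 h4 (by rwa [Finset.insert_comm]) h6 (by rwa [Finset.insert_comm])
    simpa [ordSign_of_lt, ordSign_of_gt, h₁, h₁.trans h₂, h₂.trans h₃, h₃,
      Finset.insert_comm d c, Finset.insert_comm d b] using this

/-- Swapping `k₁, k₂` or `l₁, l₂` interchanges the two sides, which is harmless as the sign is its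
own inverse. Swapping the `k`'s with the `l`'s flips all four order signs and so preserves their
product. After these symmetries only three relative orders remain, one for each Plücker relation. -/
theorem IsPluecker.isExchange (h : IsPluecker M y e) : IsExchange M y e he := by
  intro J k₁ k₂ l₁ l₂ hJ n₁ n₂ n₃ n₄ n₅ n₆ hk₁ hk₂ hl₁ hl₂ h0 h₁ h₂ h₃ h₄
  -- reduce to `k₁ < k₂`, `l₁ < l₂` and `k₁ < l₁`
  wlog hk : k₁ < k₂ generalizing k₁ k₂
  · have := this k₂ k₁ n₁.symm n₄ n₅ n₂ n₃ hk₂ hk₁ (by rwa [Finset.insert_comm]) h₄ h₃ h₂ h₁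
      (lt_of_le_of_ne (not_lt.mp hk) n₁.symm)
    rw [mul_comm (y (insert k₁ (insert l₂ J))), this,
      show ordSign k₁ l₁ * ordSign k₂ l₂ * ordSign k₁ l₂ * ordSign k₂ l₁ =
        ordSign k₂ l₁ * ordSign k₁ l₂ * ordSign k₂ l₂ * ordSign k₁ l₁ by ac_rfl,
      unitsHom_mul_self, mul_comm]
  wlog hl : l₁ < l₂ generalizing l₁ l₂
  · have := this l₂ l₁ n₆.symm hl₂ hl₁ n₃ n₂ n₅ n₄ (by rwa [Finset.insert_comm l₂]) h₃ h₄ h₁ h₂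
      (lt_of_le_of_ne (not_lt.mp hl) n₆.symm)
    rw [this, show ordSign k₁ l₁ * ordSign k₂ l₂ * ordSign k₁ l₂ * ordSign k₂ l₁ =
        ordSign k₁ l₂ * ordSign k₂ l₁ * ordSign k₁ l₁ * ordSign k₂ l₂ by ac_rfl,
      unitsHom_mul_self]
  wlog hkl : k₁ < l₁ generalizing k₁ k₂ l₁ l₂
  · have := this l₁ l₂ n₆ hl₁ hl₂ hl k₁ k₂ n₁ hk₁ hk₂ n₂.symm n₄.symm n₃.symm n₅.symm
      (by rwa [and_comm]) (by rwa [Finset.insert_comm])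
      (by rwa [Finset.insert_comm]) (by rwa [Finset.insert_comm]) (by rwa [Finset.insert_comm])
      hk (lt_of_le_of_ne (not_lt.mp hkl) n₂.symm)
    rw [Finset.insert_comm l₁ k₁, Finset.insert_comm l₂ k₂, Finset.insert_comm l₁ k₂,
      Finset.insert_comm l₂ k₁] at this
    rw [this, ordSign_swap n₂, ordSign_swap n₃, ordSign_swap n₄, ordSign_swap n₅,
      mul_comm (y (insert k₂ (insert l₁ J)))]
    simp only [mul_neg, neg_mul, neg_neg]
    congr 2
    ac_rfl
  have hkl2 := hkl.trans hl
  rcases n₄.lt_or_gt with h5 | h5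
  · have := h.eq₁₂ J k₁ k₂ l₁ l₂ hJ hk h5 hl hk₁ hk₂ hl₁ hl₂ h0 h₁ h₂ h₃ h₄
    simpa [ordSign_of_lt, hkl, hkl2, h5, h5.trans hl] using this
  rcases n₅.lt_or_gt with h6 | h6
  · have := h.eq₁₃ J k₁ l₁ k₂ l₂ hJ hkl h5 h6 hk₁ hl₁ hk₂ hl₂ h0 h₁ h₂ h₃
      (by rwa [Finset.insert_comm])
    simpa [ordSign_of_lt, ordSign_of_gt, hkl, hkl2, h5, h6, unitsHom_neg_one,
      Finset.insert_comm l₁ k₂] using this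
  · have := h.eq₁₄ J k₁ l₁ l₂ k₂ hJ hkl hl h6 hk₁ hl₁ hl₂ hk₂ h0 h₁ (by rwa [Finset.insert_comm])
      h₃ (by rwa [Finset.insert_comm])
    simpa [ordSign_of_lt, ordSign_of_gt, hkl, hkl2, h5, h6,
      Finset.insert_comm l₁ k₂, Finset.insert_comm l₂ k₂] using this

end Units
end Matroid

/-! ### The Tutte group in terms of sorted bases -/

namespace Matroid

universe u

variable {E : Type u} {M : Matroid E}

theorem IsFinBase.card_eq_rk {B : Finset E} (hB : M.IsFinBase B) : B.card = M.rk :=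
  Matroid.card_eq_rk M ⟨B, hB⟩

section

variable (M)

theorem tutteEps_sq : M.tutteEps ^ 2 = 1 :=
  (QuotientGroup.eq_one_iff _).mpr (Subgroup.subset_closure .eps_sq)

theorem tutteX_perm (σ : Equiv.Perm (Fin M.rk)) (i : Fin M.rk → E) (hi : M.IsBase (Set.range i))
    (hσ : M.IsBase (Set.range (i ∘ σ))) :
    M.tutteEps ^ signExponent σ * M.tutteX (i ∘ σ) hσ = M.tutteX i hi := by
  rw [← mul_inv_eq_one]
  exact (QuotientGroup.eq_one_iff _).mpr (Subgroup.subset_closure (.perm σ i hi hσ))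

theorem tutteX_exchange {s : ℕ} (h : s + 2 = M.rk) (J : Fin s → E) (k₁ k₂ l₁ l₂ : E)
    (h₁₁ : M.IsBase (Set.range (M.tupleSnoc h J k₁ l₁)))
    (h₂₂ : M.IsBase (Set.range (M.tupleSnoc h J k₂ l₂)))
    (h₁₂ : M.IsBase (Set.range (M.tupleSnoc h J k₁ l₂)))
    (h₂₁ : M.IsBase (Set.range (M.tupleSnoc h J k₂ l₁)))
    (hk : ¬ M.IsBase (Set.range J ∪ {k₁, k₂})) :
    M.tutteX _ h₁₁ * M.tutteX _ h₂₂ = M.tutteX _ h₁₂ * M.tutteX _ h₂₁ := by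
  rw [← mul_inv_eq_one, mul_inv, ← mul_assoc]
  exact (QuotientGroup.eq_one_iff _).mpr
    (Subgroup.subset_closure (.exchange h J k₁ k₂ l₁ l₂ h₁₁ h₂₂ h₁₂ h₂₁ hk))

end

variable [LinearOrder E]

theorem isBase_range_iff {n : ℕ} {i : Fin n → E} :
    M.IsBase (Set.range i) ↔ M.IsFinBase (Finset.univ.image i) := by
  rw [IsFinBase, Finset.coe_image, Finset.coe_univ, Set.image_univ]

theorem injective_of_isFinBase {i : Fin M.rk → E} (hi : M.IsFinBase (Finset.univ.image i)) :
    Function.Injective i := by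
  have h : (Finset.univ.image i).card = (Finset.univ : Finset (Fin M.rk)).card := by
    rw [hi.card_eq_rk, Finset.card_univ, Fintype.card_fin]
  have := Finset.injOn_of_card_image_eq h
  rwa [Finset.coe_univ, Set.injOn_univ] at this

variable (M)

open Classical in
/-- The function `I ↦ X_I` on finite sets, with value `1` if `I` is not a basis. -/
noncomputable def tutteFun (I : Finset E) : M.TutteG :=
  if h : M.IsFinBase I then M.tutteXBasis ⟨I, h⟩ else 1

theorem pow_signExponent {A : Type*} [CommGroup A] {e : A} {he : e ^ 2 = 1} {n : ℕ}
    (σ : Equiv.Perm (Fin n)) : e ^ signExponent σ = unitsHom e he (Equiv.Perm.sign σ) := by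
  rcases Int.units_eq_one_or (Equiv.Perm.sign σ) with h | h
  · simp [signExponent, h]
  · rw [h, unitsHom_neg_one, signExponent, h, if_neg (by decide), pow_one]

/-- Sorting the tuple with the permutation relation leaves exactly the sign of the sorting
permutation. -/
theorem tutteX_eq (i : Fin M.rk → E) (hi : M.IsBase (Set.range i)) :
    M.tutteX i hi = unitsHom M.tutteEps M.tutteEps_sq (tupleSign i) *
      M.tutteFun (Finset.univ.image i) := by
  have hi' := isBase_range_iff.mp hi
  have hinj := injective_of_isFinBase hi'
  have hmono : StrictMono (i ∘ Tuple.sort i) :=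
    (Tuple.monotone_sort i).strictMono_of_injective (hinj.comp (Tuple.sort i).injective)
  have h1 : i ∘ Tuple.sort i = (Finset.univ.image i).orderEmbOfFin hi'.card_eq_rk :=
    Finset.orderEmbOfFin_unique _ (fun p => by simp) hmono
  have h2 := tupleSign_comp hinj (Tuple.sort i)
  rw [tupleSign_strictMono hmono] at h2
  have h3 : Equiv.Perm.sign (Tuple.sort i) = tupleSign i := by
    rw [eq_comm, ← mul_left_cancel_iff (a := Equiv.Perm.sign (Tuple.sort i)), ← h2,
      Int.units_mul_self]
  have hσ : M.IsBase (Set.range (i ∘ Tuple.sort i)) := by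
    rwa [(Tuple.sort i).surjective.range_comp]
  rw [← M.tutteX_perm (Tuple.sort i) i hi hσ, pow_signExponent (he := M.tutteEps_sq), h3]
  congr 1
  rw [tutteFun, dif_pos hi', tutteXBasis]
  congr 1

section Exchange

variable {A : Type*} [CommGroup A] {e : A} {he : e ^ 2 = 1} {y : Finset E → A}

/-- The factors that involve `J` agree on both sides, so only the four signs between the `k`'s and
the `l`'s matter, and each surplus sign occurs twice. -/
theorem unitsHom_tupleSnoc_mul {s : ℕ} (h : s + 2 = M.rk) (J : Fin s → E) (k₁ k₂ l₁ l₂ : E) :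
    unitsHom e he (tupleSign (M.tupleSnoc h J k₁ l₁)) *
        unitsHom e he (tupleSign (M.tupleSnoc h J k₂ l₂)) =
      unitsHom e he (ordSign k₁ l₁ * ordSign k₂ l₂ * ordSign k₁ l₂ * ordSign k₂ l₁) *
        (unitsHom e he (tupleSign (M.tupleSnoc h J k₁ l₂)) *
          unitsHom e he (tupleSign (M.tupleSnoc h J k₂ l₁))) := by
  simp only [← map_mul, tupleSign_tupleSnoc]
  congr 1
  generalize tupleSign J = a
  generalize ∏ p, ordSign (J p) k₁ = b
  generalize ∏ p, ordSign (J p) k₂ = b'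
  generalize ∏ p, ordSign (J p) l₁ = c
  generalize ∏ p, ordSign (J p) l₂ = c'
  have h1 := Int.units_mul_self (ordSign k₁ l₂)
  have h2 := Int.units_mul_self (ordSign k₂ l₁)
  calc _ = a * a * b * b' * c * c' * (ordSign k₁ l₁ * ordSign k₂ l₂) * 1 * 1 := by
        simp only [mul_one]; ac_rfl
    _ = a * a * b * b' * c * c' * (ordSign k₁ l₁ * ordSign k₂ l₂) *
          (ordSign k₁ l₂ * ordSign k₁ l₂) * (ordSign k₂ l₁ * ordSign k₂ l₁) := by rw [h1, h2]
    _ = _ := by ac_rfl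

theorem range_union_pair {s : ℕ} (J : Fin s → E) (k l : E) :
    Set.range J ∪ {k, l} = ((insert k (insert l (Finset.univ.image J)) : Finset E) : Set E) := by
  ext x
  simp only [Set.mem_union, Set.mem_range, Set.mem_insert_iff, Set.mem_singleton_iff,
    Finset.coe_insert, Finset.coe_image, Finset.coe_univ, Set.image_univ]
  tauto

theorem isExchange_tutteFun : IsExchange M M.tutteFun M.tutteEps M.tutteEps_sq := by
  have main : ∀ (J : Finset E) (k₁ k₂ l₁ l₂ : E), J.card + 2 = M.rk →
      ¬ M.IsFinBase (insert k₁ (insert k₂ J)) →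
      M.IsFinBase (insert k₁ (insert l₁ J)) → M.IsFinBase (insert k₂ (insert l₂ J)) →
      M.IsFinBase (insert k₁ (insert l₂ J)) → M.IsFinBase (insert k₂ (insert l₁ J)) →
      M.tutteFun (insert k₁ (insert l₁ J)) * M.tutteFun (insert k₂ (insert l₂ J)) =
      unitsHom M.tutteEps M.tutteEps_sq
          (ordSign k₁ l₁ * ordSign k₂ l₂ * ordSign k₁ l₂ * ordSign k₂ l₁) *
        (M.tutteFun (insert k₁ (insert l₂ J)) * M.tutteFun (insert k₂ (insert l₁ J))) := by
    intro J k₁ k₂ l₁ l₂ hJ hk h₁₁ h₂₂ h₁₂ h₂₁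
    let j : Fin J.card → E := J.orderEmbOfFin rfl
    have hj : Finset.univ.image j = J := Finset.image_orderEmbOfFin_univ J rfl
    have hbase : ∀ {k l}, M.IsFinBase (insert k (insert l J)) →
        M.IsBase (Set.range (M.tupleSnoc hJ j k l)) := by
      intro k l h
      rwa [isBase_range_iff, image_tupleSnoc, hj]
    have h := M.tutteX_exchange hJ j k₁ k₂ l₁ l₂ (hbase h₁₁) (hbase h₂₂) (hbase h₁₂) (hbase h₂₁)
      (by rwa [range_union_pair, hj])
    simp only [tutteX_eq, image_tupleSnoc, hj] at h
    rw [mul_mul_mul_comm, unitsHom_tupleSnoc_mul, mul_mul_mul_comm (unitsHom _ _ _) (M.tutteFun _),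
      mul_assoc, mul_left_comm] at h
    exact (unitsHom_mul_self _ _).symm.trans (congrArg _ (mul_left_cancel h))
  intro J k₁ k₂ l₁ l₂ hJ n₁ n₂ n₃ n₄ n₅ n₆ hk₁ hk₂ hl₁ hl₂ h0 h₁ h₂ h₃ h₄
  -- The relation in `G_M` requires that `k₁, k₂` do not complete `J`. If they do, then `l₁, l₂` do
  -- not, and the roles of the `k`'s and the `l`'s are exchanged.
  by_cases hk : M.IsFinBase (insert k₁ (insert k₂ J))
  · have := main J l₁ l₂ k₁ k₂ hJ (fun h => h0 ⟨hk, h⟩) (by rwa [Finset.insert_comm])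
      (by rwa [Finset.insert_comm]) (by rwa [Finset.insert_comm]) (by rwa [Finset.insert_comm])
    rw [Finset.insert_comm l₁ k₁, Finset.insert_comm l₂ k₂, Finset.insert_comm l₁ k₂,
      Finset.insert_comm l₂ k₁] at this
    rw [this, ordSign_swap n₂, ordSign_swap n₃, ordSign_swap n₄, ordSign_swap n₅,
      mul_comm (M.tutteFun (insert k₂ (insert l₁ J)))]
    simp only [mul_neg, neg_mul, neg_neg]
    congr 2
    ac_rfl
  · exact main J k₁ k₂ l₁ l₂ hJ hk h₁ h₂ h₃ h₄

variable {M}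

/-- The homomorphism on the free group of a function on the bases. -/
noncomputable def tutteFreeLift (M : Matroid E) (e : A) (he : e ^ 2 = 1) (y : Finset E → A) :
    M.TutteFree →* A :=
  AddMonoidHom.toMultiplicativeLeft (FreeAbelianGroup.lift fun x => match x with
    | .eps => Additive.ofMul e
    | .X i _ => Additive.ofMul (unitsHom e he (tupleSign i) * y (Finset.univ.image i)))

theorem tutteFreeLift_eps : M.tutteFreeLift e he y M.freeEps = e := by
  simp [tutteFreeLift, freeEps]

theorem tutteFreeLift_X (i : Fin M.rk → E) (hi : M.IsBase (Set.range i)) :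
    M.tutteFreeLift e he y (M.freeX i hi) =
      unitsHom e he (tupleSign i) * y (Finset.univ.image i) := by
  simp [tutteFreeLift, freeX]

theorem IsExchange.tutteFreeLift_rel (h : IsExchange M y e he) {g : M.TutteFree}
    (hg : M.TutteRel g) : M.tutteFreeLift e he y g = 1 := by
  cases hg with
  | eps_sq => rw [map_pow, tutteFreeLift_eps, he]
  | perm σ i hi hσ =>
    have hinj := injective_of_isFinBase (isBase_range_iff.mp hi)
    have h1 : Finset.univ.image (i ∘ σ) = Finset.univ.image i := by
      rw [← Finset.image_image]
      congr 1
      ext x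
      simp
    rw [map_mul, map_mul, map_pow, map_inv, tutteFreeLift_eps, tutteFreeLift_X, tutteFreeLift_X,
      pow_signExponent (he := he), tupleSign_comp hinj, h1, map_mul, ← mul_assoc, ← mul_assoc,
      ← map_mul, Int.units_mul_self, map_one, one_mul, mul_inv_cancel]
  | @exchange s hs J k₁ k₂ l₁ l₂ h₁₁ h₂₂ h₁₂ h₂₁ hk =>
    rw [isBase_range_iff] at h₁₁ h₂₂ h₁₂ h₂₁
    rw [map_mul, map_mul, map_mul, map_inv, map_inv, mul_assoc, ← mul_inv, mul_inv_eq_one]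
    simp only [tutteFreeLift_X]
    -- The relations of `G_M` allow repeated entries. With `k₁ = k₂` or `l₁ = l₂` both sides are
    -- equal up to order; all other coincidences are excluded below by the cardinality of a basis.
    by_cases hkk : k₁ = k₂
    · subst hkk
      rw [mul_comm]
    by_cases hll : l₁ = l₂
    · subst hll
      rfl
    have key : ∀ {k l}, M.IsFinBase (Finset.univ.image (M.tupleSnoc hs J k l)) →
        (Finset.univ.image J).card = s ∧ M.IsFinBase (insert k (insert l (Finset.univ.image J))) ∧
          k ≠ l ∧ k ∉ Finset.univ.image J ∧ l ∉ Finset.univ.image J := by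
      intro k l hkl
      rw [image_tupleSnoc] at hkl
      have h1 := hkl.card_eq_rk
      have h2 : (Finset.univ.image J).card ≤ s := Finset.card_image_le.trans (by simp)
      have h3 := Finset.card_insert_le l (Finset.univ.image J)
      have h4 := Finset.card_insert_le k (insert l (Finset.univ.image J))
      have h5 : k ∉ insert l (Finset.univ.image J) := fun h => by
        rw [Finset.card_insert_of_mem h] at h1
        omega
      have h6 : l ∉ Finset.univ.image J := fun h => by
        rw [Finset.card_insert_of_mem h] at h3 h4
        omega
      rw [Finset.mem_insert, not_or] at h5
      exact ⟨by omega, hkl, h5.1, h5.2, h6⟩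
    have hJ := (key h₁₁).1
    obtain ⟨-, b₁₁, c₁₁, d₁, f₁⟩ := key h₁₁
    obtain ⟨-, b₂₂, c₂₂, d₂, f₂⟩ := key h₂₂
    obtain ⟨-, b₁₂, c₁₂, -, -⟩ := key h₁₂
    obtain ⟨-, b₂₁, c₂₁, -, -⟩ := key h₂₁
    have := h (Finset.univ.image J) k₁ k₂ l₁ l₂ (by rw [hJ, hs]) hkk c₁₁ c₁₂ c₂₁ c₂₂ hll d₁ d₂ f₁ f₂
      (fun h => hk (by rw [range_union_pair]; exact h.1)) b₁₁ b₂₂ b₁₂ b₂₁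
    rw [mul_mul_mul_comm, unitsHom_tupleSnoc_mul, mul_mul_mul_comm (unitsHom _ _ _) (y _)]
    simp only [image_tupleSnoc]
    rw [this, mul_assoc, mul_left_comm (unitsHom _ _ _ * unitsHom _ _ _), unitsHom_mul_self]

/-- The homomorphism on `G_M` that is defined by a function on the bases. -/
noncomputable def IsExchange.lift (h : IsExchange M y e he) : M.TutteG →* A :=
  QuotientGroup.lift _ (M.tutteFreeLift e he y)
    ((Subgroup.closure_le _).mpr fun _ hg => h.tutteFreeLift_rel hg)

theorem IsExchange.lift_eps (h : IsExchange M y e he) : h.lift M.tutteEps = e :=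
  tutteFreeLift_eps (he := he) (y := y)

theorem IsExchange.lift_basis (h : IsExchange M y e he) (I : M.Bases) :
    h.lift (M.tutteXBasis I) = y I.1 := by
  refine (tutteFreeLift_X (he := he) (y := y) _ _).trans ?_
  rw [tupleSign_strictMono (OrderEmbedding.strictMono _), map_one, one_mul,
    Finset.image_orderEmbOfFin_univ]

end Exchange

end Matroid

/-! ### Maps out of quotients and pasteurizations -/

noncomputable section

universe u v

namespace OrderedBlueprint

section Lift

variable {B : OrderedBlueprint.{u}} {S : Set (B.Amb × B.Amb)} {T : OrderedBlueprint.{v}}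

theorem GenLE.map (f : B.Amb →+* T.Amb) (hf : ∀ x y, x ≤ y → f x ≤ f y)
    (hS : ∀ p ∈ S, f p.1 ≤ f p.2) {x y : B.Amb} (h : B.GenLE S x y) : f x ≤ f y := by
  induction h with
  | of_le h => exact hf _ _ h
  | of_mem h => exact hS _ h
  | trans _ _ h h' => exact h.trans h'
  | add _ _ h h' => rw [map_add, map_add]; exact T.add_le h h'
  | mul _ _ h k => rw [map_mul, map_mul]; exact T.mul_le h k

/-- The extension of a monotone homomorphism to a quotient. -/
def quotLift (f : B.Amb →+* T.Amb) (hf : ∀ x y, x ≤ y → f x ≤ f y)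
    (hS : ∀ p ∈ S, f p.1 ≤ f p.2) : (B.quot S).Amb →+* T.Amb :=
  RingCon.lift (B.genCon S) f fun _ _ h => le_antisymm (h.1.map f hf hS) (h.2.map f hf hS)

theorem quotLift_toQuot (f : B.Amb →+* T.Amb) (hf : ∀ x y, x ≤ y → f x ≤ f y)
    (hS : ∀ p ∈ S, f p.1 ≤ f p.2) (x : B.Amb) : quotLift f hf hS (B.toQuot S x) = f x :=
  rfl

theorem toQuot_surjective : Function.Surjective (B.toQuot S) := RingCon.mk'_surjective _

theorem quotLift_mono (f : B.Amb →+* T.Amb) (hf : ∀ x y, x ≤ y → f x ≤ f y)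
    (hS : ∀ p ∈ S, f p.1 ≤ f p.2) (x y : (B.quot S).Amb) (h : x ≤ y) :
    quotLift f hf hS x ≤ quotLift f hf hS y := by
  obtain ⟨x, rfl⟩ := toQuot_surjective x
  obtain ⟨y, rfl⟩ := toQuot_surjective y
  exact GenLE.map f hf hS h

end Lift

section Pasteurization

variable (B : OrderedBlueprint.{u})

/-- The canonical map `B^+ → (B ⊗ 𝔽₁^±)^+`. -/
def tensorHom : B.Amb →+* B.tensorF1pm.Amb :=
  (toQuot _ _).comp (MonoidAlgebra.singleOneRingHom : B.Amb →+* MonoidAlgebra B.Amb ℤˣ)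

/-- The canonical map `B^+ → (B^±)^+`. -/
def pasteurizationHom : B.Amb →+* B.pasteurization.Amb := (toQuot _ _).comp B.tensorHom

theorem coe_toPasteurization (a : B.points) :
    (B.toPasteurization a : B.pasteurization.Amb) = B.pasteurizationHom a := rfl

theorem tensorHom_mono {x y : B.Amb} (h : x ≤ y) : B.tensorHom x ≤ B.tensorHom y :=
  GenLE.of_mem (.inl ⟨x, y, h, rfl⟩)

theorem pasteurizationHom_mono {x y : B.Amb} (h : x ≤ y) :
    B.pasteurizationHom x ≤ B.pasteurizationHom y :=
  GenLE.of_le (B.tensorHom_mono h)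

/-- The element `1 ⊗ ε` of `B ⊗ 𝔽₁^±`. -/
def tensorEps : B.tensorF1pm.Amb :=
  toQuot _ _ (MonoidAlgebra.single (-1 : ℤˣ) (1 : B.Amb) : MonoidAlgebra B.Amb ℤˣ)

theorem zero_le_tensorEps_add : 0 ≤ B.tensorEps + 1 := by
  have : (0 : B.tensorF1pm.Amb) ≤ 1 + B.tensorEps := GenLE.of_mem (.inr rfl)
  rwa [add_comm]

theorem tensorEps_mem : B.tensorEps ∈ B.tensorF1pm.points :=
  ⟨_, ⟨1, B.points.one_mem, -1, rfl⟩, rfl⟩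

theorem tensorHom_mem {a : B.Amb} (ha : a ∈ B.points) : B.tensorHom a ∈ B.tensorF1pm.points :=
  (B.toTensorF1pm ⟨a, ha⟩).2

theorem toQuot_commonWeakInverse {a a' b : B.Amb} (ha : a ∈ B.points) (ha' : a' ∈ B.points)
    (hb : b ∈ B.points) (h : 0 ≤ a + b) (h' : 0 ≤ a' + b) :
    B.toQuot B.commonWeakInverse a = B.toQuot B.commonWeakInverse a' :=
  le_antisymm (α := (B.quot B.commonWeakInverse).Amb)
    (GenLE.of_mem ⟨ha, ha', b, hb, h, h'⟩) (GenLE.of_mem ⟨ha', ha, b, hb, h', h⟩)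

theorem zero_le_tensorHom {a b : B.Amb} (h : 0 ≤ a + b) : 0 ≤ B.tensorHom a + B.tensorHom b := by
  have := B.tensorHom_mono h
  rwa [map_zero, map_add] at this

theorem toPasteurization_eq {a a' b : B.points} (h : 0 ≤ (a : B.Amb) + b)
    (h₂ : 0 ≤ (a' : B.Amb) + b) : B.toPasteurization a = B.toPasteurization a' :=
  Subtype.ext (B.tensorF1pm.toQuot_commonWeakInverse (B.tensorHom_mem a.2) (B.tensorHom_mem a'.2)
    (B.tensorHom_mem b.2) (B.zero_le_tensorHom h) (B.zero_le_tensorHom h₂))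

/-- A weak inverse of `1` becomes the element `ε` of the pasteurization. -/
theorem toQuot_tensorEps {e : B.Amb} (he : e ∈ B.points) (h : 0 ≤ e + 1) :
    toQuot _ _ B.tensorEps = B.pasteurizationHom e := by
  refine B.tensorF1pm.toQuot_commonWeakInverse B.tensorEps_mem (B.tensorHom_mem he)
    B.tensorF1pm.points.one_mem B.zero_le_tensorEps_add ?_
  have := B.zero_le_tensorHom h
  rwa [map_one] at this

/-- If `1` already has a weak inverse `e` in `B`, it is identified with `1 ⊗ ε`, so the
pasteurization has no new points. -/
theorem exists_toPasteurization_eq {e : B.Amb} (he : e ∈ B.points) (h : 0 ≤ e + 1)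
    (x : B.pasteurization.points) : ∃ a, B.toPasteurization a = x := by
  obtain ⟨_, _, ⟨_, ⟨a, ha, s, rfl⟩, rfl⟩, rfl⟩ := x
  rcases Int.units_eq_one_or s with rfl | rfl
  · exact ⟨⟨a, ha⟩, rfl⟩
  · refine ⟨⟨e * a, mul_mem he ha⟩, Subtype.ext ?_⟩
    rw [coe_toPasteurization]
    change B.pasteurizationHom (e * a) = _
    rw [map_mul, ← B.toQuot_tensorEps he h]
    have h1 : (MonoidAlgebra.single (-1 : ℤˣ) a : MonoidAlgebra B.Amb ℤˣ) =
        MonoidAlgebra.single (-1) 1 * MonoidAlgebra.single 1 a := by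
      rw [MonoidAlgebra.single_mul_single, mul_one, one_mul]
    exact congrArg (fun z => toQuot _ _ (toQuot _ _ z)) h1.symm

variable {B} {T : OrderedBlueprint.{v}}

theorem liftNCRingHom_single {R k G : Type*} [CommSemiring R] [CommSemiring k] [Monoid G]
    (f : k →+* R) (g : G →* R) (s : G) (a : k) :
    MonoidAlgebra.liftNCRingHom f g (fun _ _ => Commute.all _ _) (MonoidAlgebra.single s a) =
      f a * g s :=
  MonoidAlgebra.liftNC_single _ _ _ _

/-- The extension of a monotone homomorphism to `B ⊗ 𝔽₁^±`. -/
def tensorLift (f : B.Amb →+* T.Amb) (hf : ∀ x y, x ≤ y → f x ≤ f y) (g : ℤˣ →* T.Amb)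
    (hg : 0 ≤ 1 + g (-1)) : B.tensorF1pm.Amb →+* T.Amb :=
  quotLift (T := T) (MonoidAlgebra.liftNCRingHom f g fun _ _ => Commute.all _ _)
    (fun x y h => by rw [show x = y from h])
    (by
      rintro _ (⟨x, y, h, rfl⟩ | rfl)
      · have h1 := liftNCRingHom_single f g 1
        simp only [map_one, mul_one] at h1
        change MonoidAlgebra.liftNCRingHom f g _ (MonoidAlgebra.single 1 x) ≤
          MonoidAlgebra.liftNCRingHom f g _ (MonoidAlgebra.single 1 y)
        rw [h1, h1]
        exact hf x y h
      · change MonoidAlgebra.liftNCRingHom f g _ 0 ≤ MonoidAlgebra.liftNCRingHom f g _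
          (MonoidAlgebra.single 1 1 + MonoidAlgebra.single (-1) 1)
        rw [map_zero, map_add, liftNCRingHom_single, liftNCRingHom_single, map_one, map_one,
          one_mul, one_mul]
        exact hg)

theorem tensorLift_mono (f : B.Amb →+* T.Amb) (hf : ∀ x y, x ≤ y → f x ≤ f y) (g : ℤˣ →* T.Amb)
    (hg : 0 ≤ 1 + g (-1)) (x y : B.tensorF1pm.Amb) (h : x ≤ y) :
    tensorLift f hf g hg x ≤ tensorLift f hf g hg y :=
  quotLift_mono _ _ _ x y h

theorem tensorLift_single (f : B.Amb →+* T.Amb) (hf : ∀ x y, x ≤ y → f x ≤ f y) (g : ℤˣ →* T.Amb)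
    (hg : 0 ≤ 1 + g (-1)) (s : ℤˣ) (a : B.Amb) :
    tensorLift f hf g hg (toQuot _ _ (MonoidAlgebra.single s a : MonoidAlgebra B.Amb ℤˣ)) =
      f a * g s := by
  exact (quotLift_toQuot _ _ _ _).trans (liftNCRingHom_single f g s a)

theorem tensorLift_tensorHom (f : B.Amb →+* T.Amb) (hf : ∀ x y, x ≤ y → f x ≤ f y)
    (g : ℤˣ →* T.Amb) (hg : 0 ≤ 1 + g (-1)) (a : B.Amb) :
    tensorLift f hf g hg (B.tensorHom a) = f a :=
  (tensorLift_single f hf g hg 1 a).trans (by rw [map_one, mul_one])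

end Pasteurization

end OrderedBlueprint

/-! ### Null ideals in group semirings -/

namespace OrderedBlueprint

section NullIdeal

variable {G : Type u} [CommGroup G] {D : Type v} [CommGroup D]

/-- The number of terms of a formal sum of group elements. -/
def numTerms : MonoidAlgebra ℕ G →+* ℕ := MonoidAlgebra.liftNCRingHom (RingHom.id ℕ) (1 : G →* ℕ)
  fun _ _ => Commute.all _ _

theorem numTerms_single (g : G) (n : ℕ) : numTerms (MonoidAlgebra.single g n) = n :=
  (liftNCRingHom_single _ _ _ _).trans (mul_one _)

theorem eq_of_numTerms (x : MonoidAlgebra ℕ G) :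
    (numTerms x = 0 → x = 0) ∧ (numTerms x = 1 → ∃ g, x = MonoidAlgebra.single g 1) := by
  induction x using MonoidAlgebra.induction_linear with
  | zero => simp
  | add f g hf hg =>
    rw [map_add]
    refine ⟨fun h => ?_, fun h => ?_⟩
    · rw [hf.1 (by omega), hg.1 (by omega), add_zero]
    · rcases Nat.add_eq_one_iff.mp h with h | h
      · rw [hf.1 h.1, zero_add]
        exact hg.2 h.2
      · rw [hg.1 h.2, add_zero]
        exact hf.2 h.1
  | single g a =>
    rw [numTerms_single]
    refine ⟨?_, ?_⟩
    · rintro rfl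
      exact MonoidAlgebra.single_zero g
    · rintro rfl
      exact ⟨g, rfl⟩

variable (D) in
/-- The formal sums without terms of multiplicity one. -/
def noSimpleTerm : Ideal (MonoidAlgebra ℕ D) where
  carrier := {n | ∀ d, n.coeff d ≠ 1}
  zero_mem' _ := by simp
  add_mem' {a b} ha hb d := by
    have h1 := ha d
    have h2 := hb d
    rw [MonoidAlgebra.coeff_add, Finsupp.add_apply]
    omega
  smul_mem' x n hn := by
    induction x using MonoidAlgebra.induction_linear with
    | zero => simp
    | add f g hf hg =>
      intro d
      have h1 := hf d
      have h2 := hg d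
      rw [smul_eq_mul] at h1 h2 ⊢
      rw [add_mul, MonoidAlgebra.coeff_add, Finsupp.add_apply]
      omega
    | single g a =>
      intro d h
      rw [smul_eq_mul, MonoidAlgebra.coeff_single_mul_eq_mul_coeff (m₂ := g⁻¹ * d)
        (H := fun m _ => by rw [eq_inv_mul_iff_mul_eq])] at h
      exact hn _ (Nat.eq_one_of_mul_eq_one_left h)

/-- The formal sums that are zero, or of the form `g + e g`, or that have at least three terms. -/
def twoTermIdeal (e : G) : Ideal (MonoidAlgebra ℕ G) where
  carrier := {n | n = 0 ∨
    (∃ g, n = MonoidAlgebra.single g 1 + MonoidAlgebra.single (g * e) 1) ∨ 3 ≤ numTerms n}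
  zero_mem' := .inl rfl
  add_mem' := by
    have h2 : ∀ {n : MonoidAlgebra ℕ G}, (∃ g, n = MonoidAlgebra.single g 1 +
        MonoidAlgebra.single (g * e) 1) ∨ 3 ≤ numTerms n → 2 ≤ numTerms n := by
      rintro n (⟨g, rfl⟩ | h)
      · rw [map_add, numTerms_single, numTerms_single]
      · omega
    rintro a b (rfl | ha) hb
    · rwa [zero_add]
    · rcases hb with rfl | hb
      · rw [add_zero]
        exact .inr ha
      · refine .inr (.inr ?_)
        have := h2 ha
        have := h2 hb
        rw [map_add]
        omega
  smul_mem' x n hn := by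
    rw [smul_eq_mul]
    rcases hn with rfl | ⟨g, rfl⟩ | hn
    · exact .inl (mul_zero _)
    -- One term only translates the pair `g + e g`; two or more terms produce at least four terms.
    · by_cases hx : numTerms x = 0
      · rw [(eq_of_numTerms x).1 hx, zero_mul]
        exact .inl rfl
      by_cases hx1 : numTerms x = 1
      · obtain ⟨h, rfl⟩ := (eq_of_numTerms x).2 hx1
        refine .inr (.inl ⟨h * g, ?_⟩)
        rw [mul_add, MonoidAlgebra.single_mul_single, MonoidAlgebra.single_mul_single, mul_one,
          mul_assoc]
      · refine .inr (.inr ?_)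
        rw [map_mul, map_add, numTerms_single, numTerms_single]
        omega
    · by_cases hx : numTerms x = 0
      · rw [(eq_of_numTerms x).1 hx, zero_mul]
        exact .inl rfl
      · refine .inr (.inr ?_)
        rw [map_mul]
        nlinarith [Nat.one_le_iff_ne_zero.mpr hx]

/-- The null set of the blueprint over a group with sign `e` and a degree homomorphism `d`. -/
def nullIdeal (e : G) (d : G →* D) : Ideal (MonoidAlgebra ℕ G) :=
  twoTermIdeal e ⊓ (noSimpleTerm D).comap (MonoidAlgebra.mapDomainRingHom ℕ d)

/-- The ordered blueprint `(G ∪ {0}, ℕ[G], ≤)` with `x ≤ y` if `y = x + n` for an element `n` of a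
given ideal. -/
def ofIdeal (N : Ideal (MonoidAlgebra ℕ G)) : OrderedBlueprint.{u} where
  Amb := MonoidAlgebra ℕ G
  order :=
    { le := fun x y => ∃ n ∈ N, y = x + n
      le_refl := fun x => ⟨0, N.zero_mem, (add_zero x).symm⟩
      le_trans := by
        rintro x _ _ ⟨n, hn, rfl⟩ ⟨m, hm, rfl⟩
        exact ⟨n + m, N.add_mem hn hm, add_assoc _ _ _⟩
      -- With coefficients in `ℕ`, a sum `n + m` vanishes only if both summands do.
      le_antisymm := by
        rintro x _ ⟨n, hn, rfl⟩ ⟨m, hm, h⟩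
        ext g
        have := congrArg (fun z => MonoidAlgebra.coeff z g) h
        simp only [MonoidAlgebra.coeff_add, Finsupp.add_apply] at this ⊢
        omega }
  add_le := by
    rintro x _ z _ ⟨n, hn, rfl⟩ ⟨m, hm, rfl⟩
    exact ⟨n + m, N.add_mem hn hm, add_add_add_comm _ _ _ _⟩
  mul_le := by
    rintro x _ z _ ⟨n, hn, rfl⟩ ⟨m, hm, rfl⟩
    exact ⟨x * m + (z + m) * n, N.add_mem (N.mul_mem_left _ hm) (N.mul_mem_left _ hn), by ring⟩
  points := groupPoints G
  zero_mem := .inl rfl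
  closure_points := (ofGroup G).closure_points

theorem ofIdeal_zero_le {N : Ideal (MonoidAlgebra ℕ G)} {x : MonoidAlgebra ℕ G} :
    (show (ofIdeal N).Amb from 0) ≤ x ↔ x ∈ N := by
  constructor
  · rintro ⟨n, hn, h⟩
    rw [show x = n from h.trans (zero_add n)]
    exact hn
  · exact fun h => ⟨x, h, (zero_add x).symm⟩

theorem single_mem_groupPoints (g : G) : MonoidAlgebra.single g 1 ∈ groupPoints G := .inr ⟨g, rfl⟩

theorem numTerms_ne_one {e : G} {x : MonoidAlgebra ℕ G} (hx : x ∈ twoTermIdeal e) :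
    numTerms x ≠ 1 := by
  rcases hx with rfl | ⟨g, rfl⟩ | h
  · simp
  · rw [map_add, numTerms_single, numTerms_single]
    omega
  · omega

/-- A point has at most one weak inverse. -/
theorem eq_of_add_mem_twoTermIdeal {e : G} (he : e * e = 1) {a b : MonoidAlgebra ℕ G}
    (ha : a ∈ groupPoints G) (hb : b ∈ groupPoints G) (h : a + b ∈ twoTermIdeal e) :
    a = MonoidAlgebra.single e 1 * b := by
  have h1 := numTerms_ne_one h
  rcases ha with rfl | ⟨g, rfl⟩ <;> rcases hb with rfl | ⟨k, rfl⟩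
  · rw [mul_zero]
  · rw [zero_add, numTerms_single] at h1
    exact absurd rfl h1
  · rw [add_zero, numTerms_single] at h1
    exact absurd rfl h1
  · rw [MonoidAlgebra.single_mul_single, mul_one]
    rcases h with h | ⟨c, h⟩ | h
    · have := congrArg numTerms h
      rw [map_add, numTerms_single, numTerms_single, map_zero] at this
      omega
    · rw [MonoidAlgebra.single_add_single_inj one_ne_zero one_ne_zero] at h
      rcases h with ⟨rfl, rfl⟩ | ⟨-, rfl, rfl⟩ | ⟨h, -⟩
      · rw [mul_left_comm, he, mul_one]
      · rw [mul_comm]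
      · omega
    · rw [map_add, numTerms_single, numTerms_single] at h
      omega

/-- Among three terms, a value different from the other two would occur exactly once. If they are
not all equal, such a value exists. -/
theorem eq_of_add_add_mem_noSimpleTerm {a b c : D}
    (h : MonoidAlgebra.single a 1 + MonoidAlgebra.single b 1 + MonoidAlgebra.single c 1 ∈
      noSimpleTerm D) : a = c := by
  classical
  have h1 := h a
  have h2 := h b
  have h3 := h c
  simp only [MonoidAlgebra.coeff_add, Finsupp.add_apply, MonoidAlgebra.coeff_single,
    Finsupp.single_apply] at h1 h2 h3
  grind

theorem eq_of_add_mem_noSimpleTerm {a c : D}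
    (h : MonoidAlgebra.single a 1 + MonoidAlgebra.single c 1 ∈ noSimpleTerm D) :
    a = c := by
  classical
  have h1 := h a
  simp only [MonoidAlgebra.coeff_add, Finsupp.add_apply, MonoidAlgebra.coeff_single,
    Finsupp.single_apply] at h1
  grind

theorem single_notMem_noSimpleTerm {a : D} : MonoidAlgebra.single a 1 ∉ noSimpleTerm D :=
  fun h => h a (by simp)

end NullIdeal

end OrderedBlueprint

/-! ### The homomorphism from the weak universal pasture to `ℕ[G_M]` -/

namespace Matroid

open OrderedBlueprint

section MonomialLift

variable {E : Type u} {M : Matroid E}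

variable {A : Type*} [CommGroup A] {e : A} {he : e ^ 2 = 1} {y : M.Bases → A}

variable (e he y) in
/-- The homomorphism on Laurent monomials given by the images of `ε` and of the variables. -/
def monomialLift : M.MonomialGroup →* A where
  toFun m := unitsHom e he m.1 * (Multiplicative.toAdd m.2).prod fun I n => y I ^ n
  map_one' := by simp
  map_mul' m n := by
    rw [Prod.fst_mul, Prod.snd_mul, map_mul, toAdd_mul,
      Finsupp.prod_add_index' (fun _ => zpow_zero _) (fun _ _ _ => zpow_add _ _ _),
      mul_mul_mul_comm]

/-- The Laurent monomial `x_I`. -/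
def monomialVar (I : M.Bases) : M.MonomialGroup := (1, Multiplicative.ofAdd (Finsupp.single I 1))

/-- The Laurent monomial `ε`. -/
def monomialEps (M : Matroid E) : M.MonomialGroup := (-1, 1)

theorem monomialLift_var (I : M.Bases) : monomialLift e he y (monomialVar I) = y I := by
  simp [monomialLift, monomialVar]

theorem monomialLift_eps : monomialLift e he y M.monomialEps = e := by
  simp [monomialLift, monomialEps, unitsHom_neg_one]

end MonomialLift

variable {E : Type u} [LinearOrder E] (M : Matroid E)

/-- The homomorphism from Laurent monomials to `G_M` with `ε ↦ ε` and `x_I ↦ X_I`. -/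
def monomialToTutte : M.MonomialGroup →* M.TutteG :=
  monomialLift M.tutteEps M.tutteEps_sq M.tutteXBasis

/-- The ordered blueprint over `G_M` whose null set is given by numbers of terms and degrees. -/
def tutteBlueprint : OrderedBlueprint.{u} := ofIdeal (nullIdeal M.tutteEps M.degG)

theorem union_pair (J : Finset E) (a b : E) : J ∪ {a, b} = insert a (insert b J) := by
  grind

open Classical in
/-- The image of `x_I` in `ℕ[G_M]`. -/
def tutteTerm (I : Finset E) : MonoidAlgebra ℕ M.TutteG :=
  if M.IsFinBase I then MonoidAlgebra.single (M.tutteFun I) 1 else 0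

theorem mapDomain_plVar (I : Finset E) :
    MonoidAlgebra.mapDomainRingHom ℕ M.monomialToTutte (M.plVar I) = M.tutteTerm I := by
  by_cases h : M.IsFinBase I
  · have h' : M.IsBase (I : Set E) := h
    rw [plVar, dif_pos h', tutteTerm, if_pos h, tutteFun, dif_pos h,
      MonoidAlgebra.mapDomainRingHom_apply, MonoidAlgebra.mapDomain_single]
    exact congrArg (fun g => MonoidAlgebra.single g 1) (monomialLift_var ⟨I, h⟩)
  · have h' : ¬ M.IsBase (I : Set E) := h
    rw [plVar, dif_neg h', tutteTerm, if_neg h, map_zero]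

theorem mapDomain_plEps :
    MonoidAlgebra.mapDomainRingHom ℕ M.monomialToTutte M.plEps =
      MonoidAlgebra.single M.tutteEps 1 := by
  rw [plEps, MonoidAlgebra.mapDomainRingHom_apply, MonoidAlgebra.mapDomain_single]
  exact congrArg (fun g => MonoidAlgebra.single g 1) monomialLift_eps

variable {M}

theorem tutteTerm_mul (I K : Finset E) [Decidable (M.IsFinBase I ∧ M.IsFinBase K)] :
    M.tutteTerm I * M.tutteTerm K = if M.IsFinBase I ∧ M.IsFinBase K then
      MonoidAlgebra.single (M.tutteFun I * M.tutteFun K) 1 else 0 := by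
  rw [tutteTerm, tutteTerm]
  split_ifs <;> first | (exfalso; tauto) | simp [MonoidAlgebra.single_mul_single]

theorem degG_tutteFun {I : Finset E} (hI : M.IsFinBase I) :
    M.degG (M.tutteFun I) = Multiplicative.ofAdd (Set.indicator (I : Set E) 1) := by
  rw [tutteFun, dif_pos hI]
  exact M.degG_tutteXBasis ⟨I, hI⟩

theorem degG_tutteFun_mul {J : Finset E} {a b c d : E} (hab : a ≠ b) (hcd : c ≠ d) (ha : a ∉ J)
    (hb : b ∉ J) (hc : c ∉ J) (hd : d ∉ J) (h : M.IsFinBase (insert a (insert b J)))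
    (h' : M.IsFinBase (insert c (insert d J))) :
    M.degG (M.tutteFun (insert a (insert b J)) * M.tutteFun (insert c (insert d J))) =
      Multiplicative.ofAdd (Set.indicator (J : Set E) 1 + Set.indicator (J : Set E) 1 +
        Pi.single a 1 + Pi.single b 1 + Pi.single c 1 + Pi.single d 1) := by
  have key : ∀ {p q}, p ≠ q → p ∉ J → q ∉ J →
      Set.indicator ((insert p (insert q J) : Finset E) : Set E) (1 : E → ℤ) =
        Set.indicator (J : Set E) 1 + Pi.single p 1 + Pi.single q 1 := by
    intro p q hpq hp hq
    ext x
    by_cases h1 : x = p <;> by_cases h2 : x = q <;> by_cases h3 : x ∈ J <;>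
      simp_all [Set.indicator]
  rw [map_mul, degG_tutteFun h, degG_tutteFun h', ← ofAdd_add, key hab ha hb, key hcd hc hd]
  congr 1
  abel

theorem single_mem_noSimpleTerm {D : Type*} [CommGroup D] {d : D} {n : ℕ} (hn : n ≠ 1) :
    MonoidAlgebra.single d n ∈ noSimpleTerm D := by
  classical
  intro d'
  rw [MonoidAlgebra.coeff_single, Finsupp.single_apply]
  split_ifs <;> omega

theorem pair_mem_nullIdeal (g : M.TutteG) :
    MonoidAlgebra.single g 1 + MonoidAlgebra.single (g * M.tutteEps) 1 ∈
      nullIdeal M.tutteEps M.degG := by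
  refine ⟨.inr (.inl ⟨g, rfl⟩), ?_⟩
  rw [SetLike.mem_coe, Ideal.mem_comap, map_add, MonoidAlgebra.mapDomainRingHom_apply,
    MonoidAlgebra.mapDomainRingHom_apply, MonoidAlgebra.mapDomain_single,
    MonoidAlgebra.mapDomain_single, map_mul, degG_tutteEps, mul_one, ← MonoidAlgebra.single_add]
  exact single_mem_noSimpleTerm (by decide)

theorem triple_mem_nullIdeal {g₁ g₂ g₃ : M.TutteG} (h₁ : M.degG g₁ = M.degG g₃)
    (h₂ : M.degG g₂ = M.degG g₃) :
    MonoidAlgebra.single g₁ 1 + MonoidAlgebra.single g₂ 1 + MonoidAlgebra.single g₃ 1 ∈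
      nullIdeal M.tutteEps M.degG := by
  refine ⟨.inr (.inr ?_), ?_⟩
  · rw [map_add, map_add, numTerms_single, numTerms_single, numTerms_single]
  · rw [SetLike.mem_coe, Ideal.mem_comap, map_add, map_add, MonoidAlgebra.mapDomainRingHom_apply,
      MonoidAlgebra.mapDomainRingHom_apply, MonoidAlgebra.mapDomainRingHom_apply,
      MonoidAlgebra.mapDomain_single, MonoidAlgebra.mapDomain_single,
      MonoidAlgebra.mapDomain_single, h₁, h₂, ← MonoidAlgebra.single_add,
      ← MonoidAlgebra.single_add]
    exact single_mem_noSimpleTerm (by decide)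

/-- Case distinction by which of the three products are nonzero. Three terms have a common degree;
two terms form a pair `g + ε g` by the exchange relations of `G_M`; a single term contradicts
`IsFinBase.exchange_pair`. -/
theorem pluecker_mem_nullIdeal {J : Finset E} {a b c d : E} (hJ : J.card + 2 = M.rk) (hab : a < b)
    (hbc : b < c) (hcd : c < d) (ha : a ∉ J) (hb : b ∉ J) (hc : c ∉ J) (hd : d ∉ J) :
    M.tutteTerm (insert a (insert b J)) * M.tutteTerm (insert c (insert d J)) +
      MonoidAlgebra.single M.tutteEps 1 *
        (M.tutteTerm (insert a (insert c J)) * M.tutteTerm (insert b (insert d J))) +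
      M.tutteTerm (insert a (insert d J)) * M.tutteTerm (insert b (insert c J)) ∈
        nullIdeal M.tutteEps M.degG := by
  classical
  have hac := hab.trans hbc
  have hbd := hbc.trans hcd
  have had := hac.trans hcd
  have hpl := M.isExchange_tutteFun.isPluecker
  have e12 := hpl.eq₁₂ J a b c d hJ hab hbc hcd ha hb hc hd
  have e13 := hpl.eq₁₃ J a b c d hJ hab hbc hcd ha hb hc hd
  have e14 := hpl.eq₁₄ J a b c d hJ hab hbc hcd ha hb hc hd
  have x12 := fun h h' => IsFinBase.exchange_pair (M := M) (J := J) (a := a) (b := b) (c := c)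
    (d := d) h h' hab.ne hac.ne had.ne hbc.ne hbd.ne hcd.ne ha hb hc hd
  have x13 := fun h h' => IsFinBase.exchange_pair (M := M) (J := J) (a := a) (b := c) (c := b)
    (d := d) h h' hac.ne hab.ne had.ne hbc.ne' hcd.ne hbd.ne ha hc hb hd
  have x14 := fun h h' => IsFinBase.exchange_pair (M := M) (J := J) (a := a) (b := d) (c := b)
    (d := c) h h' had.ne hab.ne hac.ne hbd.ne' hcd.ne' hbc.ne ha hd hb hc
  rw [Finset.insert_comm c b] at x13
  rw [Finset.insert_comm d c, Finset.insert_comm d b] at x14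
  have d12 := fun h h' => degG_tutteFun_mul (M := M) (J := J) hab.ne hcd.ne ha hb hc hd h h'
  have d13 := fun h h' => degG_tutteFun_mul (M := M) (J := J) hac.ne hbd.ne ha hc hb hd h h'
  have d14 := fun h h' => degG_tutteFun_mul (M := M) (J := J) had.ne hbc.ne ha hd hb hc h h'
  rw [add_right_comm _ (Pi.single c 1) (Pi.single b 1)] at d13
  rw [add_right_comm _ (Pi.single d 1) (Pi.single b 1),
    add_right_comm _ (Pi.single d 1) (Pi.single c 1)] at d14
  -- All three products have the same degree: twice the indicator of `J` plus the four unit vectors.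
  generalize (Multiplicative.ofAdd _ : Multiplicative (E → ℤ)) = δ at d12 d13 d14
  rw [tutteTerm_mul, tutteTerm_mul, tutteTerm_mul]
  by_cases h12 : M.IsFinBase (insert a (insert b J)) ∧ M.IsFinBase (insert c (insert d J)) <;>
  by_cases h13 : M.IsFinBase (insert a (insert c J)) ∧ M.IsFinBase (insert b (insert d J)) <;>
  by_cases h14 : M.IsFinBase (insert a (insert d J)) ∧ M.IsFinBase (insert b (insert c J)) <;>
  simp only [h12, h13, h14, if_true, if_false, and_self, mul_zero, add_zero, zero_add,
    MonoidAlgebra.single_mul_single, mul_one]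
  · refine triple_mem_nullIdeal ?_ ?_
    · rw [d12 h12.1 h12.2, d14 h14.1 h14.2]
    · rw [map_mul M.degG M.tutteEps, degG_tutteEps, one_mul, d13 h13.1 h13.2, d14 h14.1 h14.2]
  · rw [e14 h14 h12.1 h12.2 h13.1 h13.2, mul_comm M.tutteEps]
    exact pair_mem_nullIdeal _
  · rw [e13 h13 h12.1 h12.2 h14.1 h14.2, mul_comm M.tutteEps, add_comm]
    exact pair_mem_nullIdeal _
  · exact ((x12 h12.1 h12.2).elim h13 h14).elim
  · rw [e12 h12 h13.1 h13.2 h14.1 h14.2, mul_comm M.tutteEps, add_comm]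
    exact pair_mem_nullIdeal _
  · exact ((x13 h13.1 h13.2).elim h12 h14).elim
  · exact ((x14 h14.1 h14.2).elim h12 h13).elim
  · exact Ideal.zero_mem _

variable (M)

/-- The homomorphism from the graded blueprint of `M` to `ℕ[G_M]`. -/
def plueckerHom : M.plueckerBlueprint.Amb →+* M.tutteBlueprint.Amb :=
  quotLift (B := ofGroup M.MonomialGroup) (T := M.tutteBlueprint)
    (MonoidAlgebra.mapDomainRingHom ℕ M.monomialToTutte)
    (fun x y h => by rw [show x = y from h])
    (by
      rintro _ (rfl | ⟨J, a, b, c, d, hJ, hab, hbc, hcd, ha, hb, hc, hd, rfl⟩)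
      · refine (ofIdeal_zero_le (N := nullIdeal M.tutteEps M.degG)).mpr ?_
        have := pair_mem_nullIdeal (M := M) 1
        rw [one_mul] at this
        change MonoidAlgebra.mapDomainRingHom ℕ M.monomialToTutte (1 + M.plEps) ∈ _
        rw [map_add, map_one, mapDomain_plEps]
        exact this
      · refine (ofIdeal_zero_le (N := nullIdeal M.tutteEps M.degG)).mpr ?_
        change MonoidAlgebra.mapDomainRingHom ℕ M.monomialToTutte _ ∈ _
        simp only [union_pair]
        simp only [map_add, map_mul, mapDomain_plEps, mapDomain_plVar]
        exact pluecker_mem_nullIdeal hJ hab hbc hcd ha hb hc hd)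

theorem plueckerHom_mono (x y : M.plueckerBlueprint.Amb) (h : x ≤ y) :
    M.plueckerHom x ≤ M.plueckerHom y :=
  quotLift_mono _ _ _ x y h

theorem plueckerHom_monomial (m : M.MonomialGroup) :
    M.plueckerHom (M.monomialToPluecker m) =
      (MonoidAlgebra.single (M.monomialToTutte m) 1 : MonoidAlgebra ℕ M.TutteG) :=
  MonoidAlgebra.mapDomain_single

/-- The homomorphism from the residue field to `ℕ[G_M]`. -/
def residueHom : M.weakResidueField.Amb →+* M.tutteBlueprint.Amb :=
  M.plueckerHom.comp
    (Subsemiring.closure (M.degreeZeroPoints : Set M.plueckerBlueprint.Amb)).subtype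

theorem residueHom_mono (x y : M.weakResidueField.Amb) (h : x ≤ y) :
    M.residueHom x ≤ M.residueHom y :=
  M.plueckerHom_mono _ _ h

/-- The homomorphism from `{1, -1}` to `ℕ[G_M]` that sends `-1` to `ε`. -/
def signHom : ℤˣ →* M.tutteBlueprint.Amb :=
  (MonoidAlgebra.of ℕ M.TutteG).comp (unitsHom M.tutteEps M.tutteEps_sq)

theorem zero_le_one_add_signHom : 0 ≤ 1 + M.signHom (-1) := by
  refine (ofIdeal_zero_le (N := nullIdeal M.tutteEps M.degG)).mpr ?_
  have := pair_mem_nullIdeal (M := M) 1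
  rw [one_mul] at this
  change 1 + MonoidAlgebra.single (unitsHom M.tutteEps M.tutteEps_sq (-1)) 1 ∈ _
  rw [unitsHom_neg_one]
  exact this

/-- The homomorphism from the tensor product of the residue field with `𝔽₁^±` to `ℕ[G_M]`. -/
def residueTensorHom : M.weakResidueField.tensorF1pm.Amb →+* M.tutteBlueprint.Amb :=
  tensorLift M.residueHom M.residueHom_mono M.signHom M.zero_le_one_add_signHom

theorem residueHom_mem {x : M.weakResidueField.Amb} (hx : x ∈ M.weakResidueField.points) :
    M.residueHom x ∈ groupPoints M.TutteG := by
  obtain h | ⟨m, -, h⟩ := hx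
  · refine .inl ?_
    change M.plueckerHom x.1 = 0
    rw [show x.1 = 0 from h, map_zero]
  · refine .inr ⟨M.monomialToTutte m, ?_⟩
    change M.plueckerHom x.1 = _
    rw [show x.1 = _ from h]
    exact M.plueckerHom_monomial m

theorem residueTensorHom_mem {x : M.weakResidueField.tensorF1pm.Amb}
    (hx : x ∈ M.weakResidueField.tensorF1pm.points) :
    M.residueTensorHom x ∈ groupPoints M.TutteG := by
  obtain ⟨_, ⟨a, ha, s, rfl⟩, rfl⟩ := hx
  have h1 := tensorLift_single M.residueHom M.residueHom_mono M.signHom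
    M.zero_le_one_add_signHom s a
  refine (congrArg (· ∈ groupPoints M.TutteG) h1).mpr ?_
  exact (groupPoints M.TutteG).mul_mem (M.residueHom_mem ha) (single_mem_groupPoints _)

/-- The homomorphism from the weak universal pasture to `ℕ[G_M]`. -/
def pastureHom : M.weakUniversalPasture.Amb →+* M.tutteBlueprint.Amb :=
  quotLift M.residueTensorHom (tensorLift_mono _ _ _ _) (by
    rintro ⟨a, a'⟩ ⟨ha, ha', b, hb, h, h'⟩
    -- The weak inverse of the image of `b` is unique, namely its product with `ε`. So `a` and `a'`
    -- have the same image and the map descends to the pasteurization.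
    have key : ∀ {a}, a ∈ M.weakResidueField.tensorF1pm.points → 0 ≤ a + b →
        M.residueTensorHom a = (MonoidAlgebra.single M.tutteEps 1 : MonoidAlgebra ℕ M.TutteG) *
          (show MonoidAlgebra ℕ M.TutteG from M.residueTensorHom b) := by
      intro a ha h
      have h1 := tensorLift_mono M.residueHom M.residueHom_mono M.signHom
        M.zero_le_one_add_signHom _ _ h
      rw [map_zero, map_add] at h1
      have h2 := (ofIdeal_zero_le (N := nullIdeal M.tutteEps M.degG)).mp h1
      exact eq_of_add_mem_twoTermIdeal (by rw [← pow_two, tutteEps_sq]) (M.residueTensorHom_mem ha)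
        (M.residueTensorHom_mem hb) h2.1
    exact le_of_eq ((key ha h).trans (key ha' h').symm))

theorem pastureHom_mono (x y : M.weakUniversalPasture.Amb) (h : x ≤ y) :
    M.pastureHom x ≤ M.pastureHom y :=
  quotLift_mono _ _ _ x y h

theorem pastureHom_monomialClass (m : M.degreeZero) :
    M.pastureHom (M.monomialClass m).1.1 =
      (MonoidAlgebra.single (M.monomialToTutte m) 1 : MonoidAlgebra ℕ M.TutteG) :=
  (tensorLift_tensorHom M.residueHom M.residueHom_mono M.signHom
    M.zero_le_one_add_signHom _).trans (M.plueckerHom_monomial m)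

end Matroid

/-! ### Monomials of degree zero and the units of the weak universal pasture -/

namespace Matroid

open OrderedBlueprint

section Monomials

variable {E : Type u} {M : Matroid E}

theorem monomialGroup_hom_ext {A : Type*} [Group A] {f g : M.MonomialGroup →* A}
    (he : f M.monomialEps = g M.monomialEps) (hv : ∀ I, f (monomialVar I) = g (monomialVar I)) :
    f = g := by
  ext ⟨s, m⟩
  have h1 : ((s, m) : M.MonomialGroup) = (s, 1) * (1, m) := by simp
  rw [h1, map_mul, map_mul]
  clear h1
  congr 1
  · rcases Int.units_eq_one_or s with rfl | rfl
    · exact (map_one f).trans (map_one g).symm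
    · exact he
  · induction m using Multiplicative.rec with
    | _ m =>
    induction m using Finsupp.induction_linear with
    | zero => exact (map_one f).trans (map_one g).symm
    | add a b ha hb =>
      have h2 : ((1, Multiplicative.ofAdd (a + b)) : M.MonomialGroup) =
          (1, Multiplicative.ofAdd a) * (1, Multiplicative.ofAdd b) := by simp
      rw [h2, map_mul, map_mul, ha, hb]
    | single I n =>
      have h2 : ((1, Multiplicative.ofAdd (Finsupp.single I n)) : M.MonomialGroup) =
          monomialVar I ^ n := by
        simp [monomialVar, Prod.pow_mk, ← ofAdd_zsmul]
      rw [h2, map_zpow, map_zpow, hv]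

theorem exists_bases [Fintype E] (M : Matroid E) : Nonempty M.Bases := by
  classical
  obtain ⟨B, hB⟩ := M.exists_isBase
  exact ⟨B.toFinset, by simpa using hB⟩

variable (M) in
/-- The total degree of Laurent monomials. -/
def totalDegree : M.MonomialGroup →* Multiplicative ℤ where
  toFun m := Multiplicative.ofAdd ((Multiplicative.toAdd m.2).sum fun _ n => n)
  map_one' := by simp
  map_mul' m n := by
    rw [Prod.snd_mul, toAdd_mul, Finsupp.sum_add_index' (fun _ => rfl) (fun _ _ _ => rfl),
      ofAdd_add]

theorem mem_degreeZero_iff {E : Type u} [LinearOrder E] {M : Matroid E} {m : M.MonomialGroup} :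
    m ∈ M.degreeZero ↔ M.totalDegree m = 1 := Iff.rfl

theorem totalDegree_var (I : M.Bases) : M.totalDegree (monomialVar I) = Multiplicative.ofAdd 1 :=
  congrArg Multiplicative.ofAdd (Finsupp.sum_single_index rfl)

variable (M) in
theorem totalDegree_eps : M.totalDegree M.monomialEps = 1 :=
  congrArg Multiplicative.ofAdd Finsupp.sum_zero_index

end Monomials

variable {E : Type u} [LinearOrder E] {M : Matroid E}

/-- Normalization of a Laurent monomial to degree `0` by a power of the variable of a basis. -/
def normalize (I₀ : M.Bases) : M.MonomialGroup →* M.degreeZero :=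
  (MonoidHom.id _ * (zpowersHom _ (monomialVar I₀)⁻¹).comp M.totalDegree).codRestrict _ fun m => by
    rw [mem_degreeZero_iff, MonoidHom.mul_apply, map_mul, MonoidHom.comp_apply,
      zpowersHom_apply, map_zpow, map_inv, totalDegree_var, MonoidHom.id_apply,
      ← ofAdd_neg, ← ofAdd_zsmul]
    simp

theorem coe_normalize (I₀ : M.Bases) (m : M.MonomialGroup) :
    (normalize I₀ m : M.MonomialGroup) =
      m * (monomialVar I₀)⁻¹ ^ (Multiplicative.toAdd (M.totalDegree m)) := rfl

theorem normalize_of_mem (I₀ : M.Bases) (m : M.degreeZero) : normalize I₀ m = m := by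
  apply Subtype.ext
  rw [coe_normalize, mem_degreeZero_iff.mp m.2, toAdd_one, zpow_zero, mul_one]

theorem monomialToTutte_normalize_mem (I₀ : M.Bases) (m : M.MonomialGroup) :
    M.monomialToTutte (normalize I₀ m) ∈ M.tutteGroup := by
  rw [← QuotientGroup.eq_one_iff]
  -- Membership in `𝕋_M` becomes triviality of a homomorphism to the quotient, which can be checked
  -- on `ε` and on the variables.
  let F : M.MonomialGroup →* M.TutteG ⧸ M.tutteGroup := (QuotientGroup.mk' M.tutteGroup).comp
    (M.monomialToTutte.comp (M.degreeZero.subtype.comp (normalize I₀)))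
  have : F = 1 := by
    refine monomialGroup_hom_ext (f := F) (g := 1) ?_ fun I => ?_
    · refine (QuotientGroup.eq_one_iff _).mpr (Subgroup.subset_closure (.inl ?_))
      change M.monomialToTutte (normalize I₀ M.monomialEps) = _
      rw [coe_normalize, totalDegree_eps, toAdd_one, zpow_zero, mul_one]
      exact monomialLift_eps
    · refine (QuotientGroup.eq_one_iff _).mpr (Subgroup.subset_closure (.inr ?_))
      have hX : ∀ I : M.Bases, ∃ i hi, M.tutteXBasis I = M.tutteX i hi := fun I => ⟨_, _, rfl⟩
      obtain ⟨i, hi, h1⟩ := hX I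
      obtain ⟨j, hj, h2⟩ := hX I₀
      refine ⟨i, hi, j, hj, ?_⟩
      change M.monomialToTutte (normalize I₀ (monomialVar I)) = _
      rw [coe_normalize, totalDegree_var, toAdd_ofAdd, zpow_one, map_mul, map_inv, ← h1, ← h2]
      exact congrArg₂ (fun a b => a * b⁻¹) (monomialLift_var I) (monomialLift_var I₀)
  exact DFunLike.congr_fun this m

theorem monomialToTutte_mem (I₀ : M.Bases) (m : M.degreeZero) :
    M.monomialToTutte m ∈ M.tutteGroup := by
  have := monomialToTutte_normalize_mem I₀ m
  rwa [normalize_of_mem] at this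

theorem exists_monomialToTutte_eq (i : Fin M.rk → E) (hi : M.IsBase (Set.range i)) :
    ∃ m, M.totalDegree m = Multiplicative.ofAdd 1 ∧ M.monomialToTutte m = M.tutteX i hi := by
  have hi' := isBase_range_iff.mp hi
  refine ⟨(tupleSign i, Multiplicative.ofAdd (Finsupp.single ⟨_, hi'⟩ 1)), ?_, ?_⟩
  · exact congrArg Multiplicative.ofAdd (Finsupp.sum_single_index rfl)
  · rw [tutteX_eq, tutteFun, dif_pos hi']
    simp [monomialToTutte, monomialLift]

theorem tutteGroup_le : M.tutteGroup ≤ M.degreeZero.map M.monomialToTutte := by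
  refine (Subgroup.closure_le _).mpr ?_
  rintro _ (rfl | ⟨i, hi, j, hj, rfl⟩)
  · exact ⟨M.monomialEps, M.totalDegree_eps, monomialLift_eps⟩
  · obtain ⟨m, hm, hm'⟩ := exists_monomialToTutte_eq i hi
    obtain ⟨n, hn, hn'⟩ := exists_monomialToTutte_eq j hj
    refine ⟨m * n⁻¹, ?_, by rw [map_mul, map_inv, hm', hn']⟩
    rw [SetLike.mem_coe, mem_degreeZero_iff, map_mul, map_inv, hm, hn, mul_inv_cancel]

variable (M)

/-- A Laurent monomial of degree `0` as an element of the residue field. -/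
def residueMonomial : M.degreeZero →* M.weakResidueField.points :=
  (M.plueckerBlueprint.toSubPoints M.degreeZeroPoints (Or.inl rfl)).comp
      { toFun := fun m => ⟨(M.monomialToPluecker m.1).1, Or.inr ⟨m.1, m.2, rfl⟩⟩
        map_one' := Subtype.ext (by
          change (M.monomialToPluecker 1).1 = _
          rw [map_one]; rfl)
        map_mul' := fun m n => Subtype.ext (by
          change (M.monomialToPluecker (m.1 * n.1)).1 = _
          rw [map_mul]; rfl) }

theorem residue_le {x y : M.weakResidueField.Amb}
    (h : (show Subsemiring.closure (M.degreeZeroPoints : Set M.plueckerBlueprint.Amb) from x).1 ≤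
      (show Subsemiring.closure (M.degreeZeroPoints : Set M.plueckerBlueprint.Amb) from y).1) :
    x ≤ y := h

theorem coe_monomialClass (m : M.degreeZero) :
    (M.monomialClass m : M.weakUniversalPasture.points) =
      M.weakResidueField.toPasteurization (M.residueMonomial m) := rfl

/-- The Laurent monomial `ε` as an element of degree `0`. -/
def degreeZeroEps : M.degreeZero := ⟨M.monomialEps, M.totalDegree_eps⟩

theorem zero_le_one_add_eps :
    0 ≤ (1 : M.plueckerBlueprint.Amb) + (M.monomialToPluecker M.monomialEps).1 :=
  GenLE.of_mem (.inl rfl)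

theorem zero_le_residue_eps_add :
    0 ≤ (M.residueMonomial M.degreeZeroEps : M.weakResidueField.Amb) + 1 := by
  have := M.zero_le_one_add_eps
  rw [add_comm] at this
  exact M.residue_le this

/-- The residue field already contains `ε`, so every point of `k_M^w` is the class of `0` or of a
monomial. The class of `0` is not a unit, because `k_M^w` maps to the nontrivial semiring `ℕ[G_M]`.
-/
theorem monomialClass_surjective : Function.Surjective M.monomialClass := by
  intro u
  obtain ⟨a, ha⟩ := M.weakResidueField.exists_toPasteurization_eq
    (M.residueMonomial M.degreeZeroEps).2 M.zero_le_residue_eps_add u.1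
  obtain h | ⟨m, hm, h⟩ := a.2
  · exfalso
    have h1 : (a : M.weakResidueField.Amb) = 0 := Subtype.ext h
    have h2 : (u.1 : M.weakUniversalPasture.Amb) = 0 := by
      rw [← ha, coe_toPasteurization, h1]
      exact map_zero M.weakResidueField.pasteurizationHom
    have h3 : (u.1 : M.weakUniversalPasture.Amb) * u⁻¹.1 = 1 := congrArg Subtype.val u.mul_inv
    rw [h2, zero_mul] at h3
    have h4 := congrArg M.pastureHom h3
    rw [map_zero, map_one] at h4
    exact zero_ne_one (α := MonoidAlgebra ℕ M.TutteG) h4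
  · refine ⟨⟨m, hm⟩, Units.ext ?_⟩
    rw [coe_monomialClass, ← ha]
    congr 1
    exact Subtype.ext (Subtype.ext h.symm)

/-- This gives injectivity: distinct elements of `G_M` stay distinct in `ℕ[G_M]`, and `pastureHom`
detects them. -/
theorem eq_one_of_monomialClass_eq_one {m : M.degreeZero} (h : M.monomialClass m = 1) :
    M.monomialToTutte m = 1 := by
  have h1 := M.pastureHom_monomialClass m
  rw [h] at h1
  have h2 : (MonoidAlgebra.single 1 1 : MonoidAlgebra ℕ M.TutteG) =
      MonoidAlgebra.single (M.monomialToTutte m) 1 := (map_one M.pastureHom).symm.trans h1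
  exact ((MonoidAlgebra.single_left_inj one_ne_zero).mp h2).symm

end Matroid

/-! ### The isomorphism between the units of the pasture and the Tutte group -/

namespace Matroid

open OrderedBlueprint

section BasisMonomial

variable {E : Type u} (M : Matroid E)

open Classical in
/-- The Laurent monomial `x_I`, with value `1` if `I` is not a basis. -/
def basisMonomial (I : Finset E) : M.MonomialGroup :=
  if h : M.IsFinBase I then monomialVar ⟨I, h⟩ else 1

variable {M} in
theorem totalDegree_basisMonomial {I : Finset E} (h : M.IsFinBase I) :
    M.totalDegree (M.basisMonomial I) = Multiplicative.ofAdd 1 := by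
  rw [basisMonomial, dif_pos h, totalDegree_var]

variable {M} in
theorem totalDegree_basisMonomial_mul {I K : Finset E} (h : M.IsFinBase I) (h' : M.IsFinBase K) :
    M.totalDegree (M.basisMonomial I * M.basisMonomial K) = Multiplicative.ofAdd 2 := by
  rw [map_mul, totalDegree_basisMonomial h, totalDegree_basisMonomial h']
  rfl

theorem monomialEps_sq : M.monomialEps ^ 2 = 1 := rfl

end BasisMonomial

variable {E : Type u} [LinearOrder E] (M : Matroid E)

/-- The variable `x_I` of the graded blueprint of `M`; it is `0` if `I` is not a basis. -/
def plueckerVar (I : Finset E) : M.plueckerBlueprint.Amb := toQuot _ _ (M.plVar I)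

variable {M} in
theorem plueckerVar_mul {I K : Finset E} (h : M.IsFinBase I) (h' : M.IsFinBase K) :
    M.plueckerVar I * M.plueckerVar K =
      (M.monomialToPluecker (M.basisMonomial I * M.basisMonomial K)).1 := by
  have key : ∀ {I : Finset E}, M.IsFinBase I →
      M.plueckerVar I = (M.monomialToPluecker (M.basisMonomial I)).1 := by
    intro I h
    have h1 : M.IsBase (I : Set E) := h
    rw [plueckerVar, plVar, dif_pos h1, basisMonomial, dif_pos h]
    rfl
  rw [key h, key h', map_mul]
  rfl

variable {M} in
theorem plueckerVar_mul_eq_zero {I K : Finset E} (h : ¬ (M.IsFinBase I ∧ M.IsFinBase K)) :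
    M.plueckerVar I * M.plueckerVar K = 0 := by
  have key : ∀ {I : Finset E}, ¬ M.IsFinBase I → M.plueckerVar I = 0 := by
    intro I h
    have h1 : ¬ M.IsBase (I : Set E) := h
    rw [plueckerVar, plVar, dif_neg h1]
    exact map_zero (toQuot _ _)
  rcases not_and_or.mp h with h | h
  · rw [key h, zero_mul]
  · rw [key h, mul_zero]

variable {M} in
theorem zero_le_pluecker {J : Finset E} {a b c d : E} (hJ : J.card + 2 = M.rk) (hab : a < b)
    (hbc : b < c) (hcd : c < d) (ha : a ∉ J) (hb : b ∉ J) (hc : c ∉ J) (hd : d ∉ J) :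
    0 ≤ M.plueckerVar (insert a (insert b J)) * M.plueckerVar (insert c (insert d J)) +
      (M.monomialToPluecker M.monomialEps).1 *
        (M.plueckerVar (insert a (insert c J)) * M.plueckerVar (insert b (insert d J))) +
      M.plueckerVar (insert a (insert d J)) * M.plueckerVar (insert b (insert c J)) := by
  simp only [← union_pair]
  exact GenLE.of_mem (.inr ⟨J, a, b, c, d, hJ, hab, hbc, hcd, ha, hb, hc, hd, rfl⟩)

theorem zero_le_mul_monomial {x : M.plueckerBlueprint.Amb} (h : 0 ≤ x) (m : M.MonomialGroup) :
    0 ≤ x * (M.monomialToPluecker m).1 := by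
  have := M.plueckerBlueprint.mul_le h (le_refl (M.monomialToPluecker m).1)
  rwa [zero_mul] at this

theorem monomial_mul (m n : M.MonomialGroup) : (M.monomialToPluecker m).1 *
    (M.monomialToPluecker n).1 = (M.monomialToPluecker (m * n)).1 := by
  rw [map_mul]
  rfl

theorem monomial_one : (M.monomialToPluecker 1).1 = 1 := by
  rw [map_one]
  rfl

variable {M}

/-- The class in `(k_M^w)^×` of a Laurent monomial, normalized to degree `0`. -/
def normalizedClass (I₀ : M.Bases) : M.MonomialGroup →* M.weakUniversalPasture.UnitGroup :=
  M.monomialClass.comp (normalize I₀)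

theorem normalizedClass_coe (I₀ : M.Bases) (m : M.degreeZero) :
    normalizedClass I₀ m = M.monomialClass m :=
  congrArg M.monomialClass (normalize_of_mem I₀ m)

theorem normalizedClass_eps_sq (I₀ : M.Bases) : normalizedClass I₀ M.monomialEps ^ 2 = 1 := by
  rw [← map_pow, monomialEps_sq, map_one]

theorem div_mem_degreeZero {m n : M.MonomialGroup} (hd : M.totalDegree m = M.totalDegree n) :
    m * n⁻¹ ∈ M.degreeZero := by
  rw [mem_degreeZero_iff, map_mul, map_inv, hd, mul_inv_cancel]

/-- After division by `n`, both `m / n` and `ε` are weak inverses of `1`, and the pasteurization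
identifies them. -/
theorem normalizedClass_eq_of_zero_le (I₀ : M.Bases) {m n : M.MonomialGroup}
    (hd : M.totalDegree m = M.totalDegree n)
    (h : 0 ≤ (M.monomialToPluecker m).1 + (M.monomialToPluecker n).1) :
    normalizedClass I₀ m = normalizedClass I₀ M.monomialEps * normalizedClass I₀ n := by
  have h1 := M.zero_le_mul_monomial h n⁻¹
  rw [add_mul, monomial_mul, monomial_mul, mul_inv_cancel, monomial_one] at h1
  have h2 : 0 ≤ (M.residueMonomial ⟨m * n⁻¹, div_mem_degreeZero hd⟩ : M.weakResidueField.Amb) + 1 :=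
    M.residue_le h1
  have h3 := M.weakResidueField.toPasteurization_eq (b := 1) h2 M.zero_le_residue_eps_add
  have h4 : M.monomialClass ⟨m * n⁻¹, div_mem_degreeZero hd⟩ = M.monomialClass M.degreeZeroEps :=
    Units.ext h3
  rw [← normalizedClass_coe I₀, ← normalizedClass_coe I₀, map_mul, map_inv] at h4
  rw [← mul_inv_eq_iff_eq_mul]
  exact h4

/-- When one product of a Plücker relation vanishes, the other two are weak inverses of each other.
The factor `ε` cancels in `eq₁₂`, remains in `eq₁₃` and appears squared in `eq₁₄`. -/
theorem isPluecker_normalizedClass (I₀ : M.Bases) :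
    IsPluecker M (fun I => normalizedClass I₀ (M.basisMonomial I))
      (normalizedClass I₀ M.monomialEps) where
  eq₁₂ J a b c d hJ h₁ h₂ h₃ ha hb hc hd h0 h4 h5 h6 h7 := by
    have h := zero_le_pluecker hJ h₁ h₂ h₃ ha hb hc hd
    rw [plueckerVar_mul_eq_zero h0, zero_add, plueckerVar_mul h4 h5, plueckerVar_mul h6 h7,
      monomial_mul] at h
    have := normalizedClass_eq_of_zero_le I₀ (by
      rw [map_mul, totalDegree_eps, one_mul, totalDegree_basisMonomial_mul h4 h5,
        totalDegree_basisMonomial_mul h6 h7]) h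
    rw [map_mul] at this
    simpa only [map_mul] using mul_left_cancel this
  eq₁₃ J a b c d hJ h₁ h₂ h₃ ha hb hc hd h0 h4 h5 h6 h7 := by
    have h := zero_le_pluecker hJ h₁ h₂ h₃ ha hb hc hd
    rw [plueckerVar_mul_eq_zero h0, mul_zero, add_zero, plueckerVar_mul h4 h5,
      plueckerVar_mul h6 h7] at h
    have := normalizedClass_eq_of_zero_le I₀ (by
      rw [totalDegree_basisMonomial_mul h4 h5, totalDegree_basisMonomial_mul h6 h7]) h
    simpa only [map_mul] using this
  eq₁₄ J a b c d hJ h₁ h₂ h₃ ha hb hc hd h0 h4 h5 h6 h7 := by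
    have h := zero_le_pluecker hJ h₁ h₂ h₃ ha hb hc hd
    rw [plueckerVar_mul_eq_zero h0, add_zero, plueckerVar_mul h4 h5, plueckerVar_mul h6 h7,
      monomial_mul] at h
    have := normalizedClass_eq_of_zero_le I₀ (by
      rw [map_mul M.totalDegree M.monomialEps, totalDegree_eps, one_mul,
        totalDegree_basisMonomial_mul h4 h5, totalDegree_basisMonomial_mul h6 h7]) h
    rw [map_mul _ M.monomialEps, ← mul_assoc, ← pow_two, normalizedClass_eps_sq, one_mul] at this
    simpa only [map_mul] using this

/-- The homomorphism `G_M → (k_M^w)^×` with `ε ↦ ε` and `X_I ↦ x_I / x_{I₀}`. -/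
def tutteToPasture (I₀ : M.Bases) : M.TutteG →* M.weakUniversalPasture.UnitGroup :=
  ((isPluecker_normalizedClass I₀).isExchange (he := normalizedClass_eps_sq I₀)).lift

theorem tutteToPasture_tutteEps (I₀ : M.Bases) :
    tutteToPasture I₀ M.tutteEps = normalizedClass I₀ M.monomialEps :=
  IsExchange.lift_eps _

theorem tutteToPasture_tutteXBasis (I₀ I : M.Bases) :
    tutteToPasture I₀ (M.tutteXBasis I) = normalizedClass I₀ (monomialVar I) := by
  refine (IsExchange.lift_basis _ I).trans ?_
  have h : M.IsFinBase I.1 := I.2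
  rw [basisMonomial, dif_pos h]

theorem monomialToTutte_eps : M.monomialToTutte M.monomialEps = M.tutteEps := monomialLift_eps

theorem monomialToTutte_var (I : M.Bases) :
    M.monomialToTutte (monomialVar I) = M.tutteXBasis I := monomialLift_var I

theorem tutteToPasture_comp (I₀ : M.Bases) :
    (tutteToPasture I₀).comp M.monomialToTutte = normalizedClass I₀ := by
  refine monomialGroup_hom_ext ?_ fun I => ?_
  · rw [MonoidHom.comp_apply, monomialToTutte_eps, tutteToPasture_tutteEps]
  · rw [MonoidHom.comp_apply, monomialToTutte_var, tutteToPasture_tutteXBasis]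

theorem tutteToPasture_monomialToTutte (I₀ : M.Bases) (m : M.degreeZero) :
    tutteToPasture I₀ (M.monomialToTutte m) = M.monomialClass m :=
  (DFunLike.congr_fun (tutteToPasture_comp I₀) m.1).trans (normalizedClass_coe I₀ m)

/-- Both groups are quotients of the monomials of degree `0`, compatibly with this map. Surjectivity
comes from `monomialClass_surjective`, injectivity from `eq_one_of_monomialClass_eq_one`. -/
theorem bijective_tutteToPasture (I₀ : M.Bases) :
    Function.Bijective ((tutteToPasture I₀).comp M.tutteGroup.subtype) := by
  constructor
  · rw [injective_iff_map_eq_one]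
    rintro ⟨t, ht⟩ h
    obtain ⟨m, hm, rfl⟩ := tutteGroup_le ht
    refine Subtype.ext (M.eq_one_of_monomialClass_eq_one (m := ⟨m, hm⟩) ?_)
    rw [← tutteToPasture_monomialToTutte I₀]
    exact h
  · intro u
    obtain ⟨m, rfl⟩ := M.monomialClass_surjective u
    exact ⟨⟨_, monomialToTutte_mem I₀ m⟩, tutteToPasture_monomialToTutte I₀ m⟩

/-- The isomorphism `(k_M^w)^× → 𝕋_M`. -/
def pastureEquivTutte (I₀ : M.Bases) : M.weakUniversalPasture.UnitGroup ≃* M.tutteGroup :=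
  (MulEquiv.ofBijective _ (bijective_tutteToPasture I₀)).symm

theorem pastureEquivTutte_monomialClass (I₀ : M.Bases) (m : M.degreeZero) :
    (pastureEquivTutte I₀ (M.monomialClass m) : M.TutteG) = M.monomialToTutte m := by
  have : pastureEquivTutte I₀ (M.monomialClass m) = ⟨_, monomialToTutte_mem I₀ m⟩ := by
    rw [pastureEquivTutte, MulEquiv.symm_apply_eq]
    exact (tutteToPasture_monomialToTutte I₀ m).symm
  rw [this]

theorem monomialToTutte_eq (i : ℕ) (e : M.Bases →₀ ℤ) :
    M.monomialToTutte ((-1) ^ i, Multiplicative.ofAdd e) =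
      M.tutteEps ^ i * e.prod fun I n => M.tutteXBasis I ^ n := by
  change unitsHom M.tutteEps M.tutteEps_sq ((-1) ^ i) * _ = _
  rw [map_pow, unitsHom_neg_one]
  rfl

theorem exists_unitMonomial_eq (m : M.degreeZero) :
    ∃ i e he, M.unitMonomial i e he = M.monomialClass m ∧
      M.monomialToTutte m = M.tutteEps ^ i * e.prod fun I n => M.tutteXBasis I ^ n := by
  obtain ⟨⟨s, e⟩, he⟩ := m
  rcases Int.units_eq_one_or s with rfl | rfl
  · refine ⟨0, Multiplicative.toAdd e, he, rfl, ?_⟩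
    rw [← monomialToTutte_eq, pow_zero]
    rfl
  · refine ⟨1, Multiplicative.toAdd e, he, rfl, ?_⟩
    rw [← monomialToTutte_eq, pow_one]
    rfl

end Matroid

/-! ### Elements of degree zero lie in the foundation -/

namespace OrderedBlueprint

variable (B : OrderedBlueprint.{u})

theorem foundationUnitsInclusion_injective : Function.Injective B.foundationUnitsInclusion := by
  refine Units.map_injective fun a b h => ?_
  have h1 : a.1.1 = b.1.1 := congrArg (fun z : B.points => z.1) h
  exact Subtype.ext (Subtype.ext h1)

/-- The submonoid generated by the fundamental elements need not be closed under inverses, so the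
inverse has to be tested separately. -/
theorem mem_range_foundationUnitsInclusion {u : B.UnitGroup} :
    u ∈ B.foundationUnitsInclusion.range ↔
      (u.1 : B.Amb) ∈ B.foundationPoints ∧ (u⁻¹.1 : B.Amb) ∈ B.foundationPoints := by
  constructor
  · rintro ⟨v, rfl⟩
    exact ⟨v.1.2, v⁻¹.1.2⟩
  · rintro ⟨h, h'⟩
    have h1 : (u.1 : B.Amb) * u⁻¹.1 = 1 := congrArg Subtype.val u.mul_inv
    have h2 : (u⁻¹.1 : B.Amb) * u.1 = 1 := congrArg Subtype.val u.inv_mul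
    refine ⟨⟨B.toSubPoints _ B.zero_mem_foundationPoints ⟨_, h⟩,
      B.toSubPoints _ B.zero_mem_foundationPoints ⟨_, h'⟩, ?_, ?_⟩, ?_⟩
    · exact Subtype.ext (Subtype.ext h1)
    · exact Subtype.ext (Subtype.ext h2)
    · exact Units.ext rfl

variable {B} in
theorem mem_foundationPoints_of_zero_le {a b e : B.Amb} (ha : a ∈ B.points) (hb : b ∈ B.points)
    (he : e ∈ B.points) (h : 0 ≤ 1 + e) (h' : 0 ≤ a + b + 1) : a ∈ B.foundationPoints :=
  Submonoid.subset_closure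
    (.inr ⟨ha, e, he, h, b, hb, 0, zero_le_one, by rwa [pow_zero]⟩)

end OrderedBlueprint

namespace Matroid

open OrderedBlueprint

section Weight

variable {E : Type u} [Fintype E] {A : Type*} [CommGroup A]

/-- The homomorphism from `ℤ^E` that is given by the images of the standard basis vectors. -/
def weightHom (u : E → A) :
    Multiplicative (E → ℤ) →* A where
  toFun f := ∏ a, u a ^ Multiplicative.toAdd f a
  map_one' := by simp
  map_mul' f g := by simp [zpow_add, Finset.prod_mul_distrib]

theorem weightHom_indicator (u : E → A) (I : Finset E) :
    weightHom u (Multiplicative.ofAdd (Set.indicator (I : Set E) 1)) = ∏ a ∈ I, u a := by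
  change ∏ a, u a ^ (Set.indicator (I : Set E) 1 a : ℤ) = _
  rw [← Finset.prod_subset (Finset.subset_univ I)]
  · refine Finset.prod_congr rfl fun a ha => ?_
    rw [Set.indicator_of_mem (Finset.mem_coe.mpr ha), Pi.one_apply, zpow_one]
  · intro a _ ha
    rw [Set.indicator_of_notMem (by simpa using ha), zpow_zero]

end Weight

variable {E : Type u} [LinearOrder E] {M : Matroid E}

section Foundation

theorem zero_le_one_add_monomialClass_eps :
    0 ≤ (1 : M.weakUniversalPasture.Amb) + (M.monomialClass M.degreeZeroEps).1.1 := by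
  have := M.weakResidueField.pasteurizationHom_mono M.zero_le_residue_eps_add
  rw [map_zero, map_add, map_one, add_comm] at this
  exact this

/-- Dividing the relation by `n` puts it into the form `0 ≤ a + b + 1`, so `m / n` is fundamental.
The middle term may be zero. -/
theorem monomialClass_mem_of_zero_le {m n : M.MonomialGroup} {x : M.plueckerBlueprint.Amb}
    (hd : M.totalDegree m = M.totalDegree n)
    (hx : x = 0 ∨ ∃ k, M.totalDegree k = M.totalDegree n ∧ x = (M.monomialToPluecker k).1)
    (h : 0 ≤ (M.monomialToPluecker m).1 + x + (M.monomialToPluecker n).1) :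
    (M.monomialClass ⟨m * n⁻¹, div_mem_degreeZero hd⟩).1.1 ∈
      M.weakUniversalPasture.foundationPoints := by
  have h1 := M.zero_le_mul_monomial h n⁻¹
  rw [add_mul, add_mul, monomial_mul, monomial_mul, mul_inv_cancel, monomial_one] at h1
  have hx' : x * (M.monomialToPluecker n⁻¹).1 ∈ M.degreeZeroPoints := by
    rcases hx with rfl | ⟨k, hk, rfl⟩
    · exact .inl (zero_mul _)
    · exact .inr ⟨k * n⁻¹, div_mem_degreeZero hk, by rw [monomial_mul]⟩
  let z : M.weakResidueField.points :=
    M.plueckerBlueprint.toSubPoints M.degreeZeroPoints (Or.inl rfl) ⟨_, hx'⟩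
  have h2 : 0 ≤ (M.residueMonomial ⟨m * n⁻¹, div_mem_degreeZero hd⟩ : M.weakResidueField.Amb) +
      z.1 + 1 := M.residue_le h1
  have h3 := M.weakResidueField.pasteurizationHom_mono h2
  rw [map_zero, map_add, map_add, map_one] at h3
  exact mem_foundationPoints_of_zero_le (M.monomialClass _).1.2
    (M.weakResidueField.toPasteurization z).2 (M.monomialClass M.degreeZeroEps).1.2
    zero_le_one_add_monomialClass_eps h3

/-- The hypotheses are symmetric in `m` and `n`, so the inverse `n / m` is fundamental too. -/
theorem monomialClass_mem_range_of_zero_le {m n : M.MonomialGroup} {x : M.plueckerBlueprint.Amb}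
    (hd : M.totalDegree m = M.totalDegree n)
    (hx : x = 0 ∨ ∃ k, M.totalDegree k = M.totalDegree n ∧ x = (M.monomialToPluecker k).1)
    (h : 0 ≤ (M.monomialToPluecker m).1 + x + (M.monomialToPluecker n).1) :
    M.monomialClass ⟨m * n⁻¹, div_mem_degreeZero hd⟩ ∈
      M.weakUniversalPasture.foundationUnitsInclusion.range := by
  rw [mem_range_foundationUnitsInclusion]
  refine ⟨monomialClass_mem_of_zero_le hd hx h, ?_⟩
  have h1 : (⟨m * n⁻¹, div_mem_degreeZero hd⟩ : M.degreeZero)⁻¹ =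
      ⟨n * m⁻¹, div_mem_degreeZero hd.symm⟩ := Subtype.ext (by simp)
  rw [← map_inv, h1]
  refine monomialClass_mem_of_zero_le hd.symm (hd ▸ hx) ?_
  rwa [add_right_comm, add_comm (M.monomialToPluecker m).1, add_right_comm] at h

variable (M) in
/-- The quotient of `(k_M^w)^×` by the units of the foundation. -/
def PastureModFoundation : Type u :=
  M.weakUniversalPasture.UnitGroup ⧸ M.weakUniversalPasture.foundationUnitsInclusion.range

instance : CommGroup M.PastureModFoundation :=
  inferInstanceAs (CommGroup (M.weakUniversalPasture.UnitGroup ⧸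
    M.weakUniversalPasture.foundationUnitsInclusion.range))

variable (M) in
/-- The quotient map from `(k_M^w)^×`. -/
def modFoundation : M.weakUniversalPasture.UnitGroup →* M.PastureModFoundation :=
  QuotientGroup.mk' M.weakUniversalPasture.foundationUnitsInclusion.range

theorem modFoundation_eq_one_iff {u : M.weakUniversalPasture.UnitGroup} :
    M.modFoundation u = 1 ↔ u ∈ M.weakUniversalPasture.foundationUnitsInclusion.range :=
  QuotientGroup.eq_one_iff u

/-- The class of a Laurent monomial in the quotient of `(k_M^w)^×` by the units of the
foundation. -/
def foundationClass (I₀ : M.Bases) : M.MonomialGroup →* M.PastureModFoundation :=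
  M.modFoundation.comp (normalizedClass I₀)

theorem foundationClass_eq_of_zero_le (I₀ : M.Bases) {m n : M.MonomialGroup}
    {x : M.plueckerBlueprint.Amb} (hd : M.totalDegree m = M.totalDegree n)
    (hx : x = 0 ∨ ∃ k, M.totalDegree k = M.totalDegree n ∧ x = (M.monomialToPluecker k).1)
    (h : 0 ≤ (M.monomialToPluecker m).1 + x + (M.monomialToPluecker n).1) :
    foundationClass I₀ m = foundationClass I₀ n := by
  rw [← mul_inv_eq_one, ← map_inv, ← map_mul]
  refine modFoundation_eq_one_iff.mpr ?_
  have h1 : normalizedClass I₀ (m * n⁻¹) = M.monomialClass ⟨m * n⁻¹, div_mem_degreeZero hd⟩ :=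
    normalizedClass_coe I₀ ⟨m * n⁻¹, div_mem_degreeZero hd⟩
  rw [h1]
  exact monomialClass_mem_range_of_zero_le hd hx h

theorem foundationClass_eps (I₀ : M.Bases) : foundationClass I₀ M.monomialEps = 1 := by
  have h := M.zero_le_one_add_eps
  rw [← monomial_one, add_comm] at h
  -- The relation `0 ≤ ε + 0 + 1` makes `ε` itself fundamental.
  rw [foundationClass_eq_of_zero_le I₀ (m := M.monomialEps) (n := 1) (x := 0)
    (by rw [totalDegree_eps, map_one]) (.inl rfl) (by rwa [add_zero]), map_one]

theorem isSquareMul_of_lt {A : Type*} [CommGroup A] {y : Finset E → A}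
    (h : ∀ (J : Finset E) (a b c d : E), J.card + 2 = M.rk → a < b → b < c → c < d →
      a ∉ J → b ∉ J → c ∉ J → d ∉ J →
      (M.IsFinBase (insert a (insert c J)) → M.IsFinBase (insert b (insert d J)) →
        M.IsFinBase (insert a (insert d J)) → M.IsFinBase (insert b (insert c J)) →
        y (insert a (insert c J)) * y (insert b (insert d J)) =
          y (insert a (insert d J)) * y (insert b (insert c J))) ∧
      (M.IsFinBase (insert a (insert b J)) → M.IsFinBase (insert c (insert d J)) →
        M.IsFinBase (insert a (insert d J)) → M.IsFinBase (insert b (insert c J)) →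
        y (insert a (insert b J)) * y (insert c (insert d J)) =
          y (insert a (insert d J)) * y (insert b (insert c J))) ∧
      (M.IsFinBase (insert a (insert b J)) → M.IsFinBase (insert c (insert d J)) →
        M.IsFinBase (insert a (insert c J)) → M.IsFinBase (insert b (insert d J)) →
        y (insert a (insert b J)) * y (insert c (insert d J)) =
          y (insert a (insert c J)) * y (insert b (insert d J)))) : M.IsSquareMul y := by
  intro J k₁ k₂ l₁ l₂ n₁ n₂ n₃ n₄ n₅ n₆ hk₁ hk₂ hl₁ hl₂ h₁ h₂ h₃ h₄
  wlog hk : k₁ < k₂ generalizing k₁ k₂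
  · rw [mul_comm, ← this k₂ k₁ n₁.symm n₄ n₅ n₂ n₃ hk₂ hk₁ h₄ h₃ h₂ h₁
      (lt_of_le_of_ne (not_lt.mp hk) n₁.symm), mul_comm]
  wlog hl : l₁ < l₂ generalizing l₁ l₂
  · exact (this l₂ l₁ n₆.symm hl₂ hl₁ n₃ n₂ n₅ n₄ h₃ h₄ h₁ h₂
      (lt_of_le_of_ne (not_lt.mp hl) n₆.symm)).symm
  wlog hkl : k₁ < l₁ generalizing k₁ k₂ l₁ l₂
  · have := this l₁ l₂ n₆ hl₁ hl₂ hl k₁ k₂ n₁ hk₁ hk₂ n₂.symm n₄.symm n₃.symm n₅.symm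
      (by rwa [Finset.insert_comm])
      (by rwa [Finset.insert_comm]) (by rwa [Finset.insert_comm]) (by rwa [Finset.insert_comm])
      hk (lt_of_le_of_ne (not_lt.mp hkl) n₂.symm)
    rw [Finset.insert_comm l₁ k₁, Finset.insert_comm l₂ k₂, Finset.insert_comm l₁ k₂,
      Finset.insert_comm l₂ k₁] at this
    rw [this, mul_comm]
  have hJ : J.card + 2 = M.rk := by
    rw [← h₁.card_eq_rk, Finset.card_insert_of_notMem (by simp [n₂, hk₁]),
      Finset.card_insert_of_notMem hl₁]
  rcases n₄.lt_or_gt with h5 | h5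
  · exact (h J k₁ k₂ l₁ l₂ hJ hk h5 hl hk₁ hk₂ hl₁ hl₂).1 h₁ h₂ h₃ h₄
  rcases n₅.lt_or_gt with h6 | h6
  · have := (h J k₁ l₁ k₂ l₂ hJ hkl h5 h6 hk₁ hl₁ hk₂ hl₂).2.1 h₁ h₂ h₃
      (by rwa [Finset.insert_comm])
    rwa [Finset.insert_comm l₁ k₂] at this
  · have := (h J k₁ l₁ l₂ k₂ hJ hkl hl h6 hk₁ hl₁ hl₂ hk₂).2.2 h₁ (by rwa [Finset.insert_comm])
      h₃ (by rwa [Finset.insert_comm])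
    rwa [Finset.insert_comm l₁ k₂, Finset.insert_comm l₂ k₂] at this

theorem plueckerVar_mul_eq_zero_or (I K : Finset E) :
    M.plueckerVar I * M.plueckerVar K = 0 ∨ ∃ k, M.totalDegree k = Multiplicative.ofAdd 2 ∧
      M.plueckerVar I * M.plueckerVar K = (M.monomialToPluecker k).1 := by
  by_cases h : M.IsFinBase I ∧ M.IsFinBase K
  · exact .inr ⟨_, totalDegree_basisMonomial_mul h.1 h.2, plueckerVar_mul h.1 h.2⟩
  · exact .inl (plueckerVar_mul_eq_zero h)

/-- A square of bases supplies two nonzero products of a Plücker relation, and the third product,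
zero or not, serves as the middle term. The sign `ε` disappears because it is trivial modulo the
foundation. -/
theorem isSquareMul_foundationClass (I₀ : M.Bases) :
    M.IsSquareMul fun I => foundationClass I₀ (M.basisMonomial I) := by
  refine isSquareMul_of_lt fun J a b c d hJ h₁ h₂ h₃ ha hb hc hd => ?_
  have h := zero_le_pluecker hJ h₁ h₂ h₃ ha hb hc hd
  have e12 := plueckerVar_mul_eq_zero_or (M := M) (insert a (insert b J)) (insert c (insert d J))
  have e13 := plueckerVar_mul_eq_zero_or (M := M) (insert a (insert c J)) (insert b (insert d J))
  have e14 := plueckerVar_mul_eq_zero_or (M := M) (insert a (insert d J)) (insert b (insert c J))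
  simp only [← map_mul]
  refine ⟨fun h4 h5 h6 h7 => ?_, fun h4 h5 h6 h7 => ?_, fun h4 h5 h6 h7 => ?_⟩
  · rw [plueckerVar_mul h4 h5, plueckerVar_mul h6 h7, monomial_mul,
      add_comm (M.plueckerVar _ * _)] at h
    have hn := totalDegree_basisMonomial_mul h6 h7
    have := foundationClass_eq_of_zero_le I₀ (by
      rw [map_mul M.totalDegree M.monomialEps, totalDegree_eps, one_mul,
        totalDegree_basisMonomial_mul h4 h5, hn]) (hn.symm ▸ e12) h
    rwa [map_mul _ M.monomialEps, foundationClass_eps, one_mul] at this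
  · rw [plueckerVar_mul h4 h5, plueckerVar_mul h6 h7] at h
    have hn := totalDegree_basisMonomial_mul h6 h7
    refine foundationClass_eq_of_zero_le I₀ (by
      rw [totalDegree_basisMonomial_mul h4 h5, hn]) (hn.symm ▸ ?_) h
    rcases e13 with e | ⟨k, hk, e⟩
    · exact .inl (by rw [e, mul_zero])
    · exact .inr ⟨M.monomialEps * k, by rw [map_mul, totalDegree_eps, one_mul, hk],
        by rw [e, monomial_mul]⟩
  · rw [plueckerVar_mul h4 h5, plueckerVar_mul h6 h7, monomial_mul, add_right_comm] at h
    have hn := totalDegree_basisMonomial_mul h6 h7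
    have hn' : M.totalDegree (M.monomialEps * (M.basisMonomial (insert a (insert c J)) *
        M.basisMonomial (insert b (insert d J)))) = Multiplicative.ofAdd 2 := by
      rw [map_mul M.totalDegree M.monomialEps, totalDegree_eps, one_mul, hn]
    have := foundationClass_eq_of_zero_le I₀ (by
      rw [totalDegree_basisMonomial_mul h4 h5, hn']) (hn'.symm ▸ e14) h
    rwa [map_mul _ M.monomialEps, foundationClass_eps, one_mul] at this

/-- By `IsSquareMul.exists_eq_prod`, the class modulo the foundation factors through the total
degree and `deg_E`, and both are trivial on `m`. -/
theorem monomialClass_mem_range_of_degG_eq_one [Fintype E] (I₀ : M.Bases) {m : M.degreeZero}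
    (hm : M.degG (M.monomialToTutte m) = 1) :
    M.monomialClass m ∈ M.weakUniversalPasture.foundationUnitsInclusion.range := by
  obtain ⟨c, u, h⟩ := (isSquareMul_foundationClass I₀).exists_eq_prod
  -- The constant `c` is weighted by the total degree and `u` by `deg_E`. It suffices to compare the
  -- values at `ε` and at each `x_I`.
  have key : foundationClass I₀ = (zpowersHom _ c).comp M.totalDegree *
      (weightHom u).comp (M.degG.comp M.monomialToTutte) := by
    refine monomialGroup_hom_ext ?_ fun I => ?_
    · simp only [MonoidHom.mul_apply, MonoidHom.comp_apply, foundationClass_eps, totalDegree_eps,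
        monomialToTutte_eps, degG_tutteEps, map_one, mul_one]
    · have hI : M.IsFinBase I.1 := I.2
      have := h I.1 hI
      simp only [basisMonomial, dif_pos hI] at this
      rw [MonoidHom.mul_apply, MonoidHom.comp_apply, MonoidHom.comp_apply, MonoidHom.comp_apply,
        totalDegree_var, monomialToTutte_var, degG_tutteXBasis, weightHom_indicator]
      simpa using this
  have h1 := DFunLike.congr_fun key m.1
  rw [MonoidHom.mul_apply, MonoidHom.comp_apply, MonoidHom.comp_apply, MonoidHom.comp_apply, hm,
    mem_degreeZero_iff.mp m.2, map_one, map_one, mul_one] at h1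
  rw [← normalizedClass_coe I₀]
  exact modFoundation_eq_one_iff.mp h1

end Foundation

end Matroid

/-! ### Units of the foundation have degree zero -/

namespace Matroid

open OrderedBlueprint

variable {E : Type u} [LinearOrder E] (M : Matroid E)

theorem pastureHom_mem_groupPoints {x : M.weakUniversalPasture.Amb}
    (hx : x ∈ M.weakUniversalPasture.points) : M.pastureHom x ∈ groupPoints M.TutteG := by
  obtain ⟨a, ha⟩ := M.weakResidueField.exists_toPasteurization_eq
    (M.residueMonomial M.degreeZeroEps).2 M.zero_le_residue_eps_add ⟨x, hx⟩
  have h : M.pastureHom x = M.residueHom a.1 :=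
    (congrArg (fun z : M.weakUniversalPasture.points => M.pastureHom z.1) ha.symm).trans
      (tensorLift_tensorHom M.residueHom M.residueHom_mono M.signHom M.zero_le_one_add_signHom a.1)
  rw [h]
  exact M.residueHom_mem a.2

theorem mapDomain_pastureHom_mem_noSimpleTerm {x : M.weakUniversalPasture.Amb} (h : 0 ≤ x) :
    MonoidAlgebra.mapDomainRingHom ℕ M.degG (M.pastureHom x) ∈ noSimpleTerm _ := by
  have h1 := M.pastureHom_mono _ _ h
  rw [map_zero] at h1
  exact ((ofIdeal_zero_le (N := nullIdeal M.tutteEps M.degG)).mp h1).2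

/-- The points of `ℕ[G_M]` of degree `0`, including `0`. -/
def degreeZeroTuttePoints : Submonoid (MonoidAlgebra ℕ M.TutteG) where
  carrier := {x | x = 0 ∨ ∃ g, M.degG g = 1 ∧ x = MonoidAlgebra.single g 1}
  one_mem' := .inr ⟨1, map_one _, rfl⟩
  mul_mem' := by
    rintro _ _ (rfl | ⟨g, hg, rfl⟩) (rfl | ⟨h, hh, rfl⟩)
    · exact .inl (mul_zero _)
    · exact .inl (zero_mul _)
    · exact .inl (mul_zero _)
    · exact .inr ⟨g * h, by rw [map_mul, hg, hh, mul_one],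
        by rw [MonoidAlgebra.single_mul_single, mul_one]⟩

theorem mem_degreeZeroTuttePoints_of_mem_noSimpleTerm {x y : MonoidAlgebra ℕ M.TutteG}
    {g : M.TutteG}
    (hx : x ∈ groupPoints M.TutteG) (hy : y ∈ groupPoints M.TutteG) (hg : M.degG g = 1)
    (h : MonoidAlgebra.mapDomainRingHom ℕ M.degG (x + y + MonoidAlgebra.single g 1) ∈
      noSimpleTerm _) : x ∈ M.degreeZeroTuttePoints := by
  rcases hx with rfl | ⟨a, rfl⟩
  · exact .inl rfl
  refine .inr ⟨a, ?_, rfl⟩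
  rw [map_add, map_add] at h
  rcases hy with rfl | ⟨b, rfl⟩
  · simp only [MonoidAlgebra.mapDomainRingHom_apply, MonoidAlgebra.mapDomain_single, map_zero,
      add_zero, hg] at h
    exact eq_of_add_mem_noSimpleTerm h
  · simp only [MonoidAlgebra.mapDomainRingHom_apply, MonoidAlgebra.mapDomain_single, hg] at h
    exact eq_of_add_add_mem_noSimpleTerm h

theorem exists_eq_single_of_one_add {x : MonoidAlgebra ℕ M.TutteG} (hx : x ∈ groupPoints M.TutteG)
    (h : MonoidAlgebra.mapDomainRingHom ℕ M.degG (1 + x) ∈ noSimpleTerm _) :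
    ∃ g, M.degG g = 1 ∧ x = MonoidAlgebra.single g 1 := by
  rcases hx with rfl | ⟨g, rfl⟩
  · rw [add_zero, map_one] at h
    exact absurd h single_notMem_noSimpleTerm
  · refine ⟨g, ?_, rfl⟩
    rw [map_add, map_one, MonoidAlgebra.one_def, MonoidAlgebra.mapDomainRingHom_apply,
      MonoidAlgebra.mapDomain_single] at h
    exact (eq_of_add_mem_noSimpleTerm h).symm

/-- Points that are zero or of degree `0` form a submonoid, so fundamental elements suffice. Any
weak inverse `e` of `1` has an image of degree `0`, since in `1 + e` no degree may occur exactly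
once; the same condition on `a + b + e ^ i` then forces degree `0` on a nonzero image of `a`. -/
theorem pastureHom_mem_of_mem_foundationPoints {x : M.weakUniversalPasture.Amb}
    (hx : x ∈ M.weakUniversalPasture.foundationPoints) :
    M.pastureHom x ∈ M.degreeZeroTuttePoints := by
  have key : M.weakUniversalPasture.foundationPoints ≤
      M.degreeZeroTuttePoints.comap
        (M.pastureHom : M.weakUniversalPasture.Amb →* M.tutteBlueprint.Amb) := by
    refine Submonoid.closure_le.mpr ?_
    rintro a (rfl | ⟨ha, e, he, h0e, b, hb, i, -, h⟩)
    · exact .inl (map_zero M.pastureHom)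
    · have h1 := M.mapDomain_pastureHom_mem_noSimpleTerm h0e
      have h2 := M.mapDomain_pastureHom_mem_noSimpleTerm h
      rw [map_add, map_one] at h1
      rw [map_add, map_add, map_pow] at h2
      obtain ⟨g, hg, h3⟩ := M.exists_eq_single_of_one_add (M.pastureHom_mem_groupPoints he) h1
      rw [h3] at h2
      refine M.mem_degreeZeroTuttePoints_of_mem_noSimpleTerm (g := g ^ i)
        (M.pastureHom_mem_groupPoints ha) (M.pastureHom_mem_groupPoints hb)
        (by rw [map_pow, hg, one_pow]) ?_
      have h4 := MonoidAlgebra.single_pow (R := ℕ) g 1 i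
      rw [one_pow] at h4
      rw [← h4]
      exact h2
  exact key hx

theorem mem_range_iff_degG_eq_one [Fintype E] {m : M.degreeZero} :
    M.monomialClass m ∈ M.weakUniversalPasture.foundationUnitsInclusion.range ↔
      M.degG (M.monomialToTutte m) = 1 := by
  obtain ⟨I₀⟩ := M.exists_bases
  refine ⟨fun h => ?_, monomialClass_mem_range_of_degG_eq_one I₀⟩
  have h1 := M.pastureHom_mem_of_mem_foundationPoints
    (mem_range_foundationUnitsInclusion _ |>.mp h).1
  rw [pastureHom_monomialClass] at h1
  rcases h1 with h1 | ⟨g, hg, h1⟩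
  · exact absurd (MonoidAlgebra.single_eq_zero.mp h1) one_ne_zero
  · rwa [(MonoidAlgebra.single_left_inj one_ne_zero).mp h1]

end Matroid

end

/-! ### The isomorphism and its restriction to the foundation -/

theorem mainTheorem6 {E : Type*} [Fintype E] [LinearOrder E] (M : Matroid E) :
    -- there is exactly one isomorphism `(k_M^w)^× → 𝕋_M` with `ε ^ i ∏ x_I ^ e_I ↦ ε ^ i ∏ X_I ^ e_I`
    (∃! Φ : M.weakUniversalPasture.UnitGroup ≃* M.tutteGroup,
      ∀ (i : ℕ) (e : M.Bases →₀ ℤ) (he : e.sum (fun _ n => n) = 0),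
        (Φ (M.unitMonomial i e he) : M.TutteG) =
          M.tutteEps ^ i * e.prod (fun I n => M.tutteXBasis I ^ n)) ∧
    -- and it restricts to an isomorphism `(k_M^f)^× → 𝕋_M^{(0)}`
    ∀ Φ : M.weakUniversalPasture.UnitGroup ≃* M.tutteGroup,
      (∀ (i : ℕ) (e : M.Bases →₀ ℤ) (he : e.sum (fun _ n => n) = 0),
        (Φ (M.unitMonomial i e he) : M.TutteG) =
          M.tutteEps ^ i * e.prod (fun I n => M.tutteXBasis I ^ n)) →
      ∃ Ψ : M.foundation.UnitGroup ≃* M.innerTutteGroup,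
        ∀ u : M.foundation.UnitGroup,
          (Ψ u : M.tutteGroup) = Φ (M.weakUniversalPasture.foundationUnitsInclusion u) := by
  -- The prescribed values determine `Φ` on all classes of monomials of degree `0`, and these
  -- exhaust the units.
  have key : ∀ Φ : M.weakUniversalPasture.UnitGroup ≃* M.tutteGroup,
      (∀ (i : ℕ) (e : M.Bases →₀ ℤ) (he : e.sum (fun _ n => n) = 0),
        (Φ (M.unitMonomial i e he) : M.TutteG) =
          M.tutteEps ^ i * e.prod (fun I n => M.tutteXBasis I ^ n)) →
      ∀ m : M.degreeZero, (Φ (M.monomialClass m) : M.TutteG) = M.monomialToTutte m := by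
    intro Φ hΦ m
    obtain ⟨i, e, he, h1, h2⟩ := Matroid.exists_unitMonomial_eq m
    rw [← h1, hΦ, h2]
  refine ⟨?_, fun Φ hΦ => ?_⟩
  · obtain ⟨I₀⟩ := M.exists_bases
    refine ⟨Matroid.pastureEquivTutte I₀, fun i e he => ?_, fun Φ hΦ => ?_⟩
    · rw [Matroid.unitMonomial, Matroid.pastureEquivTutte_monomialClass,
        ← Matroid.monomialToTutte_eq]
    · refine MulEquiv.ext fun u => Subtype.ext ?_
      obtain ⟨m, rfl⟩ := M.monomialClass_surjective u
      rw [key Φ hΦ, Matroid.pastureEquivTutte_monomialClass]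
  -- The units of the foundation embed into those of `k_M^w`, so it suffices that `Φ` carries their
  -- image onto the kernel of `deg_E`.
  · have hmap : M.weakUniversalPasture.foundationUnitsInclusion.range.map Φ.toMonoidHom =
        M.innerTutteGroup := by
      ext t
      obtain ⟨u, rfl⟩ := Φ.surjective t
      obtain ⟨m, rfl⟩ := M.monomialClass_surjective u
      rw [Subgroup.mem_map_equiv, MulEquiv.symm_apply_apply, M.mem_range_iff_degG_eq_one,
        ← key Φ hΦ]
      rfl
    exact ⟨((MonoidHom.ofInjective
      M.weakUniversalPasture.foundationUnitsInclusion_injective).trans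
        (Φ.subgroupMap _)).trans (MulEquiv.subgroupCongr hmap), fun u => rfl⟩
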